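/- **Setting.** Let $P$ be an ergodic reversible Markov chain on the vertices of a finite graph $G(V,E)$, $|V|\ge 2$, with stationary distribution $\pi$ and with all eigenvalues in $[0,1]$ (lazy walk), and let $g\in V$ be the single marked vertex. Let $P'$ be $P$ with the outgoing transitions of $g$ replaced by a self-loop, $P(s)=(1-s)P+sP'$, $D(P)=\sqrt{P\circ P^T}$ (entrywise), and let $\Delta(s)$ be $1$ minus the largest eigenvalue $\neq 1$ of $P(s)$. Let $\mathrm{HT}=\max_{x\in V}\mathrm{HT}(P,\{x\})$, where $\mathrm{HT}(P,\{x\})=\sum_{\lambda'_k\ne 1}|\langle v'_k|\bar\pi_x\rangle|^2/(1-\lambda'_k)$, with $\lambda'_k,|v'_k\rangle$ the eigenvalues and an orthonormal eigenbasis of the discriminant matrix of the chain made absorbing at $x$, and $|\bar\pi_x\rangle$ the normalized restriction of $|\pi\rangle=\sum_y\sqrt{\pi_y}|y\rangle$ to $V\setminus\{x\}$. For $r\ge1$ put $\theta_i=\frac{i\pi}{2(r+1)}$ and $s_i=\frac{1-\pi_g/\sin^2\theta_i}{1-\pi_g}$, $1\le i\le r$, and assume $0\le s_i\le 1$ for all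 $i$ (that is, $\pi_g\le\sin^2\frac{\pi}{2(r+1)}$). **Walk and fast-forwarding.** $W(s)=V(s)^\dagger\, S\, V(s)\,R_{\bar 0}$ on $\mathbb C^V\otimes\mathbb C^V$, where $V(s)$ is any unitary with $V(s)|x\rangle|\bar0\rangle=|x\rangle\sum_y\sqrt{P(s)_{xy}}|y\rangle$, $S$ swaps the two registers on pairs that are edges and is the identity on the other pairs, and $R_{\bar0}=I\otimes(2|\bar0\rangle\langle\bar0|-I)$. For $t,\tau\in\mathbb N$ let $U_{qff}=V_q^\dagger\big(\sum_{l<2^\tau}W(s)^l\otimes|l\rangle\langle l|\big)V_q$, where $V_q$ is any unitary on $\tau$ qubits with $V_q|0^\tau\rangle=\sum_{l<2^\tau}\sqrt{p_l/(1-\sum_{x=2^\tau}^{t}p_x)}\,|l\rangle$ and $p_l$ is the probability that the simple random walk on $\mathbb Z$ from $0$ is at distance $l$ from $0$ at time $t$. On five registers $R_1,\dots,R_5$ (two vertices, $\tau$ qubits, $1$ qubit, $r$ qubits), the operator $U_{qfs}(W(s_i),\tau)$ does the following in order: flip $R_4$ if $R_2$ is $|\bar0\rangle$; flip $R_4$;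 apply $U_{qff}$ for $s=s_i$ and $t=\lceil\frac{2}{\Delta(s_i)}\log\frac{2r}{\varepsilon}\rceil$; flip qubit $i$ of $R_5$ if $R_2,R_3,R_4$ are $|\bar0\rangle,|0^\tau\rangle,|0\rangle$; apply $U_{qff}^\dagger$; flip $R_4$; flip $R_4$ if $R_2$ is $|\bar0\rangle$. **Algorithm.** Given an error $\varepsilon$ and $\Gamma=\Theta(\log(\varepsilon^{-1})\sqrt{\mathrm{HT}})$, put $\tau=\lceil\log_2\Gamma\rceil$, prepare $|\pi\rangle|\bar0\rangle|0^\tau\rangle|0\rangle|0^r\rangle$ and measure whether $R_1$ is $|g\rangle$; if so, output $g$ and stop; otherwise apply $U_{qfs}(W(s_1),\tau),\dots,U_{qfs}(W(s_r),\tau)$ one after the other, measure $R_1$ and output the result. Let $p_{succ}$ be the probability that the final measurement gives $g$, conditioned on the first one not having found it. Preparing the initial state costs $\mathcal S$, each controlled call to $W(s_i)$ or $W(s_i)^\dagger$ costs $\mathcal U+\mathcal C$ (one update and one check), and the initial check costs $\mathcal C$. **Theorem.** There are a universal constant $\varepsilon_0\in(0,1)$ and constants $\kappa_r>0$ depending only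 on $r$ such that the following holds. 1. For every $r\ge1$ and $K\ge\kappa_r$ there are constants $c_1,c_2>0$ depending only on $r$ and $K$ such that, for all data as above, all $0<\varepsilon\le\varepsilon_0$ and all $\Gamma$ with $\kappa_r\log(\varepsilon^{-1})\sqrt{\mathrm{HT}}\le\Gamma\le K\log(\varepsilon^{-1})\sqrt{\mathrm{HT}}$: (a) $\sqrt{p_{succ}}\ge\cos^{r+1}\!\big(\frac{\pi}{2(r+1)}\big)-\varepsilon$, and if $r\ge10$ then $p_{succ}>4/5$ and the algorithm as a whole outputs $g$ with probability more than $4/5$; (b) the cost lies between $\mathcal S+c_1\log(\varepsilon^{-1})\sqrt{\mathrm{HT}}\,(\mathcal U+\mathcal C)$ and $\mathcal S+c_2\log(\varepsilon^{-1})\sqrt{\mathrm{HT}}\,(\mathcal U+\mathcal C)$; (c) the number $\tau+1+r$ of ancilla qubits lies between $c_1(\log\log\varepsilon^{-1}+\log\sqrt{\mathrm{HT}})$ and $c_2(\log\log\varepsilon^{-1}+\log\sqrt{\mathrm{HT}})$. 2. (No soufflé problem.) For every $r\ge1$ there is $\varepsilon_1>0$, depending only on $r$, such that for every $r'>r$,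 all data for which the $s_i$ lie in $[0,1]$ both for $r$ and for $r'$, all $0<\varepsilon\le\varepsilon_1$ and all $\Gamma\ge\kappa_r\log(\varepsilon^{-1})\sqrt{\mathrm{HT}}$, $\Gamma'\ge\kappa_{r'}\log(\varepsilon^{-1})\sqrt{\mathrm{HT}}$, both $p_{succ}$ and the success probability of the whole algorithm are strictly larger with $r'$ rounds (and $\Gamma'$) than with $r$ rounds (and $\Gamma$). Moreover $\cos^{r+1}\!\big(\frac{\pi}{2(r+1)}\big)$ is strictly increasing in $r$ and tends to $1$. -/

import Mathlib

noncomputable section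

/-! ### Markov chains -/

/-- `P` is the transition matrix of an ergodic reversible Markov chain on the graph `G`, with
stationary distribution `π`, all of whose eigenvalues are nonnegative (as after passing to the
lazy walk). -/
structure IsErgodicReversible {V : Type*} [Fintype V] [DecidableEq V]
    (G : SimpleGraph V) (P : Matrix V V ℝ) (π : V → ℝ) : Prop where
  nonneg : ∀ x y, 0 ≤ P x y
  row_sum : ∀ x, ∑ y, P x y = 1
  /-- transitions follow the edges of the graph, or stay put -/
  support : ∀ x y, x ≠ y → 0 < P x y → G.Adj x y
  /-- every vertex can reach every other vertex -/
  irreducible : ∀ x y, ∃ n : ℕ, 0 < (P ^ n) x y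
  /-- the lengths of the closed directed walks have greatest common divisor `1` -/
  aperiodic : ∀ d : ℕ, (∀ (x : V) (n : ℕ), 0 < n → 0 < (P ^ n) x x → d ∣ n) → d = 1
  dist_nonneg : ∀ x, 0 ≤ π x
  dist_sum : ∑ x, π x = 1
  stationary : ∀ y, ∑ x, π x * P x y = π y
  reversible : ∀ x y, π x * P x y = π y * P y x
  eigenvalue_nonneg : ∀ μ ∈ spectrum ℝ P, 0 ≤ μ

/-- The discriminant matrix `√(P ∘ Pᵀ)`, computed entrywise. -/
def discriminant {V : Type*} (P : Matrix V V ℝ) : Matrix V V ℝ :=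
  Matrix.of fun x y => √(P x y * P y x)

theorem discriminant_isHermitian {V : Type*} (P : Matrix V V ℝ) :
    (discriminant P).IsHermitian := by
  ext x y
  simp [discriminant, Matrix.conjTranspose_apply, mul_comm]

/-- The absorbing chain `P'`: transitions out of marked vertices become self-loops. -/
def absorbing {V : Type*} [DecidableEq V] (P : Matrix V V ℝ) (M : Finset V) : Matrix V V ℝ :=
  Matrix.of fun x y => if x ∈ M then (if y = x then 1 else 0) else P x y

/-- The interpolated chain `P(s) = (1 - s) P + s P'` with the single marked vertex `g`. -/
def interpolated {V : Type*} [DecidableEq V] (P : Matrix V V ℝ) (g : V) (s : ℝ) :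
    Matrix V V ℝ :=
  (1 - s) • P + s • absorbing P {g}

/-- The amplitudes of `|π̄⟩`, the normalized restriction of `|π⟩` to the unmarked vertices. -/
def unmarkedAmplitude {V : Type*} [DecidableEq V] (π : V → ℝ) (M : Finset V) (x : V) : ℝ :=
  if x ∈ M then 0 else √(π x) / √(1 - ∑ m ∈ M, π m)

/-- The hitting time `HT(P, M) = ∑ |⟨v'ₖ|π̄⟩|² / (1 - λ'ₖ)`, the sum running over the eigenvalues
`λ'ₖ ≠ 1` of the discriminant matrix of the absorbing chain, with an orthonormal eigenbasis. -/
def hittingTime {V : Type*} [Fintype V] [DecidableEq V] (P : Matrix V V ℝ) (π : V → ℝ)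
    (M : Finset V) : ℝ :=
  ∑ k with (discriminant_isHermitian (absorbing P M)).eigenvalues k ≠ 1,
    (∑ x, (discriminant_isHermitian (absorbing P M)).eigenvectorBasis k x *
        unmarkedAmplitude π M x) ^ 2 /
      (1 - (discriminant_isHermitian (absorbing P M)).eigenvalues k)

/-- The maximum `HT = max_x HT(P, {x})` over all vertices. -/
def maxHittingTime {V : Type*} [Fintype V] [DecidableEq V] (P : Matrix V V ℝ) (π : V → ℝ) : ℝ :=
  ⨆ x : V, hittingTime P π {x}

/-- The eigenvalue gap `Δ = 1 - λ₁`, where `λ₁` is the largest eigenvalue other than `1`. -/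
def eigenvalueGap {V : Type*} [Fintype V] [DecidableEq V] (P : Matrix V V ℝ) : ℝ :=
  1 - sSup (spectrum ℝ P \ {1})

/-! ### Quantum walk operators on `ℂ^V ⊗ ℂ^V` -/

open Classical in
/-- The swap operator: `|x⟩|y⟩ ↦ |y⟩|x⟩` if `(x, y)` is an edge, and the identity otherwise. -/
def swapOperator {V : Type*} (G : SimpleGraph V) : Matrix (V × V) (V × V) ℂ :=
  Matrix.of fun a b => if a = (if G.Adj b.1 b.2 then (b.2, b.1) else b) then 1 else 0

/-- The reflection `I ⊗ (2|0̄⟩⟨0̄| - I)`, with `|0̄⟩ = |o⟩`. -/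
def reflection {V : Type*} [DecidableEq V] (o : V) : Matrix (V × V) (V × V) ℂ :=
  Matrix.of fun a b => if a = b then (if b.2 = o then 1 else -1) else 0

/-- `A` is a unitary `V(P)`: it maps `|x⟩|0̄⟩` to `|x⟩ ∑_y √(P x y) |y⟩`. -/
structure IsWalkIsometry {V : Type*} [Fintype V] [DecidableEq V] (P : Matrix V V ℝ) (o : V)
    (A : Matrix (V × V) (V × V) ℂ) : Prop where
  unitary : A ∈ Matrix.unitaryGroup (V × V) ℂ
  apply : ∀ x z y, A (z, y) (x, o) = if z = x then ((√(P x y) : ℝ) : ℂ) else 0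

/-- The walk operator `W = V† · S · V · R`. -/
def walkOperator {V : Type*} [Fintype V] [DecidableEq V] (G : SimpleGraph V) (o : V)
    (A : Matrix (V × V) (V × V) ℂ) : Matrix (V × V) (V × V) ℂ :=
  A.conjTranspose * swapOperator G * A * reflection o

/-! ### Quantum fast-forwarding -/

/-- The probability that the simple symmetric random walk on `ℤ` started at `0` is at distance
`l` from `0` at time `t`. -/
def walkDistanceProb (t l : ℕ) : ℝ :=
  ((Finset.univ.filter fun w : Fin t → Bool =>
    (∑ j, if w j then (1 : ℤ) else -1).natAbs = l).card : ℝ) / 2 ^ t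

/-- The number written in binary in a register of `τ` qubits (qubit `j` has weight `2 ^ j`). -/
def registerValue {τ : ℕ} (l : Fin τ → Bool) : ℕ :=
  ∑ j, if l j then 2 ^ (j : ℕ) else 0

/-- `A` is a unitary `V_q` on `τ` qubits: it maps `|0^τ⟩` to
`∑_{l < 2^τ} √(p_l / (1 - ∑_{x = 2^τ}^t p_x)) |l⟩`. -/
structure IsStepPreparation (t τ : ℕ) (A : Matrix (Fin τ → Bool) (Fin τ → Bool) ℂ) : Prop where
  unitary : A ∈ Matrix.unitaryGroup (Fin τ → Bool) ℂ
  apply : ∀ l, A l (fun _ => false) =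
    ((√(walkDistanceProb t (registerValue l) /
        (1 - ∑ x ∈ Finset.Icc (2 ^ τ) t, walkDistanceProb t x)) : ℝ) : ℂ)

/-! ### The search algorithm as a circuit -/

/-- Basis states of the five registers `R₁, …, R₅`: two vertices, `τ` qubits, one qubit and
`r` qubits. -/
abbrev Reg (V : Type*) (r τ : ℕ) : Type _ :=
  V × V × (Fin τ → Bool) × Bool × (Fin r → Bool)

set_option synthInstance.maxSize 1000 in
instance Reg.decidableEq {V : Type*} [DecidableEq V] (r τ : ℕ) : DecidableEq (Reg V r τ) :=
  inferInstance

/-- The number of ancilla qubits: the registers `R₃, R₄, R₅`. -/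
def ancillaQubits (r τ : ℕ) : ℕ := τ + 1 + r

/-- The unitaries `V(P(s_i))` and `V_q` (for `t i` walk steps) used by the algorithm; the values
of these unitaries outside the prescribed ones are arbitrary. -/
structure Realization {V : Type*} [Fintype V] [DecidableEq V] (P : Matrix V V ℝ) (g o : V)
    {r : ℕ} (s : Fin r → ℝ) (t : Fin r → ℕ) (τ : ℕ) where
  walk : Fin r → Matrix (V × V) (V × V) ℂ
  prep : Fin r → Matrix (Fin τ → Bool) (Fin τ → Bool) ℂ
  isWalk : ∀ i, IsWalkIsometry (interpolated P g (s i)) o (walk i)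
  isPrep : ∀ i, IsStepPreparation (t i) τ (prep i)

/-- The elementary operations of the circuit. -/
inductive Gate (r τ : ℕ) : Type where
  /-- `W(s_i)` controlled by qubit `j` of `R₃` -/
  | ctrlWalk (i : Fin r) (j : Fin τ)
  /-- `W(s_i)†` controlled by qubit `j` of `R₃` -/
  | ctrlWalkInv (i : Fin r) (j : Fin τ)
  /-- `V_q` on `R₃` -/
  | prep (i : Fin r)
  /-- `V_q†` on `R₃` -/
  | prepInv (i : Fin r)
  /-- flip `R₄` -/
  | flip
  /-- flip `R₄` if `R₂` is `|0̄⟩` -/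
  | check
  /-- flip qubit `i` of `R₅` if `R₂, R₃, R₄` are `|0̄⟩, |0^τ⟩, |0⟩` -/
  | mark (i : Fin r)

/-- The matrix of an operation that permutes the basis states. -/
def basisMap {ι : Type*} [DecidableEq ι] (f : ι → ι) : Matrix ι ι ℂ :=
  Matrix.of fun a b => if a = f b then 1 else 0

/-- `B` on `R₁R₂`, controlled by qubit `j` of `R₃`. -/
def ctrlMatrix {V : Type*} [DecidableEq V] {r τ : ℕ} (B : Matrix (V × V) (V × V) ℂ)
    (j : Fin τ) : Matrix (Reg V r τ) (Reg V r τ) ℂ :=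
  Matrix.of fun a b =>
    if a.2.2 = b.2.2 then
      (if b.2.2.1 j then B (a.1, a.2.1) (b.1, b.2.1)
        else (1 : Matrix (V × V) (V × V) ℂ) (a.1, a.2.1) (b.1, b.2.1))
    else 0

/-- `B` on `R₃`. -/
def prepMatrix {V : Type*} [DecidableEq V] {r τ : ℕ}
    (B : Matrix (Fin τ → Bool) (Fin τ → Bool) ℂ) : Matrix (Reg V r τ) (Reg V r τ) ℂ :=
  Matrix.of fun a b =>
    if a.1 = b.1 ∧ a.2.1 = b.2.1 ∧ a.2.2.2 = b.2.2.2 then B a.2.2.1 b.2.2.1 else 0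

/-- The action of an operation on the five registers. -/
def Gate.matrix {V : Type*} [Fintype V] [DecidableEq V] {P : Matrix V V ℝ} {g o : V} {r τ : ℕ}
    {s : Fin r → ℝ} {t : Fin r → ℕ} (G : SimpleGraph V) (R : Realization P g o s t τ) :
    Gate r τ → Matrix (Reg V r τ) (Reg V r τ) ℂ
  | .ctrlWalk i j => ctrlMatrix (walkOperator G o (R.walk i)) j
  | .ctrlWalkInv i j => ctrlMatrix (walkOperator G o (R.walk i)).conjTranspose j
  | .prep i => prepMatrix (R.prep i)
  | .prepInv i => prepMatrix (R.prep i).conjTranspose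
  | .flip => basisMap fun (x, y, l, a, f) => (x, y, l, !a, f)
  | .check => basisMap fun (x, y, l, a, f) => (x, y, l, if y = o then !a else a, f)
  | .mark i => basisMap fun (x, y, l, a, f) =>
      (x, y, l, a, if y = o ∧ (∀ j, l j = false) ∧ a = false
        then Function.update f i (!(f i)) else f)

/-- The cost of an operation: a controlled call to `W(s_i)` or its inverse is charged one update
`U` and one check `C`. -/
def Gate.cost {r τ : ℕ} (U C : ℝ) : Gate r τ → ℝ
  | .ctrlWalk _ _ => U + C
  | .ctrlWalkInv _ _ => U + C
  | _ => 0

/-- `W_ctrl = ∑_l W(s_i)^l ⊗ |l⟩⟨l|`: `2 ^ j` calls controlled by qubit `j`, for each `j`. -/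
def ctrlCircuit (r τ : ℕ) (i : Fin r) : List (Gate r τ) :=
  (List.finRange τ).flatMap fun j : Fin τ => List.replicate (2 ^ (j : ℕ)) (.ctrlWalk i j)

/-- `W_ctrl†`. -/
def ctrlInvCircuit (r τ : ℕ) (i : Fin r) : List (Gate r τ) :=
  (List.finRange τ).reverse.flatMap fun j : Fin τ => List.replicate (2 ^ (j : ℕ)) (.ctrlWalkInv i j)

/-- `U_qff = V_q† W_ctrl V_q`; circuits are listed in the order of application. -/
def qffCircuit (r τ : ℕ) (i : Fin r) : List (Gate r τ) :=
  [.prep i] ++ ctrlCircuit r τ i ++ [.prepInv i]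

/-- `U_qff† = V_q† W_ctrl† V_q`. -/
def qffInvCircuit (r τ : ℕ) (i : Fin r) : List (Gate r τ) :=
  [.prep i] ++ ctrlInvCircuit r τ i ++ [.prepInv i]

/-- The operator `U_qfs(W(s_i), τ)`. -/
def qfsCircuit (r τ : ℕ) (i : Fin r) : List (Gate r τ) :=
  [.check, .flip] ++ qffCircuit r τ i ++ [.mark i] ++ qffInvCircuit r τ i ++ [.flip, .check]

/-- The loop of the algorithm: `U_qfs(W(s_1), τ)`, …, `U_qfs(W(s_r), τ)`. -/
def searchCircuit (r τ : ℕ) : List (Gate r τ) :=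
  (List.finRange r).flatMap (qfsCircuit r τ)

/-- Applying a circuit to a state. -/
def runCircuit {V : Type*} [Fintype V] [DecidableEq V] {P : Matrix V V ℝ} {g o : V} {r τ : ℕ}
    {s : Fin r → ℝ} {t : Fin r → ℕ} (G : SimpleGraph V) (R : Realization P g o s t τ)
    (c : List (Gate r τ)) (ψ : Reg V r τ → ℂ) : Reg V r τ → ℂ :=
  c.foldl (fun φ γ => (γ.matrix G R).mulVec φ) ψ

/-- The initial state `|π⟩|0̄⟩|0^τ⟩|0⟩|0^r⟩`, where `|π⟩ = ∑ √(π x) |x⟩`. -/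
def initialState {V : Type*} [DecidableEq V] (π : V → ℝ) (o : V) (r τ : ℕ) : Reg V r τ → ℂ :=
  fun (x, a) => if a = (o, (fun _ => false), false, (fun _ => false))
    then ((√(π x) : ℝ) : ℂ) else 0

/-- The probability of obtaining `g` when `R₁` is measured. -/
def probMarked {V : Type*} [Fintype V] [DecidableEq V] {r τ : ℕ} (g : V)
    (ψ : Reg V r τ → ℂ) : ℝ :=
  ∑ a with a.1 = g, ‖ψ a‖ ^ 2

/-- The normalized state after measuring whether `R₁` is `|g⟩` with negative outcome. -/
def collapse {V : Type*} [Fintype V] [DecidableEq V] {r τ : ℕ} (g : V)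
    (ψ : Reg V r τ → ℂ) : Reg V r τ → ℂ :=
  fun a => if a.1 = g then 0 else ψ a / ((√(1 - probMarked g ψ) : ℝ) : ℂ)

/-- `p_succ`: the probability that the final measurement gives `g`, once the initial measurement
has not found it. -/
def loopSuccessProb {V : Type*} [Fintype V] [DecidableEq V] {P : Matrix V V ℝ} {g o : V}
    {r τ : ℕ} {s : Fin r → ℝ} {t : Fin r → ℕ} (G : SimpleGraph V) (π : V → ℝ)
    (R : Realization P g o s t τ) : ℝ :=
  probMarked g (runCircuit G R (searchCircuit r τ) (collapse g (initialState π o r τ)))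

/-- The probability that the whole algorithm, started from `|π⟩`, outputs `g`: either the initial
measurement gives `g`, or the final one does. -/
def successProb {V : Type*} [Fintype V] [DecidableEq V] {P : Matrix V V ℝ} {g o : V}
    {r τ : ℕ} {s : Fin r → ℝ} {t : Fin r → ℕ} (G : SimpleGraph V) (π : V → ℝ)
    (R : Realization P g o s t τ) : ℝ :=
  probMarked g (initialState π o r τ) +
    (1 - probMarked g (initialState π o r τ)) * loopSuccessProb G π R

/-- The cost of the algorithm: one setup `S`, the check in the initial measurement, and the
operations of the loop. -/
def searchCost (r τ : ℕ) (S U C : ℝ) : ℝ :=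
  S + (C + ((searchCircuit r τ).map (Gate.cost U C)).sum)

/-! ### The parameters of the algorithm -/

/-- `s_i = (1 - π_g / sin² θ_i) / (1 - π_g)` with `θ_i = iπ / (2(r+1))`, for `i = 1, …, r`
(the index of `Fin r` is shifted by one). -/
def interpolationParam {V : Type*} (π : V → ℝ) (g : V) (r : ℕ) (i : Fin r) : ℝ :=
  (1 - π g / Real.sin (((i : ℕ) + 1) * Real.pi / (2 * (r + 1))) ^ 2) / (1 - π g)

/-- The number `t = (2 / Δ(s_i)) log (2r / ε)` of walk steps that are fast-forwarded in round `i`,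
rounded up. -/
def fastForwardSteps {V : Type*} [Fintype V] [DecidableEq V] (P : Matrix V V ℝ) (π : V → ℝ)
    (g : V) (r : ℕ) (ε : ℝ) (i : Fin r) : ℕ :=
  ⌈2 / eigenvalueGap (interpolated P g (interpolationParam π g r i)) * Real.log (2 * r / ε)⌉₊

/-- The size `τ = ⌈log₂ Γ⌉` of the register `R₃`. -/
def registerSize (Γ : ℝ) : ℕ := ⌈Real.logb 2 Γ⌉₊

end

/-! Everything happens near the real plane spanned by `|π̄⟩` and `|g⟩`. The value `s_i` is chosen so
that the stationary state of `P(s_i)` is the unit vector of this plane at angle `θ_i = iδ`, with `δ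
= π/(2(r+1))` (`sqrt_interpDist_eq_planeVec`). A perfect round would be a projective measurement
onto that vector, with the outcome recorded coherently in `R₅`. Each such measurement turns the
frame by `δ` and multiplies the difference of the two outcome probabilities by `cos 2δ`
(`IsIdealCoeff.succ`). Since `rδ = π/2 - δ`, the final measurement of `g` is one more turn by `δ`,
and the ideal success probability is exactly `(1 + cos(2δ)^(r+1))/2`, called `idealProb r`.
Convexity of `x^(r+1)` bounds it below by `cos^(2(r+1)) δ`. Concavity of cosine makes it strictly
increasing in `r`.

A round is realized by fast-forwarding. On an eigenvector of the discriminant `D` with eigenvalue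
`cos θ`, the block of `W^l` at `|0̄⟩` is `cos(lθ)` (`walkOperator_pow_block`). The average of
`cos(lθ)` over the distance `l` of a `t`-step random walk is `cos^t θ`. Hence, up to the Hoeffding
tail beyond `2^τ`, the block of `U_qff` is `D^t`. It fixes the stationary state and nearly
annihilates its orthogonal complement, where the eigenvalues lie in `[0, 1 - Δ]`. Undoing `U_qff`
after the flag flip leaves an error of norm at most `ε/r` per round
(`stateNorm_round_planeState_le`). Unitarity makes the errors add up to `ε`
(`abs_sqrt_loopSuccessProb_sub_sqrt_idealProb_le`).

The complexity rests on a bound that does not depend on `s`: `Δ(s) ≥ 1/(4 HT)`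
(`eigenvalueGap_interpolated_ge`). The spectral formula for the hitting time and Cauchy-Schwarz give
`(E_π f - f(x))² ≤ HT · 𝓔(f)`, with `𝓔` the Dirichlet form of `P`. So the oscillation of `f` is
controlled by `4 HT · 𝓔(f)`. Interpolation scales `𝓔` and the stationary mass off `g` by the same
factor, which therefore cancels. Thus `t = O_r(HT log(1/ε))`, and a register holding numbers of
order `√(t log(1/ε))`, that is `√HT · log(1/ε)` up to a factor depending on `r`, makes the tail
negligible.

Because the estimate on `√p_succ` is two-sided around `√(idealProb r)`, strict monotonicity of
`idealProb` passes to the actual probabilities once `ε` is small compared with the first increment.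
A lower bound alone could not exclude the soufflé problem. -/

open Matrix

/-! ### Powers of cosines and the ideal success probability. -/

theorem pow_lt_of_mul_add_one_lt {n : ℕ} {c d : ℝ} (hc : 0 ≤ c) (hd : (n * c + 1) / (n + 1) < d) :
    c ^ n < d ^ (n + 1) := by
  have hn : (0 : ℝ) < n + 1 := by positivity
  -- Weighted AM-GM for `n` copies of `c` and one copy of `1`.
  have h := Real.geom_mean_le_arith_mean2_weighted (w₁ := n / (n + 1)) (w₂ := 1 / (n + 1))
    (p₁ := c) (p₂ := 1) (by positivity) (by positivity) hc zero_le_one (by field_simp)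
  rw [Real.one_rpow, mul_one] at h
  have h2 : c ^ n ≤ ((n * c + 1) / (n + 1)) ^ (n + 1) := by
    calc c ^ n = (c ^ ((n : ℝ) / (n + 1))) ^ (n + 1) := by
          rw [← Real.rpow_natCast (c ^ _), ← Real.rpow_mul hc, ← Real.rpow_natCast c]
          congr 1
          push_cast
          field_simp
      _ ≤ _ := by
          gcongr
          calc _ ≤ _ := h
            _ = _ := by field_simp
  exact h2.trans_lt (by gcongr)

/-- `cos (a / n) ^ n` is strictly increasing in `n` as long as `a / n ≤ π / 2`. -/
theorem cos_div_pow_lt {n : ℕ} {a : ℝ} (hn : 0 < n) (ha : 0 < a) (han : a / n ≤ Real.pi / 2) :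
    Real.cos (a / n) ^ n < Real.cos (a / (n + 1 : ℕ)) ^ (n + 1) := by
  have hn' : (0 : ℝ) < n := by exact_mod_cast hn
  have hy : 0 < a / n := by positivity
  apply pow_lt_of_mul_add_one_lt
  · exact Real.cos_nonneg_of_neg_pi_div_two_le_of_le (by linarith) han
  -- Strict concavity, with `a/(n+1)` written as the convex combination of `a/n` and `0` with
  -- weights `n/(n+1)` and `1/(n+1)`.
  · have h := strictConcaveOn_cos_Icc.2 (show a / n ∈ Set.Icc _ _ from ⟨by linarith, han⟩)
      (show (0 : ℝ) ∈ Set.Icc _ _ from ⟨by linarith, by linarith⟩) hy.ne'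
      (show (0 : ℝ) < n / (n + 1) by positivity) (show (0 : ℝ) < 1 / (n + 1) by positivity)
      (by field_simp)
    simp only [smul_eq_mul, Real.cos_zero, mul_one, mul_zero, add_zero] at h
    have e1 : (n : ℝ) / (n + 1) * (a / n) = a / ((n + 1 : ℕ) : ℝ) := by
      push_cast; field_simp
    rw [e1] at h
    calc _ = _ := by field_simp
      _ < _ := h

theorem strictMono_cos_pow :
    StrictMono (fun r : ℕ => Real.cos (Real.pi / (2 * (r + 1))) ^ (r + 1)) := by
  refine strictMono_nat_of_lt_succ fun r => ?_
  have h := cos_div_pow_lt (n := r + 1) (a := Real.pi / 2) (by omega) (by positivity)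
    (by apply div_le_self (by positivity); push_cast; linarith [(Nat.cast_nonneg r : (0 : ℝ) ≤ r)])
  rw [div_div, div_div] at h
  push_cast at h ⊢
  exact h

theorem tendsto_cos_pow :
    Filter.Tendsto (fun r : ℕ => Real.cos (Real.pi / (2 * (r + 1))) ^ (r + 1)) Filter.atTop
      (nhds 1) := by
  have h1 : Filter.Tendsto (fun r : ℕ => 1 - Real.pi ^ 2 / 8 * (1 / ((r : ℝ) + 1))) Filter.atTop
      (nhds 1) := by
    simpa using (tendsto_one_div_add_atTop_nhds_zero_nat (𝕜 := ℝ)).const_mul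
      (Real.pi ^ 2 / 8) |>.const_sub 1
  refine tendsto_of_tendsto_of_tendsto_of_le_of_le h1 tendsto_const_nhds (fun r => ?_) fun r => ?_
  · have hr : (0 : ℝ) < r + 1 := by positivity
    have hx : 0 < Real.pi / (2 * (r + 1)) := by positivity
    have hc : 0 ≤ Real.cos (Real.pi / (2 * (r + 1))) := by
      apply Real.cos_nonneg_of_neg_pi_div_two_le_of_le (by linarith [Real.pi_pos])
      apply div_le_div_of_nonneg_left Real.pi_pos.le (by norm_num)
      linarith [(Nat.cast_nonneg r : (0 : ℝ) ≤ r)]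
    -- Bernoulli's inequality and `cos x ≥ 1 - x²/2` give the lower envelope `1 - π²/(8(r+1))`.
    have hb := one_add_mul_le_pow (a := Real.cos (Real.pi / (2 * (r + 1))) - 1) (by linarith) (r + 1)
    have hq := Real.one_sub_sq_div_two_le_cos (x := Real.pi / (2 * (r + 1)))
    rw [add_sub_cancel] at hb
    refine le_trans ?_ hb
    push_cast
    have : Real.pi ^ 2 / 8 * (1 / ((r : ℝ) + 1)) =
        (r + 1) * ((Real.pi / (2 * (r + 1))) ^ 2 / 2) := by field_simp; norm_num
    rw [this]
    nlinarith
  · refine pow_le_one₀ (Real.cos_nonneg_of_neg_pi_div_two_le_of_le ?_ ?_) (Real.cos_le_one _)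
    · have : 0 < Real.pi / (2 * ((r : ℝ) + 1)) := by positivity
      linarith [Real.pi_pos]
    · apply div_le_div_of_nonneg_left Real.pi_pos.le (by norm_num)
      linarith [(Nat.cast_nonneg r : (0 : ℝ) ≤ r)]

/-- The success probability of the sequence of perfect projective measurements. -/
noncomputable def idealProb (r : ℕ) : ℝ := (1 + Real.cos (Real.pi / (r + 1)) ^ (r + 1)) / 2

theorem cos_pi_div_succ_nonneg {r : ℕ} (hr : 1 ≤ r) : 0 ≤ Real.cos (Real.pi / (r + 1)) := by
  have hr' : (1 : ℝ) ≤ r := by exact_mod_cast hr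
  have h0 : 0 < Real.pi / (r + 1) := by positivity
  refine Real.cos_nonneg_of_neg_pi_div_two_le_of_le (by linarith [Real.pi_pos]) ?_
  exact div_le_div_of_nonneg_left Real.pi_pos.le (by norm_num) (by linarith)

theorem idealProb_nonneg {r : ℕ} (hr : 1 ≤ r) : 0 ≤ idealProb r := by
  have := pow_nonneg (cos_pi_div_succ_nonneg hr) (r + 1)
  unfold idealProb
  linarith

theorem idealProb_lt_succ {r : ℕ} (hr : 1 ≤ r) : idealProb r < idealProb (r + 1) := by
  have hr' : (1 : ℝ) ≤ r := by exact_mod_cast hr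
  have h := cos_div_pow_lt (n := r + 1) (a := Real.pi) (by omega) Real.pi_pos
    (by apply div_le_div_of_nonneg_left Real.pi_pos.le (by norm_num); push_cast; linarith)
  unfold idealProb
  push_cast at h ⊢
  linarith

theorem idealProb_le {r r' : ℕ} (hr : 1 ≤ r) (h : r ≤ r') : idealProb r ≤ idealProb r' := by
  induction r', h using Nat.le_induction with
  | base => exact le_rfl
  | succ n hn ih => exact ih.trans (idealProb_lt_succ (hr.trans hn)).le

/-- With `c = cos 2δ` and `cos² δ = (1 + c)/2`, this is convexity of `x^(r+1)` at the midpoint of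
`1` and `c`. Both are nonnegative because `r ≥ 1`. -/
theorem cos_pow_le_sqrt_idealProb {r : ℕ} (hr : 1 ≤ r) :
    Real.cos (Real.pi / (2 * (r + 1))) ^ (r + 1) ≤ √(idealProb r) := by
  apply Real.le_sqrt_of_sq_le
  have h0 := cos_pi_div_succ_nonneg hr
  have e : Real.cos (Real.pi / (2 * (r + 1))) ^ 2 = (1 + Real.cos (Real.pi / (r + 1))) / 2 := by
    have e2 : Real.pi / (r + 1) = 2 * (Real.pi / (2 * (r + 1))) := by field_simp
    rw [e2, Real.cos_two_mul]; ring
  rw [pow_right_comm, e, idealProb]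
  have h := (convexOn_pow (𝕜 := ℝ) (r + 1)).2 (show (1 : ℝ) ∈ Set.Ici 0 by simp)
    (show Real.cos (Real.pi / (r + 1)) ∈ Set.Ici 0 from h0) (show (0 : ℝ) ≤ 1 / 2 by norm_num)
    (show (0 : ℝ) ≤ 1 / 2 by norm_num) (by norm_num)
  simp only [smul_eq_mul, one_pow] at h
  calc _ = _ := by congr 1; ring
    _ ≤ _ := h
    _ = _ := by ring

/-- The threshold `81/100` makes the ideal amplitude at least `9/10`, leaving room for an error in
the amplitude before its square drops to `4/5`. -/
theorem idealProb_ten : (81 / 100 : ℝ) < idealProb 10 := by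
  have h1 := Real.one_sub_sq_div_two_le_cos (x := Real.pi / 11)
  have h2 : (0.959 : ℝ) ≤ Real.cos (Real.pi / 11) := by
    have := Real.pi_lt_d4
    have := Real.pi_gt_three
    nlinarith
  have h3 : (0.959 : ℝ) ^ 11 ≤ Real.cos (Real.pi / 11) ^ 11 := by gcongr
  unfold idealProb
  norm_num at h3 ⊢
  linarith

/-! ### The simple random walk -/

/-- The endpoint of the walk on `ℤ` with the steps `w`. -/
def walkEnd {t : ℕ} (w : Fin t → Bool) : ℤ := ∑ j, if w j then (1 : ℤ) else -1

theorem natAbs_walkEnd_le {t : ℕ} (w : Fin t → Bool) : (walkEnd w).natAbs ≤ t := by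
  have h : |walkEnd w| ≤ ∑ j : Fin t, |if w j then (1 : ℤ) else -1| :=
    Finset.abs_sum_le_sum_abs _ _
  have h2 : ∀ j : Fin t, |if w j then (1 : ℤ) else -1| = 1 := fun j => by split_ifs <;> simp
  simp only [h2, Finset.sum_const, Finset.card_univ, Fintype.card_fin, mul_one,
    nsmul_eq_mul] at h
  rw [← Nat.cast_le (α := ℤ), Int.natCast_natAbs]
  exact h

/-- The steps are independent, so the generating function factors. Imaginary `z` yields the
Chebyshev average and real `z` the Chernoff bound. -/
theorem sum_exp_walkEnd (t : ℕ) (z : ℂ) :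
    ∑ w : Fin t → Bool, Complex.exp (walkEnd w * z) = (Complex.exp z + Complex.exp (-z)) ^ t := by
  have h : ∀ w : Fin t → Bool, Complex.exp (walkEnd w * z) =
      ∏ j, Complex.exp ((if w j then (1 : ℤ) else -1 : ℤ) * z) := by
    intro w
    rw [← Complex.exp_sum, ← Finset.sum_mul, walkEnd]
    push_cast
    rfl
  simp_rw [h]
  have := (Finset.prod_univ_sum (fun _ : Fin t => (Finset.univ : Finset Bool))
    (fun _ b => Complex.exp ((if b then (1 : ℤ) else -1 : ℤ) * z))).symm
  rw [Fintype.piFinset_univ] at this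
  rw [this]
  simp

theorem sum_cos_walkEnd (t : ℕ) (θ : ℝ) :
    ∑ w : Fin t → Bool, Real.cos ((walkEnd w).natAbs * θ) = 2 ^ t * Real.cos θ ^ t := by
  have h := congrArg Complex.re (sum_exp_walkEnd t (θ * Complex.I))
  have h2 : Complex.exp (θ * Complex.I) + Complex.exp (-(θ * Complex.I)) =
      ((2 * Real.cos θ : ℝ) : ℂ) := by
    push_cast
    rw [Complex.two_cos, neg_mul]
  rw [h2, ← Complex.ofReal_pow, Complex.ofReal_re, Complex.re_sum, mul_pow] at h
  rw [← h]
  refine Finset.sum_congr rfl fun w _ => ?_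
  have : (walkEnd w : ℂ) * (θ * Complex.I) = ((walkEnd w * θ : ℝ) : ℂ) * Complex.I := by
    push_cast; ring
  rw [this, Complex.exp_ofReal_mul_I_re, Nat.cast_natAbs]
  rcases abs_choice (walkEnd w) with h | h <;> rw [h]
  push_cast
  rw [neg_mul, Real.cos_neg]

theorem sum_rexp_walkEnd (t : ℕ) (x : ℝ) :
    ∑ w : Fin t → Bool, Real.exp (walkEnd w * x) = (2 * Real.cosh x) ^ t := by
  have h := sum_exp_walkEnd t x
  rw [Real.cosh_eq, mul_div_cancel₀ _ two_ne_zero]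
  exact_mod_cast h

/-- Hoeffding's inequality for the simple random walk, in terms of the number of paths. -/
theorem card_walkEnd_ge_le (t : ℕ) {a : ℝ} (ha : 0 ≤ a) :
    (((Finset.univ.filter fun w : Fin t → Bool => a ≤ (walkEnd w).natAbs).card : ℝ)) ≤
      2 ^ t * (2 * Real.exp (-(a ^ 2 / (2 * t)))) := by
  rcases Nat.eq_zero_or_pos t with rfl | ht
  · simp only [Finset.univ_unique, pow_zero, CharP.cast_eq_zero, mul_zero, div_zero, neg_zero,
      Real.exp_zero, mul_one, one_mul]
    calc _ ≤ (1 : ℝ) := by exact_mod_cast (Finset.card_filter_le _ _)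
      _ ≤ 2 := by norm_num
  have ht' : (0 : ℝ) < t := by exact_mod_cast ht
  -- The minimizer of the Chernoff exponent `t x²/2 - a x`.
  set x := a / t with hx
  have hx0 : 0 ≤ x := by positivity
  have h1 : (((Finset.univ.filter fun w : Fin t → Bool => a ≤ (walkEnd w).natAbs).card : ℝ)) *
      Real.exp (a * x) ≤
      ∑ w : Fin t → Bool, (Real.exp (walkEnd w * x) + Real.exp (walkEnd w * (-x))) := by
    rw [← nsmul_eq_mul, ← Finset.sum_const]
    refine (Finset.sum_le_sum fun w hw => ?_).trans (Finset.sum_le_sum_of_subset_of_nonneg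
      (Finset.subset_univ _) fun _ _ _ => by positivity)
    have hw := (Finset.mem_filter.1 hw).2
    rw [Nat.cast_natAbs] at hw
    have e : Real.exp (a * x) ≤ Real.exp (|walkEnd w| * x) := by gcongr
    rcases abs_choice (walkEnd w) with h | h <;> rw [h] at e
    · exact e.trans (le_add_of_nonneg_right (Real.exp_pos _).le)
    · refine e.trans (le_add_of_nonneg_of_le (Real.exp_pos _).le (le_of_eq ?_))
      push_cast; ring_nf
  rw [Finset.sum_add_distrib, sum_rexp_walkEnd, sum_rexp_walkEnd, Real.cosh_neg] at h1
  have h2 : (2 * Real.cosh x) ^ t ≤ 2 ^ t * Real.exp (t * (x ^ 2 / 2)) := by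
    rw [mul_pow, Real.exp_nat_mul]
    have := Real.cosh_le_exp_half_sq x
    have := Real.cosh_pos x
    gcongr
  have h3 : Real.exp (t * (x ^ 2 / 2)) = Real.exp (a * x) * Real.exp (-(a ^ 2 / (2 * t))) := by
    rw [← Real.exp_add]; congr 1; rw [hx]; field_simp; ring
  rw [h3] at h2
  refine le_of_mul_le_mul_right ?_ (Real.exp_pos (a * x))
  calc _ ≤ _ := h1
    _ ≤ _ := add_le_add h2 h2
    _ = _ := by ring

theorem walkDistanceProb_eq (t l : ℕ) : walkDistanceProb t l =
    ((Finset.univ.filter fun w : Fin t → Bool => (walkEnd w).natAbs = l).card : ℝ) / 2 ^ t := rfl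

theorem walkDistanceProb_nonneg (t l : ℕ) : 0 ≤ walkDistanceProb t l := by
  unfold walkDistanceProb; positivity

theorem sum_walkDistanceProb_mul (t : ℕ) (s : Finset ℕ) (φ : ℕ → ℝ) :
    ∑ l ∈ s, walkDistanceProb t l * φ l =
      (∑ w : Fin t → Bool with (walkEnd w).natAbs ∈ s, φ (walkEnd w).natAbs) / 2 ^ t := by
  simp_rw [walkDistanceProb_eq, div_mul_eq_mul_div]
  rw [← Finset.sum_div]
  congr 1
  rw [← Finset.sum_fiberwise_of_maps_to (s := Finset.univ.filter _) (t := s)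
    (g := fun w : Fin t → Bool => (walkEnd w).natAbs) (fun w hw => (Finset.mem_filter.1 hw).2)]
  refine Finset.sum_congr rfl fun l hl => ?_
  rw [Finset.filter_filter, ← nsmul_eq_mul, ← Finset.sum_const]
  refine Finset.sum_congr (Finset.filter_congr fun w _ => ?_) fun w hw => ?_
  · constructor
    · rintro rfl; exact ⟨hl, rfl⟩
    · exact fun h => h.2
  · rw [(Finset.mem_filter.1 hw).2.2]

/-- The probability that the walk is at distance at least `N` after `t` steps. -/
noncomputable def walkTail (t N : ℕ) : ℝ := ∑ x ∈ Finset.Icc N t, walkDistanceProb t x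

theorem walkTail_eq (t N : ℕ) : walkTail t N =
    ((Finset.univ.filter fun w : Fin t → Bool => N ≤ (walkEnd w).natAbs).card : ℝ) / 2 ^ t := by
  have h := sum_walkDistanceProb_mul t (Finset.Icc N t) fun _ => 1
  simp only [mul_one, Finset.sum_const, nsmul_eq_mul] at h
  rw [walkTail, h]
  congr 4
  ext w
  simp [natAbs_walkEnd_le]

theorem walkTail_le (t N : ℕ) : walkTail t N ≤ 2 * Real.exp (-((N : ℝ) ^ 2 / (2 * t))) := by
  have h := card_walkEnd_ge_le t (a := N) (by positivity)
  simp only [Nat.cast_le] at h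
  rw [walkTail_eq, div_le_iff₀ (by positivity)]
  linarith

/-- An expectation splits into the distances kept in the register and the paths ending beyond it. -/
theorem sum_walkDistanceProb_mul_add (t N : ℕ) (φ : ℕ → ℝ) :
    ∑ l ∈ Finset.range N, walkDistanceProb t l * φ l +
      (∑ w : Fin t → Bool with N ≤ (walkEnd w).natAbs, φ (walkEnd w).natAbs) / 2 ^ t =
      (∑ w : Fin t → Bool, φ (walkEnd w).natAbs) / 2 ^ t := by
  rw [sum_walkDistanceProb_mul, ← add_div,
    ← Finset.sum_filter_add_sum_filter_not Finset.univ
      (fun w : Fin t → Bool => (walkEnd w).natAbs ∈ Finset.range N)]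
  simp

/-- The truncated fast-forwarding sum approximates the power `cos θ ^ t`. -/
theorem abs_sum_walkDistanceProb_cos_le (t N : ℕ) {θ : ℝ} (hθ : 0 ≤ Real.cos θ) :
    |∑ l ∈ Finset.range N, walkDistanceProb t l * Real.cos (l * θ)| ≤
      Real.cos θ ^ t + walkTail t N := by
  have h := sum_walkDistanceProb_mul_add t N fun l => Real.cos (l * θ)
  rw [sum_cos_walkEnd, mul_div_cancel_left₀ _ (by positivity)] at h
  rw [eq_sub_of_add_eq h]
  refine (abs_sub _ _).trans (add_le_add (abs_of_nonneg (by positivity)).le ?_)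
  rw [abs_div, abs_of_pos (show (0 : ℝ) < 2 ^ t by positivity), walkTail_eq]
  gcongr
  refine (Finset.abs_sum_le_sum_abs _ _).trans ((Finset.sum_le_sum fun w _ =>
    Real.abs_cos_le_one _).trans ?_)
  simp

/-! ### Register values -/

theorem registerValue_succ {τ : ℕ} (l : Fin (τ + 1) → Bool) :
    registerValue l = (if l 0 then 1 else 0) + 2 * registerValue (Fin.tail l) := by
  unfold registerValue
  rw [Fin.sum_univ_succ, Finset.mul_sum]
  congr 1
  refine Finset.sum_congr rfl fun j _ => ?_
  cases h : l j.succ <;> simp [Fin.tail, pow_succ', h]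

theorem registerValue_lt {τ : ℕ} (l : Fin τ → Bool) : registerValue l < 2 ^ τ := by
  induction τ with
  | zero => simp [registerValue]
  | succ τ ih =>
    have := ih (Fin.tail l)
    rw [registerValue_succ, pow_succ]
    split_ifs <;> omega

theorem registerValue_injective {τ : ℕ} :
    Function.Injective (registerValue : (Fin τ → Bool) → ℕ) := by
  induction τ with
  | zero => exact fun _ _ _ => Subsingleton.elim _ _
  | succ τ ih =>
    intro l m h
    rw [registerValue_succ, registerValue_succ] at h
    have h0 : l 0 = m 0 := by
      cases hl : l 0 <;> cases hm : m 0 <;> simp [hl, hm] at h ⊢ <;> omega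
    rw [h0] at h
    have h1 : Fin.tail l = Fin.tail m := ih (by omega)
    rw [← Fin.cons_self_tail l, ← Fin.cons_self_tail m, h0, h1]

theorem sum_registerValue {M : Type*} [AddCommMonoid M] (τ : ℕ) (φ : ℕ → M) :
    ∑ l : Fin τ → Bool, φ (registerValue l) = ∑ n ∈ Finset.range (2 ^ τ), φ n := by
  have himg : Finset.univ.image (registerValue : (Fin τ → Bool) → ℕ) = Finset.range (2 ^ τ) := by
    refine Finset.eq_of_subset_of_card_le ?_ ?_
    · intro n hn
      obtain ⟨l, -, rfl⟩ := Finset.mem_image.1 hn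
      exact Finset.mem_range.2 (registerValue_lt l)
    · rw [Finset.card_image_of_injective _ registerValue_injective]
      simp
  rw [← himg, Finset.sum_image fun _ _ _ _ h => registerValue_injective h]

/-! ### Orthonormal bases of real vectors -/

theorem OrthonormalBasis.sum_mul_eq {ι V : Type*} [Fintype ι] [Fintype V]
    (b : OrthonormalBasis ι ℝ (EuclideanSpace ℝ V)) (p u : V → ℝ) :
    ∑ x, p x * u x = ∑ k, (∑ x, b k x * p x) * (∑ x, b k x * u x) := by
  have h := b.sum_inner_mul_inner (WithLp.toLp 2 p) (WithLp.toLp 2 u)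
  simp only [PiLp.inner_apply, RCLike.inner_apply, conj_trivial] at h
  calc _ = ∑ x, u x * p x := by simp only [mul_comm]
    _ = _ := h.symm
    _ = _ := by
      refine Finset.sum_congr rfl fun k _ => ?_
      simp only [mul_comm]

theorem OrthonormalBasis.eq_sum_coeff {ι V : Type*} [Fintype ι] [Fintype V]
    (b : OrthonormalBasis ι ℝ (EuclideanSpace ℝ V)) (u : V → ℝ) (x : V) :
    u x = ∑ k, (∑ y, b k y * u y) * b k x := by
  have h := congrArg (fun w : EuclideanSpace ℝ V => w x) (b.sum_repr' (WithLp.toLp 2 u))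
  simp only [PiLp.inner_apply, RCLike.inner_apply, conj_trivial, WithLp.ofLp_sum, WithLp.ofLp_smul,
    Finset.sum_apply, Pi.smul_apply, smul_eq_mul] at h
  rw [← h]
  simp only [mul_comm]

/-! ### Quadratic forms in an eigenbasis of a Hermitian matrix. -/

section Hermitian

variable {V : Type*} [Fintype V] [DecidableEq V] {A : Matrix V V ℝ} (hA : A.IsHermitian)

/-- The coefficient of a vector along an eigenvector of `A`. -/
noncomputable def eigenCoeff (k : V) (u : V → ℝ) : ℝ := ∑ x, hA.eigenvectorBasis k x * u x

theorem eigenCoeff_mulVec (k : V) (u : V → ℝ) :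
    eigenCoeff hA k (A *ᵥ u) = hA.eigenvalues k * eigenCoeff hA k u := by
  have h := hA.mulVec_eigenvectorBasis k
  have e : ∀ u : V → ℝ, eigenCoeff hA k u = (hA.eigenvectorBasis k : V → ℝ) ⬝ᵥ u := fun u => rfl
  have hT : Aᵀ = A := by simpa [Matrix.IsHermitian, Matrix.conjTranspose_eq_transpose_of_trivial] using hA
  rw [e, e, Matrix.dotProduct_mulVec, ← Matrix.mulVec_transpose, hT, h, smul_dotProduct,
    smul_eq_mul]

theorem sum_mul_mulVec_eq (u : V → ℝ) :
    ∑ x, u x * (A *ᵥ u) x = ∑ k, hA.eigenvalues k * eigenCoeff hA k u ^ 2 := by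
  rw [hA.eigenvectorBasis.sum_mul_eq]
  refine Finset.sum_congr rfl fun k _ => ?_
  have := eigenCoeff_mulVec hA k u
  unfold eigenCoeff at *
  rw [this]; ring

/-- The Cauchy-Schwarz inequality for the form `1 - A`. -/
theorem sq_sum_mul_le (h1 : ∀ k, hA.eigenvalues k ≤ 1) {p : V → ℝ}
    (hp : ∀ k, hA.eigenvalues k = 1 → eigenCoeff hA k p = 0) (u : V → ℝ) :
    (∑ x, p x * u x) ^ 2 ≤
      (∑ k with hA.eigenvalues k ≠ 1, eigenCoeff hA k p ^ 2 / (1 - hA.eigenvalues k)) *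
        (∑ x, u x * u x - ∑ x, u x * (A *ᵥ u) x) := by
  have e1 : ∑ x, p x * u x = ∑ k with hA.eigenvalues k ≠ 1,
      eigenCoeff hA k p * eigenCoeff hA k u := by
    rw [hA.eigenvectorBasis.sum_mul_eq, Finset.sum_filter]
    refine Finset.sum_congr rfl fun k _ => ?_
    split_ifs with h
    · rfl
    · have := hp k (not_not.1 h)
      unfold eigenCoeff at this
      rw [this, zero_mul]
  have e2 : ∑ x, u x * u x - ∑ x, u x * (A *ᵥ u) x =
      ∑ k, (1 - hA.eigenvalues k) * eigenCoeff hA k u ^ 2 := by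
    rw [sum_mul_mulVec_eq hA, hA.eigenvectorBasis.sum_mul_eq, ← Finset.sum_sub_distrib]
    refine Finset.sum_congr rfl fun k _ => ?_
    unfold eigenCoeff; ring
  have e3 : ∑ k with hA.eigenvalues k ≠ 1, (1 - hA.eigenvalues k) * eigenCoeff hA k u ^ 2 ≤
      ∑ k, (1 - hA.eigenvalues k) * eigenCoeff hA k u ^ 2 :=
    Finset.sum_le_sum_of_subset_of_nonneg (Finset.filter_subset _ _) fun k _ _ =>
      mul_nonneg (sub_nonneg.2 (h1 k)) (sq_nonneg _)
  rw [e1, e2]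
  have hpos : ∀ k ∈ Finset.univ.filter fun k => hA.eigenvalues k ≠ 1, 0 < 1 - hA.eigenvalues k :=
    fun k hk => sub_pos.2 (lt_of_le_of_ne (h1 k) (Finset.mem_filter.1 hk).2)
  -- Each product of coefficients is split as `(p_k/√(1-λ_k)) · (√(1-λ_k) u_k)`. This is possible
  -- because only eigenvalues below `1` remain.
  refine (Finset.sum_sq_le_sum_mul_sum_of_sq_le_mul _ (fun k hk => div_nonneg (sq_nonneg _) (hpos k hk).le)
    (fun k hk => mul_nonneg (hpos k hk).le (sq_nonneg (eigenCoeff hA k u))) fun k hk => le_of_eq ?_).trans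
    (mul_le_mul_of_nonneg_left e3 (Finset.sum_nonneg fun k hk => div_nonneg (sq_nonneg _) (hpos k hk).le))
  have := (hpos k hk).ne'
  field_simp

theorem eigenvector_form (k : V) :
    ∑ x, hA.eigenvectorBasis k x * (A *ᵥ (hA.eigenvectorBasis k : V → ℝ)) x = hA.eigenvalues k := by
  rw [hA.mulVec_eigenvectorBasis k]
  have h := hA.eigenvectorBasis.orthonormal.1 k
  rw [EuclideanSpace.norm_eq, Real.sqrt_eq_one] at h
  simp only [Real.norm_eq_abs, sq_abs] at h
  simp only [Pi.smul_apply, smul_eq_mul]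
  calc _ = hA.eigenvalues k * ∑ x, hA.eigenvectorBasis k x ^ 2 := by
        rw [Finset.mul_sum]; exact Finset.sum_congr rfl fun x _ => by ring
    _ = _ := by rw [h, mul_one]

theorem eigenvector_sq_sum (k : V) :
    ∑ x, hA.eigenvectorBasis k x * hA.eigenvectorBasis k x = 1 := by
  have h := hA.eigenvectorBasis.orthonormal.1 k
  rw [EuclideanSpace.norm_eq, Real.sqrt_eq_one] at h
  simpa [sq] using h

end Hermitian

/-! ### Dirichlet forms of reversible chains -/

/-- Detailed balance makes the discriminant similar to `Q` through the diagonal matrix of `ρ`, the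
square root of the stationary weights. Hence `v ↦ v/ρ` carries its eigenvectors to eigenfunctions of
`Q`. -/
theorem discriminant_eq {V : Type*} {Q : Matrix V V ℝ} {ρ : V → ℝ}
    (hQ : ∀ x y, 0 ≤ Q x y) (hρ : ∀ x, 0 < ρ x)
    (hrev : ∀ x y, ρ x ^ 2 * Q x y = ρ y ^ 2 * Q y x) (x y : V) :
    discriminant Q x y = ρ x * Q x y / ρ y := by
  have h1 := hρ x
  have h2 := hρ y
  have h3 := hQ x y
  have : Q y x = ρ x ^ 2 * Q x y / ρ y ^ 2 := by rw [hrev]; field_simp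
  rw [discriminant, Matrix.of_apply, this]
  rw [show Q x y * (ρ x ^ 2 * Q x y / ρ y ^ 2) = (ρ x * Q x y / ρ y) ^ 2 by ring,
    Real.sqrt_sq (by positivity)]

theorem discriminant_nonneg {V : Type*} (Q : Matrix V V ℝ) (x y : V) : 0 ≤ discriminant Q x y :=
  Real.sqrt_nonneg _

section Dirichlet

variable {V : Type*} [Fintype V]

/-- The Dirichlet form of symmetric edge weights. -/
noncomputable def dirichletForm (m : V → V → ℝ) (f : V → ℝ) : ℝ :=
  (∑ x, ∑ y, m x y * (f x - f y) ^ 2) / 2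

theorem dirichletForm_nonneg {m : V → V → ℝ} (hm : ∀ x y, 0 ≤ m x y) (f : V → ℝ) :
    0 ≤ dirichletForm m f :=
  div_nonneg (Finset.sum_nonneg fun _ _ => Finset.sum_nonneg fun _ _ =>
    mul_nonneg (hm _ _) (sq_nonneg _)) zero_le_two

theorem dirichletForm_sub_const (m : V → V → ℝ) (f : V → ℝ) (c : ℝ) :
    dirichletForm m (fun x => f x - c) = dirichletForm m f := by
  simp [dirichletForm]

theorem eq_of_dirichletForm_eq_zero {m : V → V → ℝ} (hm : ∀ x y, 0 ≤ m x y) {f : V → ℝ}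
    (h : dirichletForm m f = 0) {x y : V} (hxy : 0 < m x y) : f x = f y := by
  have h' : ∑ x, ∑ y, m x y * (f x - f y) ^ 2 = 0 := by
    unfold dirichletForm at h; linarith
  have h1 := (Finset.sum_eq_zero_iff_of_nonneg fun x _ => Finset.sum_nonneg fun y _ =>
    mul_nonneg (hm x y) (sq_nonneg (f x - f y))).1 h' x (Finset.mem_univ _)
  have h2 := (Finset.sum_eq_zero_iff_of_nonneg fun y _ =>
    mul_nonneg (hm x y) (sq_nonneg (f x - f y))).1 h1 y (Finset.mem_univ _)
  have h3 := (mul_eq_zero.1 h2).resolve_left hxy.ne'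
  exact sub_eq_zero.1 (pow_eq_zero_iff two_ne_zero |>.1 h3)

/-- The identity `⟨f, (1 - Q) f⟩ = 𝓔(f)` for a reversible chain, in terms of its edge weights. -/
theorem sum_sub_sum_eq_dirichletForm {m : V → V → ℝ} {w : V → ℝ} (hm : ∀ x y, m x y = m y x)
    (hw : ∀ x, ∑ y, m x y = w x) (f : V → ℝ) :
    ∑ x, w x * (f x * f x) - ∑ x, ∑ y, m x y * (f x * f y) = dirichletForm m f := by
  have e1 : ∑ x, w x * (f x * f x) = ∑ x, ∑ y, m x y * (f x * f x) := by
    refine Finset.sum_congr rfl fun x _ => ?_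
    rw [← hw, Finset.sum_mul]
  have e2 : ∑ x, w x * (f x * f x) = ∑ x, ∑ y, m x y * (f y * f y) := by
    rw [e1, Finset.sum_comm]
    exact Finset.sum_congr rfl fun x _ => Finset.sum_congr rfl fun y _ => by rw [hm]
  have e3 : ∑ x, ∑ y, m x y * (f x - f y) ^ 2 = ∑ x, ∑ y, m x y * (f x * f x) +
      ∑ x, ∑ y, m x y * (f y * f y) - 2 * ∑ x, ∑ y, m x y * (f x * f y) := by
    simp only [Finset.mul_sum, ← Finset.sum_add_distrib, ← Finset.sum_sub_distrib]
    exact Finset.sum_congr rfl fun x _ => Finset.sum_congr rfl fun y _ => by ring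
  unfold dirichletForm
  rw [e3, ← e1, ← e2]; ring

variable {Q : Matrix V V ℝ} {ρ : V → ℝ}

theorem discriminant_mulVec (hQ : ∀ x y, 0 ≤ Q x y) (hρ : ∀ x, 0 < ρ x)
    (hrev : ∀ x y, ρ x ^ 2 * Q x y = ρ y ^ 2 * Q y x) (f : V → ℝ) (x : V) :
    (discriminant Q *ᵥ fun y => ρ y * f y) x = ρ x * (Q *ᵥ f) x := by
  simp only [Matrix.mulVec, dotProduct, Finset.mul_sum]
  refine Finset.sum_congr rfl fun y _ => ?_
  rw [discriminant_eq hQ hρ hrev]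
  have := (hρ y).ne'
  field_simp

theorem sum_mul_discriminant_mulVec (hQ : ∀ x y, 0 ≤ Q x y) (hρ : ∀ x, 0 < ρ x)
    (hrev : ∀ x y, ρ x ^ 2 * Q x y = ρ y ^ 2 * Q y x) (f : V → ℝ) :
    ∑ x, ρ x * f x * (discriminant Q *ᵥ fun y => ρ y * f y) x =
      ∑ x, ∑ y, ρ x ^ 2 * Q x y * (f x * f y) := by
  refine Finset.sum_congr rfl fun x _ => ?_
  rw [discriminant_mulVec hQ hρ hrev]
  simp only [Matrix.mulVec, dotProduct, Finset.mul_sum]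
  exact Finset.sum_congr rfl fun y _ => by ring

theorem mulVec_div_of_discriminant (hQ : ∀ x y, 0 ≤ Q x y) (hρ : ∀ x, 0 < ρ x)
    (hrev : ∀ x y, ρ x ^ 2 * Q x y = ρ y ^ 2 * Q y x) {v : V → ℝ} {μ : ℝ}
    (hv : discriminant Q *ᵥ v = μ • v) :
    Q *ᵥ (fun x => v x / ρ x) = μ • fun x => v x / ρ x := by
  ext x
  have hx := (hρ x).ne'
  have e : v = fun y => ρ y * (v y / ρ y) := by
    ext y; have := (hρ y).ne'; field_simp
  have h := congrFun hv x
  rw [e, discriminant_mulVec hQ hρ hrev] at h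
  simp only [Pi.smul_apply, smul_eq_mul] at h ⊢
  refine mul_left_cancel₀ hx (h.trans ?_)
  ring

variable [DecidableEq V]

theorem mem_spectrum_of_mulVec {μ : ℝ} {f : V → ℝ} (hf : f ≠ 0) (h : Q *ᵥ f = μ • f) :
    μ ∈ spectrum ℝ Q := by
  rw [← Matrix.spectrum_toLin']
  exact (Module.End.hasEigenvalue_of_hasEigenvector
    (Module.End.hasEigenvector_iff.2 ⟨Module.End.mem_eigenspace_iff.2 (by simpa using h), hf⟩)).mem_spectrum

theorem exists_mulVec_of_mem_spectrum {μ : ℝ} (h : μ ∈ spectrum ℝ Q) :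
    ∃ f : V → ℝ, f ≠ 0 ∧ Q *ᵥ f = μ • f := by
  rw [← Matrix.spectrum_toLin', ← Module.End.hasEigenvalue_iff_mem_spectrum] at h
  obtain ⟨f, hf⟩ := h.exists_hasEigenvector
  exact ⟨f, hf.2, by simpa using hf.apply_eq_smul⟩

theorem mem_spectrum_of_discriminant (hQ : ∀ x y, 0 ≤ Q x y) (hρ : ∀ x, 0 < ρ x)
    (hrev : ∀ x y, ρ x ^ 2 * Q x y = ρ y ^ 2 * Q y x) {v : V → ℝ} {μ : ℝ} (hv0 : v ≠ 0)
    (hv : discriminant Q *ᵥ v = μ • v) : μ ∈ spectrum ℝ Q := by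
  refine mem_spectrum_of_mulVec (fun h0 => hv0 ?_) (mulVec_div_of_discriminant hQ hρ hrev hv)
  ext x
  exact (div_eq_zero_iff.1 (congrFun h0 x)).resolve_right (hρ x).ne'

end Dirichlet

/-! ### Hitting times -/

theorem discriminant_absorbing {V : Type*} [DecidableEq V] (P : Matrix V V ℝ) (x y z : V) :
    discriminant (absorbing P {x}) y z =
      (if y = x ∨ z = x then 0 else discriminant P y z) + if y = x ∧ z = x then 1 else 0 := by
  simp only [discriminant, absorbing, Matrix.of_apply, Finset.mem_singleton]
  by_cases hy : y = x <;> by_cases hz : z = x <;> simp [hy, hz]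

theorem unmarkedAmplitude_nonneg {V : Type*} [DecidableEq V] (π : V → ℝ) (x y : V) : 0 ≤ unmarkedAmplitude π {x} y := by
  unfold unmarkedAmplitude
  split_ifs <;> positivity

theorem hittingTime_le_maxHittingTime {V : Type*} [Fintype V] [DecidableEq V] (P : Matrix V V ℝ)
    (π : V → ℝ) (x : V) : hittingTime P π {x} ≤ maxHittingTime P π :=
  le_ciSup (f := fun x => hittingTime P π {x}) (Set.finite_range _).bddAbove x

section HittingTime

variable {V : Type*} [Fintype V] [DecidableEq V] {G : SimpleGraph V} {P : Matrix V V ℝ}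
  {π : V → ℝ}

namespace IsErgodicReversible

variable (h : IsErgodicReversible G P π)

include h

theorem pow_nonneg_apply (n : ℕ) (x y : V) : 0 ≤ (P ^ n) x y := by
  induction n generalizing y with
  | zero => rw [pow_zero, Matrix.one_apply]; split_ifs <;> norm_num
  | succ n ih =>
    rw [pow_succ, Matrix.mul_apply]
    exact Finset.sum_nonneg fun z _ => mul_nonneg (ih z) (h.nonneg z y)

theorem stationary_pow (n : ℕ) (y : V) : ∑ x, π x * (P ^ n) x y = π y := by
  induction n generalizing y with
  | zero => simp [Matrix.one_apply]
  | succ n ih =>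
    simp only [pow_succ, Matrix.mul_apply, Finset.mul_sum]
    rw [Finset.sum_comm, ← h.stationary]
    refine Finset.sum_congr rfl fun z _ => ?_
    rw [← ih z, Finset.sum_mul]
    exact Finset.sum_congr rfl fun x _ => by ring

theorem dist_pos (x : V) : 0 < π x := by
  have h0 : ∃ z, 0 < π z := by
    by_contra! hc
    have := Finset.sum_nonpos fun z (_ : z ∈ Finset.univ) => hc z
    rw [h.dist_sum] at this
    linarith
  obtain ⟨z, hz⟩ := h0
  obtain ⟨n, hn⟩ := h.irreducible z x
  rw [← h.stationary_pow n x]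
  refine (mul_pos hz hn).trans_le (Finset.single_le_sum (f := fun y => π y * (P ^ n) y x)
    (fun y _ => mul_nonneg (h.dist_nonneg y) (h.pow_nonneg_apply n y x)) (Finset.mem_univ z))

theorem dist_lt_one [Nontrivial V] (x : V) : π x < 1 := by
  obtain ⟨y, hy⟩ := exists_ne x
  rw [← h.dist_sum, ← Finset.sum_erase_add _ _ (Finset.mem_univ x)]
  refine lt_add_of_pos_left _ (Finset.sum_pos (fun z _ => h.dist_pos z) ⟨y, by simp [hy]⟩)

theorem sqrt_dist_pos (x : V) : 0 < √(π x) := Real.sqrt_pos.2 (h.dist_pos x)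

theorem sqrt_dist_sq (x : V) : √(π x) ^ 2 = π x := Real.sq_sqrt (h.dist_nonneg x)

theorem reversible_sqrt (x y : V) : √(π x) ^ 2 * P x y = √(π y) ^ 2 * P y x := by
  rw [h.sqrt_dist_sq, h.sqrt_dist_sq, h.reversible]

theorem weight_nonneg (x y : V) : 0 ≤ π x * P x y := mul_nonneg (h.dist_nonneg x) (h.nonneg x y)

theorem sum_weight (x : V) : ∑ y, π x * P x y = π x := by
  rw [← Finset.mul_sum, h.row_sum, mul_one]

theorem eq_of_pow_pos {f : V → ℝ} (hf : dirichletForm (fun x y => π x * P x y) f = 0) (n : ℕ)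
    {x y : V} (hn : 0 < (P ^ n) x y) : f x = f y := by
  induction n generalizing y with
  | zero =>
    rw [pow_zero, Matrix.one_apply] at hn
    split_ifs at hn with hxy
    · rw [hxy]
    · exact absurd hn (lt_irrefl _)
  | succ n ih =>
    rw [pow_succ, Matrix.mul_apply] at hn
    obtain ⟨z, -, hz⟩ := Finset.exists_lt_of_sum_lt (s := Finset.univ) (f := fun _ : V => (0 : ℝ))
      (by simpa using hn)
    have h1 : 0 < (P ^ n) x z := lt_of_le_of_ne (h.pow_nonneg_apply n x z) fun h0 => by
      rw [← h0, zero_mul] at hz; exact lt_irrefl _ hz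
    have h2 : 0 < P z y := lt_of_le_of_ne (h.nonneg z y) fun h0 => by
      rw [← h0, mul_zero] at hz; exact lt_irrefl _ hz
    exact (ih h1).trans (eq_of_dirichletForm_eq_zero h.weight_nonneg hf (mul_pos (h.dist_pos z) h2))

/-- By irreducibility only the constants have vanishing Dirichlet form. -/
theorem eq_of_dirichletForm_eq_zero {f : V → ℝ}
    (hf : dirichletForm (fun x y => π x * P x y) f = 0) (x y : V) : f x = f y := by
  obtain ⟨n, hn⟩ := h.irreducible x y
  exact h.eq_of_pow_pos hf n hn

/-- Absorbing at `x` clears the row and the column of `x` in the discriminant and puts `1` on the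
diagonal. The `x`-coordinate thus drops out of `1 - D'`, which is the same as imposing a zero
boundary value at `x` in the Dirichlet form of the original chain. -/
theorem absorbing_form (x : V) (w : V → ℝ) :
    ∑ y, w y * w y - ∑ y, w y * (discriminant (absorbing P {x}) *ᵥ w) y =
      dirichletForm (fun x y => π x * P x y) fun y => if y = x then 0 else w y / √(π y) := by
  rw [← sum_sub_sum_eq_dirichletForm h.reversible h.sum_weight]
  have e1 : ∑ y, w y * w y = w x * w x + ∑ y, π y * ((if y = x then 0 else w y / √(π y)) *
      (if y = x then 0 else w y / √(π y))) := by
    have e : w x * w x = ∑ y, if y = x then w y * w y else 0 := by simp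
    rw [e, ← Finset.sum_add_distrib]
    refine Finset.sum_congr rfl fun y _ => ?_
    have h1 := h.sqrt_dist_pos y
    have h2 := h.sqrt_dist_sq y
    split_ifs
    · ring
    · rw [div_mul_div_comm, ← sq, ← sq, h2]
      have := (h.dist_pos y).ne'
      field_simp
      ring
  have e2 : ∑ y, w y * (discriminant (absorbing P {x}) *ᵥ w) y = w x * w x +
      ∑ y, ∑ z, π y * P y z * ((if y = x then 0 else w y / √(π y)) *
        (if z = x then 0 else w z / √(π z))) := by
    have e : w x * w x = ∑ y, ∑ z, if y = x ∧ z = x then w y * w z else 0 := by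
      simp only [ite_and, Finset.sum_ite_irrel, Finset.sum_const_zero]
      simp
    rw [e, ← Finset.sum_add_distrib]
    refine Finset.sum_congr rfl fun y _ => ?_
    rw [← Finset.sum_add_distrib, Matrix.mulVec, dotProduct, Finset.mul_sum]
    refine Finset.sum_congr rfl fun z _ => ?_
    rw [discriminant_absorbing P, discriminant_eq h.nonneg h.sqrt_dist_pos h.reversible_sqrt]
    have h1 := h.sqrt_dist_pos y
    have h2 := h.sqrt_dist_sq y
    have h3 := h.sqrt_dist_pos z
    by_cases hy : y = x <;> by_cases hz : z = x <;> simp only [hy, hz, if_true, if_false, or_true,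
      true_or, and_true, and_false, or_self, mul_zero, zero_mul, zero_add, add_zero]
    · ring
    · have e : π y * P y z * (w y / √(π y) * (w z / √(π z))) =
          √(π y) ^ 2 * P y z * (w y / √(π y) * (w z / √(π z))) := by rw [h2]
      rw [e]
      field_simp
  rw [e1, e2]; ring

theorem sum_erase_dist (x : V) : ∑ y, (if y = x then 0 else π y) = 1 - π x := by
  have e : π x = ∑ y, if y = x then π y else 0 := by simp
  rw [← h.dist_sum, e, ← Finset.sum_sub_distrib]
  exact Finset.sum_congr rfl fun y _ => by split_ifs <;> simp

theorem eigenvalues_absorbing_le_one (x k : V) :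
    (discriminant_isHermitian (absorbing P {x})).eigenvalues k ≤ 1 := by
  have h1 := h.absorbing_form x
    ((discriminant_isHermitian (absorbing P {x})).eigenvectorBasis k : V → ℝ)
  rw [eigenvector_sq_sum, eigenvector_form] at h1
  linarith [dirichletForm_nonneg h.weight_nonneg fun y => if y = x then 0 else
    (discriminant_isHermitian (absorbing P {x})).eigenvectorBasis k y / √(π y)]

/-- A fixed vector has vanishing Dirichlet form, so the associated function is constant and equal to
its boundary value `0`. The vector is therefore supported at `x`, where `|π̄⟩` vanishes. This
justifies omitting the eigenvalue `1` in the hitting time. -/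
theorem eigenCoeff_absorbing_eq_zero (x k : V)
    (hk : (discriminant_isHermitian (absorbing P {x})).eigenvalues k = 1) :
    eigenCoeff (discriminant_isHermitian (absorbing P {x})) k (unmarkedAmplitude π {x}) = 0 := by
  have h1 := h.absorbing_form x
    ((discriminant_isHermitian (absorbing P {x})).eigenvectorBasis k : V → ℝ)
  rw [eigenvector_sq_sum, eigenvector_form, hk, sub_self] at h1
  refine Finset.sum_eq_zero fun y _ => ?_
  have h2 := h.eq_of_dirichletForm_eq_zero h1.symm y x
  by_cases hy : y = x
  · simp [hy, unmarkedAmplitude]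
  · simp only [hy, if_true, if_false] at h2
    rw [(div_eq_zero_iff.1 h2).resolve_right (h.sqrt_dist_pos y).ne', zero_mul]

theorem sq_sum_unmarkedAmplitude_le (x : V) (u : V → ℝ) :
    (∑ y, unmarkedAmplitude π {x} y * u y) ^ 2 ≤ hittingTime P π {x} *
      dirichletForm (fun x y => π x * P x y) fun y => if y = x then 0 else u y / √(π y) := by
  rw [← h.absorbing_form x u]
  exact sq_sum_mul_le (discriminant_isHermitian (absorbing P {x}))
    (h.eigenvalues_absorbing_le_one x) (h.eigenCoeff_absorbing_eq_zero x) u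

variable [Nontrivial V]

theorem sum_unmarkedAmplitude_sq (x : V) :
    ∑ y, unmarkedAmplitude π {x} y * unmarkedAmplitude π {x} y = 1 := by
  have h1 : 0 < 1 - π x := sub_pos.2 (h.dist_lt_one x)
  have : ∀ y, unmarkedAmplitude π {x} y * unmarkedAmplitude π {x} y =
      (if y = x then 0 else π y) / (1 - π x) := by
    intro y
    simp only [unmarkedAmplitude, Finset.mem_singleton, Finset.sum_singleton]
    split_ifs
    · simp
    · rw [div_mul_div_comm, Real.mul_self_sqrt (h.dist_nonneg y), Real.mul_self_sqrt h1.le]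
  simp only [this]
  rw [← Finset.sum_div, h.sum_erase_dist, div_self h1.ne']

/-- Test the Cauchy-Schwarz bound on `|π̄⟩` itself: the form of `1 - D'` there is at most `1`,
because `D'` and `|π̄⟩` have nonnegative entries. -/
theorem one_le_hittingTime (x : V) : 1 ≤ hittingTime P π {x} := by
  have h1 := h.sq_sum_unmarkedAmplitude_le x (unmarkedAmplitude π {x})
  rw [← h.absorbing_form, h.sum_unmarkedAmplitude_sq, one_pow] at h1
  have h0 : 0 ≤ ∑ y, unmarkedAmplitude π {x} y *
      (discriminant (absorbing P {x}) *ᵥ unmarkedAmplitude π {x}) y :=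
    Finset.sum_nonneg fun y _ => mul_nonneg (unmarkedAmplitude_nonneg _ x y)
      (Finset.sum_nonneg fun z _ => mul_nonneg (discriminant_nonneg _ _ _)
        (unmarkedAmplitude_nonneg _ x z))
  have h2 : 0 ≤ hittingTime P π {x} := by
    refine Finset.sum_nonneg fun k _ => div_nonneg (sq_nonneg _) ?_
    linarith [h.eigenvalues_absorbing_le_one x k]
  nlinarith

theorem one_le_maxHittingTime : 1 ≤ maxHittingTime P π := by
  obtain ⟨x⟩ : Nonempty V := inferInstance
  exact (h.one_le_hittingTime x).trans (hittingTime_le_maxHittingTime P π x)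

/-- The bridge from hitting times to spectral gaps: the Cauchy-Schwarz bound for the chain absorbed
at `x` is applied to `√π (f - f x)`, which already satisfies the boundary condition. -/
theorem sq_sub_mean_le (f : V → ℝ) (x : V) :
    (∑ y, π y * f y - f x) ^ 2 ≤
      maxHittingTime P π * dirichletForm (fun x y => π x * P x y) f := by
  have h1 : 0 < 1 - π x := sub_pos.2 (h.dist_lt_one x)
  have h2 := h.sq_sum_unmarkedAmplitude_le x fun y => √(π y) * (f y - f x)
  have e1 : (fun y => if y = x then 0 else √(π y) * (f y - f x) / √(π y)) = fun y => f y - f x := by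
    ext y
    have := (h.sqrt_dist_pos y).ne'
    split_ifs with hy
    · rw [hy, sub_self]
    · field_simp
  have e2 : ∑ y, unmarkedAmplitude π {x} y * (√(π y) * (f y - f x)) =
      (∑ y, π y * f y - f x) / √(1 - π x) := by
    have e3 : ∑ y, π y * f y - f x = ∑ y, π y * (f y - f x) := by
      simp only [mul_sub, Finset.sum_sub_distrib]
      rw [← Finset.sum_mul, h.dist_sum, one_mul]
    rw [e3, Finset.sum_div]
    refine Finset.sum_congr rfl fun y _ => ?_
    simp only [unmarkedAmplitude, Finset.mem_singleton, Finset.sum_singleton]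
    split_ifs with hy
    · simp [hy]
    · nth_rw 3 [← Real.mul_self_sqrt (h.dist_nonneg y)]
      ring
  rw [e1, e2, dirichletForm_sub_const, div_pow, Real.sq_sqrt h1.le, div_le_iff₀ h1] at h2
  have h3 := dirichletForm_nonneg h.weight_nonneg f
  have h4 := h.one_le_hittingTime x
  -- The factor `1 - π x`, left by the normalization of `|π̄⟩`, is at most `1` and is dropped.
  have h5 : hittingTime P π {x} * dirichletForm (fun x y => π x * P x y) f * (1 - π x) ≤
      hittingTime P π {x} * dirichletForm (fun x y => π x * P x y) f :=
    mul_le_of_le_one_right (by positivity) (by linarith [h.dist_nonneg x])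
  exact (h2.trans h5).trans (mul_le_mul_of_nonneg_right (hittingTime_le_maxHittingTime P π x) h3)

theorem sq_sub_le (f : V → ℝ) (x y : V) :
    (f x - f y) ^ 2 ≤
      4 * maxHittingTime P π * dirichletForm (fun x y => π x * P x y) f := by
  have h1 := h.sq_sub_mean_le f x
  have h2 := h.sq_sub_mean_le f y
  nlinarith [sq_nonneg ((∑ y, π y * f y - f x) + (∑ y, π y * f y - f y))]

end IsErgodicReversible

end HittingTime

/-! ### The interpolated chain -/

/-- The stationary distribution of the interpolated chain `P(s)`. -/
noncomputable def interpDist {V : Type*} [DecidableEq V] (π : V → ℝ) (g : V) (s : ℝ) (x : V) : ℝ :=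
  ((1 - s) * π x + if x = g then s * π g else 0) / (1 - s * (1 - π g))

theorem interpolated_apply {V : Type*} [DecidableEq V] (P : Matrix V V ℝ) (g : V) (s : ℝ) (x y : V) :
    interpolated P g s x y =
      (1 - s) * P x y + s * if x = g then (if y = x then 1 else 0) else P x y := by
  simp [interpolated, absorbing]

section Interpolated

variable {V : Type*} [Fintype V] [DecidableEq V] {G : SimpleGraph V} {P : Matrix V V ℝ}
  {π : V → ℝ} {s : ℝ}

namespace IsErgodicReversible

variable (h : IsErgodicReversible G P π) (g : V) (hs0 : 0 ≤ s) (hs1 : s < 1)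

include h hs0

theorem interpolated_nonneg (hs1 : s ≤ 1) (x y : V) : 0 ≤ interpolated P g s x y := by
  rw [interpolated_apply]
  have := h.nonneg x y
  have := sub_nonneg.2 hs1
  split_ifs <;> positivity

omit hs0 in
theorem interpolated_row_sum (x : V) : ∑ y, interpolated P g s x y = 1 := by
  simp only [interpolated_apply, Finset.sum_add_distrib, ← Finset.mul_sum, h.row_sum]
  split_ifs
  · simp
  · rw [h.row_sum]; ring

include hs1

theorem interpDist_denom_pos : 0 < 1 - s * (1 - π g) := by
  have := h.dist_pos g
  nlinarith

theorem interpDist_pos (x : V) : 0 < interpDist π g s x := by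
  refine div_pos ?_ (h.interpDist_denom_pos g hs0 hs1)
  have := h.dist_pos x
  have := h.dist_pos g
  have := sub_pos.2 hs1
  split_ifs <;> positivity

theorem sum_interpDist : ∑ x, interpDist π g s x = 1 := by
  unfold interpDist
  rw [← Finset.sum_div, Finset.sum_add_distrib, ← Finset.mul_sum, h.dist_sum,
    div_eq_one_iff_eq (h.interpDist_denom_pos g hs0 hs1).ne']
  simp only [Finset.sum_ite_eq', Finset.mem_univ, if_true]
  ring

omit hs0 hs1 h [Fintype V] in
-- The stationary flow of `P(s)` is a rescaled flow of `P` plus a loop at `g`. This gives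
-- reversibility, and, since loops do not enter a Dirichlet form, also its scaling.
theorem interpDist_mul_interpolated (x y : V) :
    interpDist π g s x * interpolated P g s x y =
      ((1 - s) / (1 - s * (1 - π g))) * (π x * P x y) +
        if x = g ∧ y = g then s * π g / (1 - s * (1 - π g)) else 0 := by
  rw [interpolated_apply, interpDist]
  by_cases hx : x = g <;> by_cases hy : y = g <;> simp [hx, hy] <;> ring

omit hs0 hs1 in
theorem interpDist_reversible (x y : V) :
    interpDist π g s x * interpolated P g s x y = interpDist π g s y * interpolated P g s y x := by
  rw [interpDist_mul_interpolated, interpDist_mul_interpolated, h.reversible x y]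
  simp only [and_comm]

theorem sqrt_interpDist_pos (x : V) : 0 < √(interpDist π g s x) :=
  Real.sqrt_pos.2 (h.interpDist_pos g hs0 hs1 x)

theorem sqrt_interpDist_sq (x : V) : √(interpDist π g s x) ^ 2 = interpDist π g s x :=
  Real.sq_sqrt (h.interpDist_pos g hs0 hs1 x).le

theorem sqrt_interpDist_reversible (x y : V) :
    √(interpDist π g s x) ^ 2 * interpolated P g s x y =
      √(interpDist π g s y) ^ 2 * interpolated P g s y x := by
  rw [h.sqrt_interpDist_sq g hs0 hs1, h.sqrt_interpDist_sq g hs0 hs1, h.interpDist_reversible]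

omit hs0 hs1 in
theorem sum_interpDist_weight (x : V) :
    ∑ y, interpDist π g s x * interpolated P g s x y = interpDist π g s x := by
  rw [← Finset.mul_sum, h.interpolated_row_sum, mul_one]

omit hs0 hs1 h in
theorem dirichletForm_interpolated (f : V → ℝ) :
    dirichletForm (fun x y => interpDist π g s x * interpolated P g s x y) f =
      ((1 - s) / (1 - s * (1 - π g))) * dirichletForm (fun x y => π x * P x y) f := by
  unfold dirichletForm
  rw [mul_div_assoc', Finset.mul_sum]
  congr 1
  refine Finset.sum_congr rfl fun x _ => ?_
  rw [Finset.mul_sum]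
  refine Finset.sum_congr rfl fun y _ => ?_
  beta_reduce
  rw [interpDist_mul_interpolated]
  split_ifs with hxy
  · rw [hxy.1, hxy.2]; ring
  · ring

omit hs0 hs1 in
theorem sum_weight_mul_nonneg (f : V → ℝ) : 0 ≤ ∑ x, ∑ y, π x * P x y * (f x * f y) := by
  have h1 := sum_mul_discriminant_mulVec h.nonneg h.sqrt_dist_pos h.reversible_sqrt f
  simp only [h.sqrt_dist_sq] at h1
  rw [← h1, sum_mul_mulVec_eq (discriminant_isHermitian P) fun y => √(π y) * f y]
  refine Finset.sum_nonneg fun k _ => mul_nonneg (h.eigenvalue_nonneg _ ?_) (sq_nonneg _)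
  refine mem_spectrum_of_discriminant h.nonneg h.sqrt_dist_pos h.reversible_sqrt
    (v := ((discriminant_isHermitian P).eigenvectorBasis k : V → ℝ)) (fun h0 => ?_)
    ((discriminant_isHermitian P).mulVec_eigenvectorBasis k)
  have := eigenvector_sq_sum (discriminant_isHermitian P) k
  simp [h0] at this

theorem sum_interpDist_mul_sq_pos {f : V → ℝ} (hf : f ≠ 0) :
    0 < ∑ x, interpDist π g s x * (f x * f x) := by
  obtain ⟨x, hx⟩ := Function.ne_iff.1 hf
  refine Finset.sum_pos' (fun y _ => mul_nonneg (h.interpDist_pos g hs0 hs1 y).le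
    (mul_self_nonneg _)) ⟨x, Finset.mem_univ x, mul_pos (h.interpDist_pos g hs0 hs1 x) ?_⟩
  exact mul_self_pos.2 hx

/-- The eigenvalues of the interpolated chain are nonnegative. -/
theorem interpolated_eigenvalue_nonneg {f : V → ℝ} (hf : f ≠ 0) {μ : ℝ}
    (hμ : interpolated P g s *ᵥ f = μ • f) : 0 ≤ μ := by
  have h1 : ∑ x, ∑ y, interpDist π g s x * interpolated P g s x y * (f x * f y) =
      μ * ∑ x, interpDist π g s x * (f x * f x) := by
    rw [Finset.mul_sum]
    refine Finset.sum_congr rfl fun x _ => ?_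
    have h2 : ∑ y, interpolated P g s x y * f y = μ * f x := congrFun hμ x
    calc _ = interpDist π g s x * f x * ∑ y, interpolated P g s x y * f y := by
          rw [Finset.mul_sum]; exact Finset.sum_congr rfl fun y _ => by ring
      _ = _ := by rw [h2]; ring
  have h3 : 0 ≤ ∑ x, ∑ y, interpDist π g s x * interpolated P g s x y * (f x * f y) := by
    -- The loop at `g` contributes a nonnegative square, so positivity of the form of `P` passes to
    -- `P(s)`.
    have e : ∑ x, ∑ y, interpDist π g s x * interpolated P g s x y * (f x * f y) =
        ((1 - s) / (1 - s * (1 - π g))) * (∑ x, ∑ y, π x * P x y * (f x * f y)) +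
          s * π g / (1 - s * (1 - π g)) * (f g * f g) := by
      have e2 : s * π g / (1 - s * (1 - π g)) * (f g * f g) = ∑ x, ∑ y,
          if x = g ∧ y = g then s * π g / (1 - s * (1 - π g)) * (f x * f y) else 0 := by
        simp only [ite_and, Finset.sum_ite_irrel, Finset.sum_const_zero]
        simp
      rw [e2]
      simp only [Finset.mul_sum, ← Finset.sum_add_distrib]
      refine Finset.sum_congr rfl fun x _ => Finset.sum_congr rfl fun y _ => ?_
      rw [interpDist_mul_interpolated]
      split_ifs <;> ring
    rw [e]
    have := h.interpDist_denom_pos g hs0 hs1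
    have := h.sum_weight_mul_nonneg f
    have := h.dist_pos g
    have := sub_pos.2 hs1
    have := mul_self_nonneg (f g)
    positivity
  rw [h1] at h3
  exact nonneg_of_mul_nonneg_left h3 (h.sum_interpDist_mul_sq_pos g hs0 hs1 hf)

omit hs0 hs1 in
theorem interpolated_eigenvalue_form {f : V → ℝ} {μ : ℝ}
    (hμ : interpolated P g s *ᵥ f = μ • f) :
    (1 - μ) * ∑ x, interpDist π g s x * (f x * f x) =
      ((1 - s) / (1 - s * (1 - π g))) * dirichletForm (fun x y => π x * P x y) f := by
  rw [← dirichletForm_interpolated, ← sum_sub_sum_eq_dirichletForm (h.interpDist_reversible g)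
    (h.sum_interpDist_weight g), sub_mul, one_mul, Finset.mul_sum]
  congr 1
  refine Finset.sum_congr rfl fun x _ => ?_
  have h2 : ∑ y, interpolated P g s x y * f y = μ * f x := congrFun hμ x
  calc _ = interpDist π g s x * f x * (μ * f x) := by ring
    _ = _ := by
      rw [← h2, Finset.mul_sum]; exact Finset.sum_congr rfl fun y _ => by ring

/-- The eigenfunctions of the interpolated chain with eigenvalue `1` are constant. -/
theorem interpolated_eq_of_eigenvalue_one {f : V → ℝ}
    (hf : interpolated P g s *ᵥ f = f) (x y : V) : f x = f y := by
  have h1 := h.interpolated_eigenvalue_form g (f := f) (μ := 1) (by rwa [one_smul])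
  rw [sub_self, zero_mul, eq_comm, mul_eq_zero] at h1
  refine h.eq_of_dirichletForm_eq_zero (h1.resolve_left ?_) x y
  exact (div_pos (sub_pos.2 hs1) (h.interpDist_denom_pos g hs0 hs1)).ne'

variable [Nontrivial V]

/-- A Poincaré inequality for `P(s)` uniform in `s`. The second moment of a mean-zero `f` is at most
the one about `f g`. That moment ignores the vertex `g`, and on the other vertices the stationary
mass carries the same factor as the Dirichlet form. -/
theorem interpolated_eigenvalue_le {f : V → ℝ} (hf : f ≠ 0) {μ : ℝ}
    (hμ : interpolated P g s *ᵥ f = μ • f) (hμ1 : μ ≠ 1) :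
    μ ≤ 1 - 1 / (4 * maxHittingTime P π) := by
  have hHT := h.one_le_maxHittingTime
  have hN := h.sum_interpDist_mul_sq_pos g hs0 hs1 hf
  have h1 := h.interpolated_eigenvalue_form g hμ
  have hα := div_pos (sub_pos.2 hs1) (h.interpDist_denom_pos g hs0 hs1)
  -- Stationarity gives `μ E f = E f`, and `μ ≠ 1`.
  have hmean : ∑ x, interpDist π g s x * f x = 0 := by
    have e : ∑ x, interpDist π g s x * (μ * f x) = ∑ x, interpDist π g s x * f x := by
      have : ∀ x, μ * f x = ∑ y, interpolated P g s x y * f y := fun x => (congrFun hμ x).symm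
      simp only [this, Finset.mul_sum]
      rw [Finset.sum_comm]
      refine Finset.sum_congr rfl fun y _ => ?_
      rw [← h.sum_interpDist_weight g y, Finset.sum_mul]
      refine Finset.sum_congr rfl fun x _ => ?_
      rw [← mul_assoc, h.interpDist_reversible]
    have e2 : μ * ∑ x, interpDist π g s x * f x = ∑ x, interpDist π g s x * f x := by
      rw [Finset.mul_sum, ← e]; exact Finset.sum_congr rfl fun x _ => by ring
    have e3 : (μ - 1) * ∑ x, interpDist π g s x * f x = 0 := by rw [sub_mul, e2]; ring
    exact (mul_eq_zero.1 e3).resolve_left (sub_ne_zero.2 hμ1)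
  have h2 : ∑ x, interpDist π g s x * (f x * f x) ≤
      ∑ x, interpDist π g s x * (f x - f g) ^ 2 := by
    have e : ∑ x, interpDist π g s x * (f x - f g) ^ 2 =
        ∑ x, interpDist π g s x * (f x * f x) - 2 * f g * ∑ x, interpDist π g s x * f x +
          f g ^ 2 * ∑ x, interpDist π g s x := by
      simp only [Finset.mul_sum, ← Finset.sum_add_distrib, ← Finset.sum_sub_distrib]
      exact Finset.sum_congr rfl fun x _ => by ring
    rw [e, hmean, h.sum_interpDist g hs0 hs1]
    nlinarith [sq_nonneg (f g)]
  have h3 : ∑ x, interpDist π g s x * (f x - f g) ^ 2 ≤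
      ((1 - s) / (1 - s * (1 - π g))) *
        (4 * maxHittingTime P π * dirichletForm (fun x y => π x * P x y) f) := by
    -- At `x = g`, the only vertex where the two weights are not proportional in this way, both
    -- sides vanish.
    have e : ∀ x, interpDist π g s x * (f x - f g) ^ 2 =
        ((1 - s) / (1 - s * (1 - π g))) * (π x * (f x - f g) ^ 2) := by
      intro x
      unfold interpDist
      split_ifs with hx
      · rw [hx]; ring
      · ring
    simp only [e]
    rw [← Finset.mul_sum]
    refine mul_le_mul_of_nonneg_left ?_ hα.le
    calc _ ≤ ∑ x, π x * (4 * maxHittingTime P π * dirichletForm (fun x y => π x * P x y) f) :=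
          Finset.sum_le_sum fun x _ => mul_le_mul_of_nonneg_left (h.sq_sub_le f x g)
            (h.dist_nonneg x)
      _ = _ := by rw [← Finset.sum_mul, h.dist_sum, one_mul]
  have h4 : ∑ x, interpDist π g s x * (f x * f x) ≤
      4 * maxHittingTime P π * (1 - μ) * ∑ x, interpDist π g s x * (f x * f x) := by
    refine (h2.trans h3).trans (le_of_eq ?_)
    rw [mul_assoc (4 * maxHittingTime P π) (1 - μ), h1]; ring
  have h5 : 1 ≤ 4 * maxHittingTime P π * (1 - μ) := by
    by_contra! hc
    have := mul_lt_mul_of_pos_right hc hN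
    linarith
  rw [le_sub_comm, div_le_iff₀ (by positivity)]
  linarith

theorem spectrum_interpolated_le {μ : ℝ} (hμ : μ ∈ spectrum ℝ (interpolated P g s) \ {1}) :
    μ ≤ 1 - 1 / (4 * maxHittingTime P π) := by
  obtain ⟨f, hf, hf1⟩ := exists_mulVec_of_mem_spectrum hμ.1
  exact h.interpolated_eigenvalue_le g hs0 hs1 hf hf1 hμ.2

theorem eigenvalueGap_interpolated_ge :
    1 / (4 * maxHittingTime P π) ≤ eigenvalueGap (interpolated P g s) := by
  have hHT := h.one_le_maxHittingTime
  have h1 : sSup (spectrum ℝ (interpolated P g s) \ {1}) ≤ 1 - 1 / (4 * maxHittingTime P π) := by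
    -- The remaining goal, nonnegativity of the bound, covers an empty spectrum off `1`, where
    -- `sSup` is `0`.
    refine Real.sSup_le (fun μ hμ => h.spectrum_interpolated_le g hs0 hs1 hμ) ?_
    rw [sub_nonneg, div_le_one (by positivity)]
    linarith
  unfold eigenvalueGap
  linarith

theorem le_one_sub_eigenvalueGap {v : V → ℝ} (hv0 : v ≠ 0) {μ : ℝ}
    (hv : discriminant (interpolated P g s) *ᵥ v = μ • v) (hμ : μ ≠ 1) :
    μ ≤ 1 - eigenvalueGap (interpolated P g s) := by
  rw [eigenvalueGap, sub_sub_cancel]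
  refine le_csSup ⟨_, fun μ hμ => h.spectrum_interpolated_le g hs0 hs1 hμ⟩ ⟨?_, hμ⟩
  exact mem_spectrum_of_discriminant (h.interpolated_nonneg g hs0 hs1.le)
    (h.sqrt_interpDist_pos g hs0 hs1) (h.sqrt_interpDist_reversible g hs0 hs1) hv0 hv

omit [Nontrivial V] in
theorem discriminant_eigenvalue_nonneg {v : V → ℝ} (hv0 : v ≠ 0) {μ : ℝ}
    (hv : discriminant (interpolated P g s) *ᵥ v = μ • v) : 0 ≤ μ := by
  obtain ⟨f, hf, hf1⟩ := exists_mulVec_of_mem_spectrum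
    (mem_spectrum_of_discriminant (h.interpolated_nonneg g hs0 hs1.le)
      (h.sqrt_interpDist_pos g hs0 hs1) (h.sqrt_interpDist_reversible g hs0 hs1) hv0 hv)
  exact h.interpolated_eigenvalue_nonneg g hs0 hs1 hf hf1

omit [Nontrivial V] in
/-- The fixed vectors of the discriminant of the interpolated chain are the multiples of the
stationary state. -/
theorem eq_smul_of_discriminant_eigenvalue_one {v : V → ℝ}
    (hv : discriminant (interpolated P g s) *ᵥ v = v) :
    ∃ c, ∀ x, v x = c * √(interpDist π g s x) := by
  have h1 := mulVec_div_of_discriminant (h.interpolated_nonneg g hs0 hs1.le)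
    (h.sqrt_interpDist_pos g hs0 hs1) (h.sqrt_interpDist_reversible g hs0 hs1)
    (v := v) (μ := 1) (by rwa [one_smul])
  rw [one_smul] at h1
  refine ⟨v g / √(interpDist π g s g), fun x => ?_⟩
  rw [← h.interpolated_eq_of_eigenvalue_one g hs0 hs1 h1 x g]
  have := (h.sqrt_interpDist_pos g hs0 hs1 x).ne'
  field_simp

end IsErgodicReversible

end Interpolated

/-! ### The walk operator -/

theorem sum_norm_sq_mulVec {ι : Type*} [Fintype ι] [DecidableEq ι] {B : Matrix ι ι ℂ}
    (hB : B ∈ Matrix.unitaryGroup ι ℂ) (v : ι → ℂ) :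
    ∑ i, ‖(B *ᵥ v) i‖ ^ 2 = ∑ i, ‖v i‖ ^ 2 := by
  have e : ∀ v : ι → ℂ, ((∑ i, ‖v i‖ ^ 2 : ℝ) : ℂ) = star v ⬝ᵥ v := by
    intro v
    simp only [dotProduct, Pi.star_apply, RCLike.star_def, Complex.conj_mul']
    push_cast
    rfl
  rw [← Complex.ofReal_inj, e, e, Matrix.star_mulVec, Matrix.dotProduct_mulVec, Matrix.vecMul_vecMul,
    ← Matrix.star_eq_conjTranspose, Matrix.mem_unitaryGroup_iff'.1 hB, Matrix.vecMul_one]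

section WalkOperator

variable {V : Type*} {G : SimpleGraph V}

open Classical in
/-- The permutation of the basis states performed by the swap operator. -/
noncomputable def edgeSwap (G : SimpleGraph V) (b : V × V) : V × V :=
  if G.Adj b.1 b.2 then (b.2, b.1) else b

theorem edgeSwap_involutive (G : SimpleGraph V) : Function.Involutive (edgeSwap G) := by
  intro b
  unfold edgeSwap
  by_cases h : G.Adj b.1 b.2
  · simp [h, h.symm]
  · simp [h]

open Classical in
theorem swapOperator_apply (G : SimpleGraph V) (a b : V × V) :
    swapOperator G a b = if a = edgeSwap G b then 1 else 0 := rfl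

variable [Fintype V]

theorem swapOperator_mulVec (G : SimpleGraph V) (ψ : V × V → ℂ) (a : V × V) :
    (swapOperator G *ᵥ ψ) a = ψ (edgeSwap G a) := by
  classical
  have : ∀ b, (a = edgeSwap G b) ↔ (b = edgeSwap G a) := fun b =>
    ⟨fun h => by rw [h, edgeSwap_involutive], fun h => by rw [h, edgeSwap_involutive]⟩
  simp only [Matrix.mulVec, dotProduct, swapOperator_apply]
  rw [Finset.sum_eq_single (edgeSwap G a)]
  · rw [if_pos ((this _).2 rfl), one_mul]
  · intro b _ hb
    rw [if_neg (fun h => hb ((this b).1 h)), zero_mul]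
  · simp

variable [DecidableEq V]

theorem matrix_ext_mulVec {m n : Type*} [Fintype n] [DecidableEq n] {A B : Matrix m n ℂ}
    (h : ∀ v, A *ᵥ v = B *ᵥ v) : A = B := by
  ext i j
  have := congrFun (h (Pi.single j 1)) i
  simpa using this

theorem swapOperator_mul_self (G : SimpleGraph V) : swapOperator G * swapOperator G = 1 := by
  refine matrix_ext_mulVec fun v => ?_
  ext a
  rw [← Matrix.mulVec_mulVec, swapOperator_mulVec, swapOperator_mulVec, edgeSwap_involutive,
    Matrix.one_mulVec]

omit [Fintype V] in
theorem swapOperator_conjTranspose (G : SimpleGraph V) :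
    (swapOperator G).conjTranspose = swapOperator G := by
  classical
  ext a b
  have : (b = edgeSwap G a) ↔ (a = edgeSwap G b) :=
    ⟨fun h => by rw [h, edgeSwap_involutive], fun h => by rw [h, edgeSwap_involutive]⟩
  simp only [Matrix.conjTranspose_apply, swapOperator_apply, this]
  split_ifs <;> simp

omit [Fintype V] in
theorem reflection_conjTranspose (o : V) : (reflection o).conjTranspose = reflection o := by
  ext a b
  simp only [Matrix.conjTranspose_apply, reflection, Matrix.of_apply]
  by_cases h : a = b
  · simp only [h, if_true]; split_ifs <;> simp
  · simp [h, Ne.symm h]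

theorem reflection_mulVec (o : V) (ψ : V × V → ℂ) (a : V × V) :
    (reflection o *ᵥ ψ) a = if a.2 = o then ψ a else -ψ a := by
  simp only [Matrix.mulVec, dotProduct, reflection, Matrix.of_apply]
  rw [Finset.sum_eq_single a]
  · simp only [if_true]; split_ifs <;> simp
  · intro b _ hb; simp [Ne.symm hb]
  · simp

theorem reflection_mul_self (o : V) : reflection o * reflection o = 1 := by
  refine matrix_ext_mulVec fun v => ?_
  ext a
  rw [← Matrix.mulVec_mulVec, reflection_mulVec, reflection_mulVec, Matrix.one_mulVec]
  split_ifs <;> simp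

/-- The state `u ⊗ |o⟩`. -/
def tensorBase {V : Type*} [DecidableEq V] (o : V) (u : V → ℂ) (a : V × V) : ℂ :=
  if a.2 = o then u a.1 else 0

omit [Fintype V] in
theorem tensorBase_smul (o : V) (c : ℂ) (u : V → ℂ) :
    tensorBase o (c • u) = c • tensorBase o u := by
  ext a
  simp [tensorBase]

variable {Q : Matrix V V ℝ} {o : V} {A : Matrix (V × V) (V × V) ℂ}

theorem walkOperator_mem_unitaryGroup (hA : A ∈ Matrix.unitaryGroup (V × V) ℂ) :
    walkOperator G o A ∈ Matrix.unitaryGroup (V × V) ℂ := by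
  refine mul_mem (mul_mem (mul_mem (Unitary.star_mem hA) ?_) hA) ?_
  · rw [Matrix.mem_unitaryGroup_iff, Matrix.star_eq_conjTranspose, swapOperator_conjTranspose,
      swapOperator_mul_self]
  · rw [Matrix.mem_unitaryGroup_iff, Matrix.star_eq_conjTranspose, reflection_conjTranspose,
      reflection_mul_self]

/-- The reflection `V† S V`. -/
noncomputable def walkSwap (G : SimpleGraph V) (A : Matrix (V × V) (V × V) ℂ) :
    Matrix (V × V) (V × V) ℂ := A.conjTranspose * swapOperator G * A

theorem walkSwap_mul_self (hA : A ∈ Matrix.unitaryGroup (V × V) ℂ) :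
    walkSwap G A * walkSwap G A = 1 := by
  have h1 : A * A.conjTranspose = 1 := Matrix.mem_unitaryGroup_iff.1 hA
  have h2 : A.conjTranspose * A = 1 := Matrix.mem_unitaryGroup_iff'.1 hA
  calc _ = A.conjTranspose * swapOperator G * (A * A.conjTranspose) * swapOperator G * A := by
        simp only [walkSwap, Matrix.mul_assoc]
    _ = A.conjTranspose * (swapOperator G * swapOperator G) * A := by
        rw [h1, Matrix.mul_one]; simp only [Matrix.mul_assoc]
    _ = 1 := by rw [swapOperator_mul_self, Matrix.mul_one, h2]

theorem walkOperator_mulVec (ψ : V × V → ℂ) :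
    walkOperator G o A *ᵥ ψ = walkSwap G A *ᵥ (reflection o *ᵥ ψ) := by
  rw [Matrix.mulVec_mulVec]; rfl

theorem reflection_mulVec_tensorBase (u : V → ℂ) :
    reflection o *ᵥ tensorBase o u = tensorBase o u := by
  ext a
  rw [reflection_mulVec, tensorBase]
  split_ifs <;> simp

theorem reflection_mulVec_eq (ψ : V × V → ℂ) :
    reflection o *ᵥ ψ = (2 : ℂ) • tensorBase o (fun x => ψ (x, o)) - ψ := by
  ext ⟨x, y⟩
  rw [reflection_mulVec]
  simp only [tensorBase, Pi.sub_apply, Pi.smul_apply, smul_eq_mul]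
  split_ifs with h
  · rw [h]; ring
  · ring

/-- `W² |u⟩|o⟩ = 2 W |D u⟩|o⟩ - |u⟩|o⟩`, where `D` is the block of `V† S V` at `|o⟩`. -/
theorem walkOperator_sq_mulVec (hA : A ∈ Matrix.unitaryGroup (V × V) ℂ) (u : V → ℂ) :
    walkOperator G o A *ᵥ (walkOperator G o A *ᵥ tensorBase o u) =
      (2 : ℂ) • walkOperator G o A *ᵥ tensorBase o
        (fun x => (walkSwap G A *ᵥ tensorBase o u) (x, o)) - tensorBase o u := by
  rw [walkOperator_mulVec (tensorBase o u), reflection_mulVec_tensorBase, walkOperator_mulVec,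
    walkOperator_mulVec, reflection_mulVec_eq, reflection_mulVec_tensorBase, Matrix.mulVec_sub,
    Matrix.mulVec_smul, Matrix.mulVec_mulVec _ (walkSwap G A) (walkSwap G A), walkSwap_mul_self hA,
    Matrix.one_mulVec]

theorem IsWalkIsometry.mulVec_tensorBase (hA : IsWalkIsometry Q o A) (u : V → ℂ) (z y : V) :
    (A *ᵥ tensorBase o u) (z, y) = (√(Q z y) : ℝ) * u z := by
  simp only [Matrix.mulVec, dotProduct, Fintype.sum_prod_type, tensorBase, mul_ite, mul_zero,
    Finset.sum_ite_eq', Finset.mem_univ, if_true, hA.apply, ite_mul, zero_mul, Finset.sum_ite_eq]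

/-- On the image of `|u⟩|o⟩` the edge swap acts as the full swap: off-diagonal non-edges carry no
amplitude, and diagonal pairs are symmetric. -/
theorem IsWalkIsometry.swap_mulVec_tensorBase (hA : IsWalkIsometry Q o A)
    (hsupp : ∀ x y, x ≠ y → ¬ G.Adj x y → Q x y = 0) (u : V → ℂ) (z y : V) :
    (swapOperator G *ᵥ (A *ᵥ tensorBase o u)) (z, y) = (√(Q y z) : ℝ) * u y := by
  rw [swapOperator_mulVec, edgeSwap]
  split_ifs with h
  · rw [hA.mulVec_tensorBase]
  · rw [hA.mulVec_tensorBase]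
    by_cases hzy : z = y
    · rw [hzy]
    · rw [hsupp z y hzy h, hsupp y z (Ne.symm hzy) (fun h' => h h'.symm)]
      simp

theorem walkSwap_block (hA : IsWalkIsometry Q o A) (hQ : ∀ x y, 0 ≤ Q x y)
    (hsupp : ∀ x y, x ≠ y → ¬ G.Adj x y → Q x y = 0) (u : V → ℂ) (x : V) :
    (walkSwap G A *ᵥ tensorBase o u) (x, o) = ∑ y, (discriminant Q x y : ℂ) * u y := by
  have e : walkSwap G A *ᵥ tensorBase o u =
      A.conjTranspose *ᵥ (swapOperator G *ᵥ (A *ᵥ tensorBase o u)) := by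
    simp only [walkSwap, Matrix.mulVec_mulVec, Matrix.mul_assoc]
  rw [e, Matrix.mulVec, dotProduct, Fintype.sum_prod_type, Finset.sum_comm]
  refine Finset.sum_congr rfl fun y _ => ?_
  simp only [hA.swap_mulVec_tensorBase hsupp, Matrix.conjTranspose_apply, hA.apply]
  rw [Finset.sum_eq_single x]
  · simp only [if_true, discriminant, Matrix.of_apply, Real.sqrt_mul (hQ x y), RCLike.star_def,
      Complex.conj_ofReal]
    push_cast; ring
  · intro z _ hz; simp [hz]
  · simp

/-- Detailed balance, after square roots, says that `V |ρ⟩|o⟩` is symmetric in the two registers,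
hence fixed by the swap. -/
theorem walkOperator_mulVec_stationary {ρ : V → ℝ} (hA : IsWalkIsometry Q o A)
    (hρ : ∀ x, 0 < ρ x) (hrev : ∀ x y, ρ x ^ 2 * Q x y = ρ y ^ 2 * Q y x)
    (hsupp : ∀ x y, x ≠ y → ¬ G.Adj x y → Q x y = 0) :
    walkOperator G o A *ᵥ tensorBase o (fun x => (ρ x : ℂ)) = tensorBase o (fun x => (ρ x : ℂ)) := by
  have h1 : swapOperator G *ᵥ (A *ᵥ tensorBase o (fun x => (ρ x : ℂ))) =
      A *ᵥ tensorBase o (fun x => (ρ x : ℂ)) := by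
    ext ⟨z, y⟩
    rw [hA.swap_mulVec_tensorBase hsupp, hA.mulVec_tensorBase]
    have h2 := congrArg Real.sqrt (hrev y z)
    rw [Real.sqrt_mul (sq_nonneg _), Real.sqrt_mul (sq_nonneg _), Real.sqrt_sq (hρ _).le,
      Real.sqrt_sq (hρ _).le] at h2
    rw [← Complex.ofReal_mul, ← Complex.ofReal_mul, mul_comm, h2, mul_comm]
  have h2 : A.conjTranspose * A = 1 := Matrix.mem_unitaryGroup_iff'.1 hA.unitary
  rw [walkOperator_mulVec, reflection_mulVec_tensorBase, walkSwap, ← Matrix.mulVec_mulVec,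
    ← Matrix.mulVec_mulVec, h1, Matrix.mulVec_mulVec, h2, Matrix.one_mulVec]

/-- On an eigenvector of the discriminant with eigenvalue `cos θ`, the powers of the walk operator
act as the Chebyshev polynomials `cos (l θ)`. -/
theorem walkOperator_pow_block (hA : IsWalkIsometry Q o A) (hQ : ∀ x y, 0 ≤ Q x y)
    (hsupp : ∀ x y, x ≠ y → ¬ G.Adj x y → Q x y = 0) {v : V → ℝ} {θ : ℝ}
    (hv : discriminant Q *ᵥ v = Real.cos θ • v) (l : ℕ) (x : V) :
    (walkOperator G o A ^ l *ᵥ tensorBase o (fun x => (v x : ℂ))) (x, o) =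
      ((Real.cos (l * θ) * v x : ℝ) : ℂ) := by
  have hblock : (fun x => (walkSwap G A *ᵥ tensorBase o (fun x => (v x : ℂ))) (x, o)) =
      (Real.cos θ : ℂ) • fun x => (v x : ℂ) := by
    ext x
    rw [walkSwap_block hA hQ hsupp]
    have := congrFun hv x
    simp only [Matrix.mulVec, dotProduct, Pi.smul_apply, smul_eq_mul] at this ⊢
    exact_mod_cast this
  -- The three-term Chebyshev recursion, on whole vectors and not only on the block at `|o⟩`.
  have hrec : ∀ l : ℕ, walkOperator G o A ^ (l + 2) *ᵥ tensorBase o (fun x => (v x : ℂ)) =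
      (2 * Real.cos θ : ℂ) • (walkOperator G o A ^ (l + 1) *ᵥ tensorBase o (fun x => (v x : ℂ))) -
        walkOperator G o A ^ l *ᵥ tensorBase o (fun x => (v x : ℂ)) := by
    intro l
    rw [show l + 2 = l + 1 + 1 from rfl, pow_succ, pow_succ, ← Matrix.mulVec_mulVec,
      ← Matrix.mulVec_mulVec, walkOperator_sq_mulVec hA.unitary, hblock, tensorBase_smul,
      Matrix.mulVec_sub]
    simp only [Matrix.mulVec_smul, Matrix.mulVec_mulVec, smul_smul]
  induction l using Nat.strong_induction_on with
  | _ l ih =>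
    match l with
    | 0 => simp [tensorBase]
    | 1 =>
      rw [pow_one, walkOperator_mulVec, reflection_mulVec_tensorBase]
      have := congrFun hblock x
      simp only [Pi.smul_apply, smul_eq_mul] at this
      rw [this]
      push_cast
      simp
    | l + 2 =>
      rw [hrec, Pi.sub_apply, Pi.smul_apply, ih (l + 1) (by omega), ih l (by omega), smul_eq_mul]
      have e : Real.cos ((l + 2 : ℕ) * θ) = 2 * Real.cos θ * Real.cos ((l + 1 : ℕ) * θ) -
          Real.cos (l * θ) := by
        have h1 : ((l + 2 : ℕ) : ℝ) * θ = (l + 1 : ℕ) * θ + θ := by push_cast; ring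
        have h2 : (l : ℝ) * θ = (l + 1 : ℕ) * θ - θ := by push_cast; ring
        rw [h1, h2, Real.cos_add, Real.cos_sub]; ring
      rw [e]
      push_cast; ring

end WalkOperator

/-! ### Norms of states -/

section StateNorm

variable {ι : Type*} [Fintype ι]

/-- The `ℓ²` norm of a state. -/
noncomputable def stateNorm (ψ : ι → ℂ) : ℝ := ‖(WithLp.toLp 2 ψ : EuclideanSpace ℂ ι)‖

theorem stateNorm_sq (ψ : ι → ℂ) : stateNorm ψ ^ 2 = ∑ a, ‖ψ a‖ ^ 2 := by
  rw [stateNorm, EuclideanSpace.norm_sq_eq]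

theorem stateNorm_nonneg (ψ : ι → ℂ) : 0 ≤ stateNorm ψ := norm_nonneg _

theorem stateNorm_add_le (ψ φ : ι → ℂ) : stateNorm (ψ + φ) ≤ stateNorm ψ + stateNorm φ :=
  norm_add_le (WithLp.toLp 2 ψ : EuclideanSpace ℂ ι) (WithLp.toLp 2 φ)

theorem stateNorm_sub_le (ψ φ : ι → ℂ) : stateNorm (ψ - φ) ≤ stateNorm ψ + stateNorm φ :=
  norm_sub_le (WithLp.toLp 2 ψ : EuclideanSpace ℂ ι) (WithLp.toLp 2 φ)

theorem stateNorm_eq_of_sum_eq {ψ φ : ι → ℂ} (h : ∑ a, ‖ψ a‖ ^ 2 = ∑ a, ‖φ a‖ ^ 2) :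
    stateNorm ψ = stateNorm φ := by
  rw [← stateNorm_sq, ← stateNorm_sq] at h
  exact (pow_left_inj₀ (stateNorm_nonneg _) (stateNorm_nonneg _) two_ne_zero).1 h

theorem stateNorm_mono {ψ φ : ι → ℂ} (h : ∀ a, ‖ψ a‖ ≤ ‖φ a‖) : stateNorm ψ ≤ stateNorm φ := by
  refine (sq_le_sq₀ (stateNorm_nonneg _) (stateNorm_nonneg _)).1 ?_
  rw [stateNorm_sq, stateNorm_sq]
  exact Finset.sum_le_sum fun a _ => by gcongr; exact h a

end StateNorm

/-! ### The operations on the five registers -/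

section Operations

variable {V : Type*} [Fintype V] [DecidableEq V] {r τ : ℕ}

theorem basisMap_mulVec {ι : Type*} [Fintype ι] [DecidableEq ι] {m : ι → ι}
    (hm : Function.Involutive m) (ψ : ι → ℂ) : basisMap m *ᵥ ψ = fun a => ψ (m a) := by
  ext a
  simp only [Matrix.mulVec, dotProduct, basisMap, Matrix.of_apply]
  rw [Finset.sum_eq_single (m a)]
  · rw [hm, if_pos rfl, one_mul]
  · intro b _ hb
    rw [if_neg (fun h => hb (by rw [h, hm])), zero_mul]
  · simp

theorem stateNorm_comp_involutive {ι : Type*} [Fintype ι] {m : ι → ι}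
    (hm : Function.Involutive m) (ψ : ι → ℂ) : stateNorm (fun a => ψ (m a)) = stateNorm ψ :=
  stateNorm_eq_of_sum_eq (Equiv.sum_comp hm.toPerm fun a => ‖ψ a‖ ^ 2)

/-- The part of the state in `R₁R₂` for given contents of the other registers. -/
def slice (ψ : Reg V r τ → ℂ) (c : (Fin τ → Bool) × Bool × (Fin r → Bool)) : V × V → ℂ :=
  fun p => ψ (p.1, p.2, c)

/-- The action on `R₁R₂` of a matrix depending on the contents of `R₃`. -/
noncomputable def controlled (B : (Fin τ → Bool) → Matrix (V × V) (V × V) ℂ)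
    (ψ : Reg V r τ → ℂ) : Reg V r τ → ℂ :=
  fun a => (B a.2.2.1 *ᵥ slice ψ a.2.2) (a.1, a.2.1)

omit [DecidableEq V] in
theorem slice_controlled (B : (Fin τ → Bool) → Matrix (V × V) (V × V) ℂ)
    (ψ : Reg V r τ → ℂ) (c : (Fin τ → Bool) × Bool × (Fin r → Bool)) :
    slice (controlled B ψ) c = B c.1 *ᵥ slice ψ c := rfl

omit [DecidableEq V] in
theorem controlled_controlled (B C : (Fin τ → Bool) → Matrix (V × V) (V × V) ℂ)
    (ψ : Reg V r τ → ℂ) : controlled B (controlled C ψ) = controlled (fun l => B l * C l) ψ := by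
  ext a
  simp only [controlled, slice_controlled]
  rw [Matrix.mulVec_mulVec]

theorem controlled_one (ψ : Reg V r τ → ℂ) : controlled (fun _ => 1) ψ = ψ := by
  ext a
  simp [controlled, slice]

theorem ctrlMatrix_mulVec (B : Matrix (V × V) (V × V) ℂ) (j : Fin τ) (ψ : Reg V r τ → ℂ) :
    ctrlMatrix B j *ᵥ ψ = controlled (fun l => if l j then B else 1) ψ := by
  ext ⟨x, y, c⟩
  simp only [controlled, slice, Matrix.mulVec, dotProduct, ctrlMatrix, Matrix.of_apply]
  rw [Fintype.sum_prod_type, Fintype.sum_prod_type]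
  refine Finset.sum_congr rfl fun x' _ => ?_
  rw [Fintype.sum_prod_type]
  refine Finset.sum_congr rfl fun y' _ => ?_
  rw [Finset.sum_eq_single c]
  · simp only [if_true]
    split_ifs <;> rfl
  · intro d _ hd; simp [Ne.symm hd]
  · simp

/-- The action on `R₃` of a matrix. -/
noncomputable def onRegister (B : Matrix (Fin τ → Bool) (Fin τ → Bool) ℂ) (ψ : Reg V r τ → ℂ) :
    Reg V r τ → ℂ :=
  fun a => (B *ᵥ fun l => ψ (a.1, a.2.1, l, a.2.2.2)) a.2.2.1

theorem prepMatrix_mulVec (B : Matrix (Fin τ → Bool) (Fin τ → Bool) ℂ) (ψ : Reg V r τ → ℂ) :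
    prepMatrix B *ᵥ ψ = onRegister B ψ := by
  ext ⟨x, y, l, c⟩
  simp only [onRegister, Matrix.mulVec, dotProduct, prepMatrix, Matrix.of_apply]
  rw [Fintype.sum_prod_type, Finset.sum_eq_single x, Fintype.sum_prod_type,
    Finset.sum_eq_single y, Fintype.sum_prod_type]
  · refine Finset.sum_congr rfl fun l' _ => ?_
    rw [Finset.sum_eq_single c]
    · simp
    · intro d _ hd; simp [Ne.symm hd]
    · simp
  · intro y' _ hy'
    exact Finset.sum_eq_zero fun d _ => by simp [Ne.symm hy']
  · simp
  · intro x' _ hx'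
    exact Finset.sum_eq_zero fun d _ => by simp [Ne.symm hx']
  · simp

omit [Fintype V] [DecidableEq V] in
theorem onRegister_onRegister (B C : Matrix (Fin τ → Bool) (Fin τ → Bool) ℂ)
    (ψ : Reg V r τ → ℂ) : onRegister B (onRegister C ψ) = onRegister (B * C) ψ := by
  ext a
  simp only [onRegister, ← Matrix.mulVec_mulVec]

omit [Fintype V] [DecidableEq V] in
theorem onRegister_one (ψ : Reg V r τ → ℂ) : onRegister 1 ψ = ψ := by
  ext a
  simp [onRegister]

theorem stateNorm_controlled {B : (Fin τ → Bool) → Matrix (V × V) (V × V) ℂ}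
    (hB : ∀ l, B l ∈ Matrix.unitaryGroup (V × V) ℂ) (ψ : Reg V r τ → ℂ) :
    stateNorm (controlled B ψ) = stateNorm ψ := by
  refine stateNorm_eq_of_sum_eq ?_
  have e : ∀ F : Reg V r τ → ℝ, ∑ a, F a = ∑ c : (Fin τ → Bool) × Bool × (Fin r → Bool),
      ∑ p : V × V, F (p.1, p.2, c) := by
    intro F
    rw [Finset.sum_comm, Fintype.sum_prod_type, Fintype.sum_prod_type]
    exact Finset.sum_congr rfl fun x _ => Fintype.sum_prod_type _
  rw [e, e]
  exact Finset.sum_congr rfl fun c _ => sum_norm_sq_mulVec (hB c.1) (slice ψ c)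

omit [DecidableEq V] in
theorem stateNorm_onRegister {B : Matrix (Fin τ → Bool) (Fin τ → Bool) ℂ}
    (hB : B ∈ Matrix.unitaryGroup (Fin τ → Bool) ℂ) (ψ : Reg V r τ → ℂ) :
    stateNorm (onRegister B ψ) = stateNorm ψ := by
  refine stateNorm_eq_of_sum_eq ?_
  rw [Fintype.sum_prod_type, Fintype.sum_prod_type]
  refine Finset.sum_congr rfl fun x _ => ?_
  rw [Fintype.sum_prod_type, Fintype.sum_prod_type]
  refine Finset.sum_congr rfl fun y _ => ?_
  rw [Fintype.sum_prod_type, Fintype.sum_prod_type, Finset.sum_comm]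
  conv_rhs => rw [Finset.sum_comm]
  exact Finset.sum_congr rfl fun c _ => sum_norm_sq_mulVec hB fun l => ψ (x, y, l, c)

end Operations

/-! ### Circuits -/

section Circuits

variable {V : Type*} [Fintype V] [DecidableEq V] {P : Matrix V V ℝ} {g o : V} {r τ : ℕ}
  {s : Fin r → ℝ} {t : Fin r → ℕ} (G : SimpleGraph V) (R : Realization P g o s t τ)

theorem runCircuit_nil (ψ : Reg V r τ → ℂ) : runCircuit G R [] ψ = ψ := rfl

theorem runCircuit_cons (γ : Gate r τ) (c : List (Gate r τ)) (ψ : Reg V r τ → ℂ) :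
    runCircuit G R (γ :: c) ψ = runCircuit G R c (γ.matrix G R *ᵥ ψ) := rfl

theorem runCircuit_append (c d : List (Gate r τ)) (ψ : Reg V r τ → ℂ) :
    runCircuit G R (c ++ d) ψ = runCircuit G R d (runCircuit G R c ψ) :=
  List.foldl_append

theorem runCircuit_sub (c : List (Gate r τ)) (ψ φ : Reg V r τ → ℂ) :
    runCircuit G R c (ψ - φ) = runCircuit G R c ψ - runCircuit G R c φ := by
  induction c generalizing ψ φ with
  | nil => rfl
  | cons γ c ih => rw [runCircuit_cons, Matrix.mulVec_sub, ih]; rfl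

theorem runCircuit_add (c : List (Gate r τ)) (ψ φ : Reg V r τ → ℂ) :
    runCircuit G R c (ψ + φ) = runCircuit G R c ψ + runCircuit G R c φ := by
  induction c generalizing ψ φ with
  | nil => rfl
  | cons γ c ih => rw [runCircuit_cons, Matrix.mulVec_add, ih]; rfl

theorem walk_mem_unitaryGroup (i : Fin r) :
    walkOperator G o (R.walk i) ∈ Matrix.unitaryGroup (V × V) ℂ :=
  walkOperator_mem_unitaryGroup (R.isWalk i).unitary

omit [DecidableEq V] [Fintype V] in
theorem flip_involutive : Function.Involutive
    (fun (x, y, l, a, f) => (x, y, l, !a, f) : Reg V r τ → Reg V r τ) :=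
  fun _ => by simp

omit [Fintype V] in
theorem check_involutive (o : V) : Function.Involutive
    (fun (x, y, l, a, f) => (x, y, l, if y = o then !a else a, f) : Reg V r τ → Reg V r τ) := by
  rintro ⟨x, y, l, a, f⟩
  by_cases h : y = o <;> simp [h]

omit [Fintype V] in
theorem mark_involutive (o : V) (i : Fin r) : Function.Involutive
    (fun (x, y, l, a, f) => (x, y, l, a, if y = o ∧ (∀ j, l j = false) ∧ a = false
        then Function.update f i (!(f i)) else f) : Reg V r τ → Reg V r τ) := by
  rintro ⟨x, y, l, a, f⟩
  by_cases h : y = o ∧ (∀ j, l j = false) ∧ a = false <;> simp [h]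

theorem stateNorm_gate (γ : Gate r τ) (ψ : Reg V r τ → ℂ) :
    stateNorm (γ.matrix G R *ᵥ ψ) = stateNorm ψ := by
  cases γ with
  | ctrlWalk i j =>
    rw [Gate.matrix, ctrlMatrix_mulVec]
    refine stateNorm_controlled (fun l => ?_) _
    split_ifs
    · exact walk_mem_unitaryGroup G R i
    · exact one_mem _
  | ctrlWalkInv i j =>
    rw [Gate.matrix, ctrlMatrix_mulVec]
    refine stateNorm_controlled (fun l => ?_) _
    split_ifs
    · exact Unitary.star_mem (walk_mem_unitaryGroup G R i)
    · exact one_mem _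
  | prep i =>
    rw [Gate.matrix, prepMatrix_mulVec]
    exact stateNorm_onRegister (R.isPrep i).unitary _
  | prepInv i =>
    rw [Gate.matrix, prepMatrix_mulVec]
    exact stateNorm_onRegister (Unitary.star_mem (R.isPrep i).unitary) _
  | flip =>
    rw [Gate.matrix, basisMap_mulVec flip_involutive]
    exact stateNorm_comp_involutive flip_involutive _
  | check =>
    rw [Gate.matrix, basisMap_mulVec (check_involutive o)]
    exact stateNorm_comp_involutive (check_involutive o) _
  | mark i =>
    rw [Gate.matrix, basisMap_mulVec (mark_involutive o i)]
    exact stateNorm_comp_involutive (mark_involutive o i) _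

theorem stateNorm_runCircuit (c : List (Gate r τ)) (ψ : Reg V r τ → ℂ) :
    stateNorm (runCircuit G R c ψ) = stateNorm ψ := by
  induction c generalizing ψ with
  | nil => rfl
  | cons γ c ih => rw [runCircuit_cons, ih, stateNorm_gate]

theorem runCircuit_replicate_ctrl {γ : Gate r τ} {B : Matrix (V × V) (V × V) ℂ} {j : Fin τ}
    (hγ : γ.matrix G R = ctrlMatrix B j) (n : ℕ) (ψ : Reg V r τ → ℂ) :
    runCircuit G R (List.replicate n γ) ψ = controlled (fun l => B ^ (if l j then n else 0)) ψ := by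
  induction n generalizing ψ with
  | zero => simpa [runCircuit_nil] using (controlled_one ψ).symm
  | succ n ih =>
    rw [List.replicate_succ, runCircuit_cons, ih, hγ, ctrlMatrix_mulVec, controlled_controlled]
    congr 1
    ext1 l
    split_ifs <;> simp [pow_succ]

/-- All factors are powers of a single matrix, so the exponents add up to the number stored in the
register, in whichever order the qubits are visited. -/
theorem runCircuit_flatMap_ctrl {γ : Fin τ → Gate r τ} {B : Matrix (V × V) (V × V) ℂ}
    (hγ : ∀ j, (γ j).matrix G R = ctrlMatrix B j) (js : List (Fin τ)) (ψ : Reg V r τ → ℂ) :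
    runCircuit G R (js.flatMap fun j : Fin τ => List.replicate (2 ^ (j : ℕ)) (γ j)) ψ =
      controlled (fun l => B ^ (js.map fun j : Fin τ => if l j then 2 ^ (j : ℕ) else 0).sum) ψ := by
  induction js generalizing ψ with
  | nil => simpa [runCircuit_nil] using (controlled_one ψ).symm
  | cons j js ih =>
    rw [List.flatMap_cons, runCircuit_append, ih, runCircuit_replicate_ctrl G R (hγ j),
      controlled_controlled]
    congr 1
    ext1 l
    rw [← pow_add, List.map_cons, List.sum_cons, add_comm]

theorem sum_map_finRange (l : Fin τ → Bool) :
    ((List.finRange τ).map fun j : Fin τ => if l j then 2 ^ (j : ℕ) else 0).sum = registerValue l := by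
  rw [registerValue, Fin.sum_univ_def]

theorem runCircuit_ctrlCircuit (i : Fin r) (ψ : Reg V r τ → ℂ) :
    runCircuit G R (ctrlCircuit r τ i) ψ =
      controlled (fun l => walkOperator G o (R.walk i) ^ registerValue l) ψ := by
  rw [ctrlCircuit, runCircuit_flatMap_ctrl G R (γ := fun j => .ctrlWalk i j) (fun j => rfl)]
  simp only [sum_map_finRange]

theorem runCircuit_ctrlInvCircuit (i : Fin r) (ψ : Reg V r τ → ℂ) :
    runCircuit G R (ctrlInvCircuit r τ i) ψ =
      controlled (fun l => (walkOperator G o (R.walk i)).conjTranspose ^ registerValue l) ψ := by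
  rw [ctrlInvCircuit, runCircuit_flatMap_ctrl G R (γ := fun j => .ctrlWalkInv i j) (fun j => rfl)]
  simp only [List.map_reverse, List.sum_reverse, sum_map_finRange]

theorem runCircuit_qffCircuit (i : Fin r) (ψ : Reg V r τ → ℂ) :
    runCircuit G R (qffCircuit r τ i) ψ = onRegister (R.prep i).conjTranspose
      (controlled (fun l => walkOperator G o (R.walk i) ^ registerValue l)
        (onRegister (R.prep i) ψ)) := by
  rw [qffCircuit, runCircuit_append, runCircuit_append, runCircuit_ctrlCircuit, runCircuit_cons,
    runCircuit_cons, runCircuit_nil, runCircuit_nil, Gate.matrix, Gate.matrix, prepMatrix_mulVec,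
    prepMatrix_mulVec]

theorem runCircuit_qffInvCircuit (i : Fin r) (ψ : Reg V r τ → ℂ) :
    runCircuit G R (qffInvCircuit r τ i) ψ = onRegister (R.prep i).conjTranspose
      (controlled (fun l => (walkOperator G o (R.walk i)).conjTranspose ^ registerValue l)
        (onRegister (R.prep i) ψ)) := by
  rw [qffInvCircuit, runCircuit_append, runCircuit_append, runCircuit_ctrlInvCircuit,
    runCircuit_cons, runCircuit_cons, runCircuit_nil, runCircuit_nil, Gate.matrix, Gate.matrix,
    prepMatrix_mulVec, prepMatrix_mulVec]

theorem prep_mul_conjTranspose (i : Fin r) : R.prep i * (R.prep i).conjTranspose = 1 :=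
  Matrix.mem_unitaryGroup_iff.1 (R.isPrep i).unitary

theorem prep_conjTranspose_mul (i : Fin r) : (R.prep i).conjTranspose * R.prep i = 1 :=
  Matrix.mem_unitaryGroup_iff'.1 (R.isPrep i).unitary

theorem runCircuit_qffInv_qff (i : Fin r) (ψ : Reg V r τ → ℂ) :
    runCircuit G R (qffInvCircuit r τ i) (runCircuit G R (qffCircuit r τ i) ψ) = ψ := by
  rw [runCircuit_qffCircuit, runCircuit_qffInvCircuit, onRegister_onRegister (R.prep i),
    prep_mul_conjTranspose, onRegister_one, controlled_controlled]
  have h : (fun l : Fin τ → Bool => (walkOperator G o (R.walk i)).conjTranspose ^ registerValue l *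
      walkOperator G o (R.walk i) ^ registerValue l) = fun _ => 1 := by
    ext1 l
    rw [← Matrix.conjTranspose_pow]
    exact Matrix.mem_unitaryGroup_iff'.1 (pow_mem (walk_mem_unitaryGroup G R i) _)
  rw [h, controlled_one, onRegister_onRegister, prep_conjTranspose_mul, onRegister_one]

end Circuits

/-! ### States with clean work registers. -/

section Embed

variable {V : Type*} [DecidableEq V] {r τ : ℕ}

/-- The state in which `R₂, R₃, R₄` are `|o⟩, |0^τ⟩, |0⟩`, and `R₁, R₅` are as prescribed. -/
def embed (o : V) (τ : ℕ) (Φ : V → (Fin r → Bool) → ℂ) : Reg V r τ → ℂ :=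
  fun (x, y, l, a, f) => if y = o ∧ (∀ j, l j = false) ∧ a = false then Φ x f else 0

theorem embed_add (o : V) (Φ Ψ : V → (Fin r → Bool) → ℂ) :
    embed o τ (Φ + Ψ) = embed o τ Φ + embed o τ Ψ := by
  ext ⟨x, y, l, a, f⟩
  simp only [embed, Pi.add_apply]
  split_ifs <;> simp

/-- Flipping a qubit of `R₅`. -/
def flipBit (i : Fin r) (f : Fin r → Bool) : Fin r → Bool := Function.update f i (!(f i))

theorem flipBit_involutive (i : Fin r) : Function.Involutive (flipBit i) := by
  intro f
  simp [flipBit]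

variable [Fintype V]

theorem stateNorm_embed_sq (o : V) (Φ : V → (Fin r → Bool) → ℂ) :
    stateNorm (embed o τ Φ) ^ 2 = ∑ x, ∑ f, ‖Φ x f‖ ^ 2 := by
  rw [stateNorm_sq]
  simp only [Fintype.sum_prod_type]
  refine Finset.sum_congr rfl fun x _ => ?_
  rw [Finset.sum_eq_single o, Finset.sum_eq_single (fun _ => false), Finset.sum_eq_single false]
  · simp [embed]
  · intro a _ ha; simp [embed, ha]
  · simp
  · intro l _ hl
    have : ¬ ∀ j, l j = false := fun h => hl (funext h)
    simp [embed, this]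
  · simp
  · intro y _ hy; simp [embed, hy]
  · simp

end Embed

/-! ### One round of the circuit. -/

section Round

variable {V : Type*} [Fintype V] [DecidableEq V] {P : Matrix V V ℝ} {g o : V} {r τ : ℕ}
  {s : Fin r → ℝ} {t : Fin r → ℕ} (G : SimpleGraph V) (R : Realization P g o s t τ)

/-- When `R₂` is `|o⟩` the check and the flip cancel on `R₄`. -/
theorem runCircuit_check_flip_embed (Φ : V → (Fin r → Bool) → ℂ) :
    runCircuit G R [.check, .flip] (embed o τ Φ) = embed o τ Φ := by
  rw [runCircuit_cons, runCircuit_cons, runCircuit_nil, Gate.matrix, Gate.matrix,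
    basisMap_mulVec (check_involutive o), basisMap_mulVec flip_involutive]
  ext ⟨x, y, l, a, f⟩
  by_cases hy : y = o <;> simp [embed, hy]

theorem runCircuit_flip_check_embed (Φ : V → (Fin r → Bool) → ℂ) :
    runCircuit G R [.flip, .check] (embed o τ Φ) = embed o τ Φ := by
  rw [runCircuit_cons, runCircuit_cons, runCircuit_nil, Gate.matrix, Gate.matrix,
    basisMap_mulVec (check_involutive o), basisMap_mulVec flip_involutive]
  ext ⟨x, y, l, a, f⟩
  by_cases hy : y = o <;> simp [embed, hy]

/-- Writing the flag flip as the identity plus a correction supported on the clean block makes its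
effect small whenever that block of `χ` is small. -/
theorem runCircuit_mark (i : Fin r) (χ : Reg V r τ → ℂ) :
    runCircuit G R [.mark i] χ = χ +
      (embed o τ (fun x f => χ (x, o, (fun _ => false), false, flipBit i f)) -
        embed o τ (fun x f => χ (x, o, (fun _ => false), false, f))) := by
  rw [runCircuit_cons, runCircuit_nil, Gate.matrix, basisMap_mulVec (mark_involutive o i)]
  ext ⟨x, y, l, a, f⟩
  simp only [Pi.add_apply, Pi.sub_apply, embed]
  split_ifs with h
  · obtain ⟨rfl, hl, rfl⟩ := h
    have hl : l = fun _ => false := funext hl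
    subst hl
    simp [flipBit]
  · simp

omit [Fintype V] in
theorem slice_onRegister_embed (B : Matrix (Fin τ → Bool) (Fin τ → Bool) ℂ)
    (Φ : V → (Fin r → Bool) → ℂ) (l : Fin τ → Bool) (a : Bool) (f : Fin r → Bool) :
    slice (onRegister B (embed o τ Φ)) (l, a, f) =
      (if a = false then B l (fun _ => false) else 0) • tensorBase o (fun x => Φ x f) := by
  ext ⟨x, y⟩
  simp only [slice, onRegister, Matrix.mulVec, dotProduct, embed, tensorBase, Pi.smul_apply,
    smul_eq_mul]
  rw [Finset.sum_eq_single (fun _ => false)]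
  · by_cases ha : a = false <;> by_cases hy : y = o <;> simp [ha, hy]
  · intro l' _ hl'
    have : ¬ ∀ j, l' j = false := fun h => hl' (funext h)
    simp [this]
  · simp

omit [DecidableEq V] in
theorem controlled_eq_self {B : (Fin τ → Bool) → Matrix (V × V) (V × V) ℂ} {ψ : Reg V r τ → ℂ}
    (h : ∀ c, B c.1 *ᵥ slice ψ c = slice ψ c) : controlled B ψ = ψ := by
  ext ⟨x, y, c⟩
  exact congrFun (h c) (x, y)

/-- States fixed by the walk are fixed by the fast-forwarded walk. -/
theorem runCircuit_qff_embed_of_fixed (i : Fin r) {Φ : V → (Fin r → Bool) → ℂ}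
    (h : ∀ f, walkOperator G o (R.walk i) *ᵥ tensorBase o (fun x => Φ x f) =
      tensorBase o (fun x => Φ x f)) :
    runCircuit G R (qffCircuit r τ i) (embed o τ Φ) = embed o τ Φ := by
  have hpow : ∀ (n : ℕ) f, walkOperator G o (R.walk i) ^ n *ᵥ tensorBase o (fun x => Φ x f) =
      tensorBase o (fun x => Φ x f) := by
    intro n f
    induction n with
    | zero => simp
    | succ n ih => rw [pow_succ, ← Matrix.mulVec_mulVec, h, ih]
  -- Every power of the walk fixes the state, so the controlled walk acts trivially and the two
  -- preparations cancel.
  rw [runCircuit_qffCircuit, controlled_eq_self, onRegister_onRegister, prep_conjTranspose_mul,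
    onRegister_one]
  rintro ⟨l, a, f⟩
  rw [slice_onRegister_embed, Matrix.mulVec_smul, hpow]

/-- The block of the fast-forwarded walk at `|o⟩|0^τ⟩`. -/
theorem runCircuit_qff_embed_apply (i : Fin r) (ht : walkTail (t i) (2 ^ τ) ≤ 1)
    (Φ : V → (Fin r → Bool) → ℂ) (x : V) (f : Fin r → Bool) :
    runCircuit G R (qffCircuit r τ i) (embed o τ Φ) (x, o, (fun _ => false), false, f) =
      ∑ n ∈ Finset.range (2 ^ τ),
        ((walkDistanceProb (t i) n / (1 - walkTail (t i) (2 ^ τ)) : ℝ) : ℂ) *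
          (walkOperator G o (R.walk i) ^ n *ᵥ tensorBase o (fun x => Φ x f)) (x, o) := by
  rw [runCircuit_qffCircuit, ← sum_registerValue]
  simp only [onRegister, Matrix.mulVec, dotProduct, Matrix.conjTranspose_apply]
  refine Finset.sum_congr rfl fun l _ => ?_
  have e := congrFun (slice_controlled (fun l => walkOperator G o (R.walk i) ^ registerValue l)
    (onRegister (R.prep i) (embed o τ Φ)) (l, false, f)) (x, o)
  rw [slice_onRegister_embed, if_pos rfl, Matrix.mulVec_smul] at e
  have e2 : controlled (fun l => walkOperator G o (R.walk i) ^ registerValue l)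
      (onRegister (R.prep i) (embed o τ Φ)) (x, o, l, false, f) =
      R.prep i l (fun _ => false) * (walkOperator G o (R.walk i) ^ registerValue l *ᵥ
        tensorBase o (fun x => Φ x f)) (x, o) := e
  refine (congrArg _ e2).trans ?_
  rw [← mul_assoc, (R.isPrep i).apply, RCLike.star_def, Complex.conj_ofReal, ← Complex.ofReal_mul,
    Real.mul_self_sqrt]
  · rfl
  · exact div_nonneg (walkDistanceProb_nonneg _ _) (sub_nonneg.2 ht)

/-- One round of the algorithm: the component fixed by the walk has qubit `i` of `R₅` flipped, and
the component that is almost annihilated by the fast-forwarded walk is almost unchanged. -/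
theorem stateNorm_round_sub_le (i : Fin r) {Φ Ψ X : V → (Fin r → Bool) → ℂ}
    (hΦ : runCircuit G R (qffCircuit r τ i) (embed o τ Φ) = embed o τ Φ)
    (hΨ : ∀ x f, runCircuit G R (qffCircuit r τ i) (embed o τ Ψ)
      (x, o, (fun _ => false), false, f) = X x f) :
    stateNorm (runCircuit G R (qfsCircuit r τ i) (embed o τ (Φ + Ψ)) -
      embed o τ (fun x f => Φ x (flipBit i f) + Ψ x f)) ≤ 2 * stateNorm (embed o τ X) := by
  -- The only damage the flag flip does to the `Ψ` part. Each of its two terms has the norm of `X`,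
  -- whence the factor `2`.
  set η := embed o τ (fun x f => X x (flipBit i f)) - embed o τ X with hη
  have hmark : runCircuit G R [.mark i] (runCircuit G R (qffCircuit r τ i) (embed o τ (Φ + Ψ))) =
      embed o τ (fun x f => Φ x (flipBit i f)) +
        (runCircuit G R (qffCircuit r τ i) (embed o τ Ψ) + η) := by
    rw [embed_add, runCircuit_add, runCircuit_add, hΦ, runCircuit_mark, runCircuit_mark]
    congr 1
    · have e : ∀ x f, embed o τ Φ (x, o, (fun _ => false), false, f) = Φ x f := by
        intro x f; simp [embed]
      simp only [e]
      abel
    · simp only [hΨ, hη]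
  have hΦ' : runCircuit G R (qffInvCircuit r τ i) (embed o τ (fun x f => Φ x (flipBit i f))) =
      embed o τ (fun x f => Φ x (flipBit i f)) := by
    have hfix : runCircuit G R (qffCircuit r τ i) (embed o τ (fun x f => Φ x (flipBit i f))) =
        embed o τ (fun x f => Φ x (flipBit i f)) := by
      -- Fast-forwarding does not touch `R₅`, so it commutes with flipping a flag.
      have e : ∀ χ : Reg V r τ → ℂ, runCircuit G R (qffCircuit r τ i)
          (fun a => χ (a.1, a.2.1, a.2.2.1, a.2.2.2.1, flipBit i a.2.2.2.2)) =
          fun a => runCircuit G R (qffCircuit r τ i) χ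
            (a.1, a.2.1, a.2.2.1, a.2.2.2.1, flipBit i a.2.2.2.2) := by
        intro χ
        rw [runCircuit_qffCircuit, runCircuit_qffCircuit]
        rfl
      have e2 : embed o τ (fun x f => Φ x (flipBit i f)) = fun a => embed o τ Φ
          (a.1, a.2.1, a.2.2.1, a.2.2.2.1, flipBit i a.2.2.2.2) := rfl
      rw [e2, e, hΦ]
    conv_lhs => rw [← hfix]
    exact runCircuit_qffInv_qff G R i _
  have hround : runCircuit G R (qfsCircuit r τ i) (embed o τ (Φ + Ψ)) -
      embed o τ (fun x f => Φ x (flipBit i f) + Ψ x f) =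
      runCircuit G R [.flip, .check] (runCircuit G R (qffInvCircuit r τ i) η) := by
    rw [qfsCircuit, runCircuit_append, runCircuit_append, runCircuit_append, runCircuit_append,
      runCircuit_check_flip_embed, hmark, runCircuit_add, runCircuit_add _ _ (qffInvCircuit r τ i), hΦ',
      runCircuit_qffInv_qff, ← add_assoc, ← embed_add, runCircuit_add]
    rw [runCircuit_flip_check_embed]
    exact add_sub_cancel_left _ _
  rw [hround, stateNorm_runCircuit, stateNorm_runCircuit]
  refine (stateNorm_sub_le _ _).trans (le_of_eq ?_)
  have e : stateNorm (embed o τ fun x f => X x (flipBit i f)) = stateNorm (embed o τ X) := by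
    refine (pow_left_inj₀ (stateNorm_nonneg _) (stateNorm_nonneg _) two_ne_zero).1 ?_
    rw [stateNorm_embed_sq, stateNorm_embed_sq]
    exact Finset.sum_congr rfl fun x _ =>
      Equiv.sum_comp (flipBit_involutive i).toPerm fun f => ‖X x f‖ ^ 2
  rw [e]; ring

end Round

/-! ### Fast-forwarding in an eigenbasis of the discriminant. -/

section Eigenbasis

variable {V : Type*} [Fintype V] [DecidableEq V]

theorem sum_eigenvectorBasis_mul {A : Matrix V V ℝ} (hA : A.IsHermitian) (j k : V) :
    ∑ x, hA.eigenvectorBasis k x * hA.eigenvectorBasis j x = if k = j then 1 else 0 := by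
  have h := orthonormal_iff_ite.1 hA.eigenvectorBasis.orthonormal k j
  rw [← h]
  simp only [PiLp.inner_apply, RCLike.inner_apply, conj_trivial]
  simp only [mul_comm]

theorem sum_sq_sum_eigenvectorBasis {A : Matrix V V ℝ} (hA : A.IsHermitian) (w : V → ℝ) :
    ∑ x, (∑ k, w k * hA.eigenvectorBasis k x) ^ 2 = ∑ k, w k ^ 2 := by
  have e : ∀ k, ∑ x, hA.eigenvectorBasis k x * ∑ j, w j * hA.eigenvectorBasis j x = w k := by
    intro k
    simp only [Finset.mul_sum]
    rw [Finset.sum_comm]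
    have : ∀ j, ∑ x, hA.eigenvectorBasis k x * (w j * hA.eigenvectorBasis j x) =
        w j * if k = j then 1 else 0 := by
      intro j
      rw [← sum_eigenvectorBasis_mul hA, Finset.mul_sum]
      exact Finset.sum_congr rfl fun x _ => by ring
    simp only [this]
    simp
  simp only [sq]
  rw [hA.eigenvectorBasis.sum_mul_eq]
  simp only [e]

variable {G : SimpleGraph V} {P : Matrix V V ℝ} {π : V → ℝ} {s : ℝ}

namespace IsErgodicReversible

theorem interpolated_eq_zero (h : IsErgodicReversible G P π) (g : V) (x y : V) (hxy : x ≠ y)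
    (hG : ¬ G.Adj x y) : interpolated P g s x y = 0 := by
  have h0 : P x y = 0 := le_antisymm (not_lt.1 fun hp => hG (h.support x y hxy hp)) (h.nonneg x y)
  rw [interpolated_apply, h0]
  simp [Ne.symm hxy]

variable [Nontrivial V]

theorem eigenvalueGap_interpolated_pos (h : IsErgodicReversible G P π) (g : V) (hs0 : 0 ≤ s)
    (hs1 : s < 1) : 0 < eigenvalueGap (interpolated P g s) := by
  have := h.one_le_maxHittingTime
  exact lt_of_lt_of_le (by positivity) (h.eigenvalueGap_interpolated_ge g hs0 hs1)

/-- The fast-forwarded walk almost annihilates the vectors orthogonal to the stationary state. -/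
theorem exists_fastForward_eq (h : IsErgodicReversible G P π) {g o : V} (hs0 : 0 ≤ s) (hs1 : s < 1)
    {A : Matrix (V × V) (V × V) ℂ} (hA : IsWalkIsometry (interpolated P g s) o A) {t N : ℕ} {δ : ℝ}
    (ht : walkTail t N < 1)
    (hδ : ∀ x : ℝ, 0 ≤ x → x ≤ 1 - eigenvalueGap (interpolated P g s) →
      x ^ t + walkTail t N ≤ δ * (1 - walkTail t N))
    {v : V → ℝ} (hv : ∑ x, √(interpDist π g s x) * v x = 0) :
    ∃ u : V → ℝ, ∑ x, u x ^ 2 ≤ δ ^ 2 * ∑ x, v x ^ 2 ∧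
      ∀ x, ∑ n ∈ Finset.range N, ((walkDistanceProb t n / (1 - walkTail t N) : ℝ) : ℂ) *
        (walkOperator G o A ^ n *ᵥ tensorBase o (fun x => (v x : ℂ))) (x, o) = (u x : ℂ) := by
  set hD := discriminant_isHermitian (interpolated P g s)
  have hb0 : ∀ k, (hD.eigenvectorBasis k : V → ℝ) ≠ 0 := by
    intro k h0
    have := eigenvector_sq_sum hD k
    simp [h0] at this
  have hb := fun k => hD.mulVec_eigenvectorBasis k
  have hnn : ∀ k, 0 ≤ hD.eigenvalues k := fun k =>
    h.discriminant_eigenvalue_nonneg g hs0 hs1 (hb0 k) (hb k)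
  have hgap : ∀ k, hD.eigenvalues k ≠ 1 →
      hD.eigenvalues k ≤ 1 - eigenvalueGap (interpolated P g s) := fun k hk =>
    h.le_one_sub_eigenvalueGap g hs0 hs1 (hb0 k) (hb k) hk
  have hle : ∀ k, hD.eigenvalues k ≤ 1 := by
    intro k
    by_cases hk : hD.eigenvalues k = 1
    · exact hk.le
    · linarith [hgap k hk, h.eigenvalueGap_interpolated_pos g hs0 hs1]
  have hcos : ∀ k, Real.cos (Real.arccos (hD.eigenvalues k)) = hD.eigenvalues k := fun k =>
    Real.cos_arccos (by linarith [hnn k]) (hle k)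
  have htail := sub_pos.2 ht
  -- The scalar by which the block of the fast-forwarded walk multiplies the `k`-th eigenvector.
  set a : V → ℝ := fun k => ∑ n ∈ Finset.range N, walkDistanceProb t n / (1 - walkTail t N) *
    Real.cos (n * Real.arccos (hD.eigenvalues k)) with ha
  have hca : ∀ k, (eigenCoeff hD k v * a k) ^ 2 ≤ δ ^ 2 * eigenCoeff hD k v ^ 2 := by
    intro k
    -- Such an eigenvector is a multiple of the stationary state, to which `v` is orthogonal. For
    -- every other eigenvalue the gap bounds the multiplier by `δ`.
    by_cases hk : hD.eigenvalues k = 1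
    · obtain ⟨c, hc⟩ := h.eq_smul_of_discriminant_eigenvalue_one g hs0 hs1
        (v := (hD.eigenvectorBasis k : V → ℝ)) (by rw [hb k, hk, one_smul])
      have : eigenCoeff hD k v = 0 := by
        unfold eigenCoeff
        simp only [hc, mul_assoc]
        rw [← Finset.mul_sum, hv, mul_zero]
      rw [this]; simp
    · have h1 : |a k| ≤ δ := by
        have h2 := abs_sum_walkDistanceProb_cos_le t N (θ := Real.arccos (hD.eigenvalues k))
          (by rw [hcos]; exact hnn k)
        rw [hcos] at h2
        have h3 := h2.trans (hδ _ (hnn k) (hgap k hk))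
        have e : a k = (∑ n ∈ Finset.range N, walkDistanceProb t n *
            Real.cos (n * Real.arccos (hD.eigenvalues k))) / (1 - walkTail t N) := by
          rw [ha, Finset.sum_div]
          exact Finset.sum_congr rfl fun n _ => by ring
        rw [e, abs_div, abs_of_pos htail, div_le_iff₀ htail]
        exact h3
      rw [mul_pow, mul_comm]
      have : a k ^ 2 ≤ δ ^ 2 := sq_le_sq' (neg_le_of_abs_le h1) (le_of_abs_le h1)
      exact mul_le_mul_of_nonneg_right this (sq_nonneg _)
  refine ⟨fun x => ∑ k, eigenCoeff hD k v * a k * hD.eigenvectorBasis k x, ?_, fun x => ?_⟩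
  · rw [sum_sq_sum_eigenvectorBasis]
    refine (Finset.sum_le_sum fun k _ => hca k).trans (le_of_eq ?_)
    rw [← Finset.mul_sum]
    congr 1
    simp only [sq]
    exact (hD.eigenvectorBasis.sum_mul_eq v v).symm
  · have e1 : tensorBase o (fun x => (v x : ℂ)) = ∑ k, (eigenCoeff hD k v : ℂ) •
        tensorBase o (fun x => (hD.eigenvectorBasis k x : ℂ)) := by
      ext ⟨z, y⟩
      simp only [tensorBase, Finset.sum_apply, Pi.smul_apply, smul_eq_mul]
      split_ifs
      · rw [hD.eigenvectorBasis.eq_sum_coeff v z]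
        simp only [eigenCoeff]
        push_cast
        rfl
      · simp
    have e2 : ∀ n : ℕ, (walkOperator G o A ^ n *ᵥ tensorBase o (fun x => (v x : ℂ))) (x, o) =
        ∑ k, ((eigenCoeff hD k v * (Real.cos (n * Real.arccos (hD.eigenvalues k)) *
          hD.eigenvectorBasis k x) : ℝ) : ℂ) := by
      intro n
      rw [e1, Matrix.mulVec_sum, Finset.sum_apply]
      refine Finset.sum_congr rfl fun k _ => ?_
      rw [Matrix.mulVec_smul, Pi.smul_apply, walkOperator_pow_block hA
        (h.interpolated_nonneg g hs0 hs1.le) (h.interpolated_eq_zero g)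
        (by rw [hcos]; exact hb k), smul_eq_mul, ← Complex.ofReal_mul]
    simp only [e2, ← Complex.ofReal_sum, ← Complex.ofReal_mul]
    congr 1
    simp only [Finset.mul_sum, Finset.sum_mul, ha]
    rw [Finset.sum_comm]
    exact Finset.sum_congr rfl fun k _ => Finset.sum_congr rfl fun n _ => by ring

end IsErgodicReversible

end Eigenbasis

/-! ### The plane spanned by `|π̄⟩` and `|g⟩` -/

section Plane

variable {V : Type*} [DecidableEq V]

/-- The unit vector at angle `θ` from `|π̄⟩` towards `|g⟩`. -/
noncomputable def planeVec (π : V → ℝ) (g : V) (θ : ℝ) (x : V) : ℝ :=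
  Real.cos θ * unmarkedAmplitude π {g} x + if x = g then Real.sin θ else 0

/-- The unit vector orthogonal to `planeVec`. -/
noncomputable def planePerp (π : V → ℝ) (g : V) (θ : ℝ) (x : V) : ℝ :=
  -(Real.sin θ * unmarkedAmplitude π {g} x) + if x = g then Real.cos θ else 0

/-- Change of orthonormal frame: the coefficients at angle `θ` are rewritten in the frame of the
next measurement. -/
theorem planeVec_rotate (π : V → ℝ) (g : V) (θ δ c d : ℝ) (x : V) :
    c * planeVec π g θ x + d * planePerp π g θ x =
      (c * Real.cos δ + d * Real.sin δ) * planeVec π g (θ + δ) x +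
        (d * Real.cos δ - c * Real.sin δ) * planePerp π g (θ + δ) x := by
  have h := Real.sin_sq_add_cos_sq δ
  unfold planeVec planePerp
  rw [Real.cos_add, Real.sin_add]
  split_ifs
  · linear_combination (-(c * (Real.cos θ * unmarkedAmplitude π {g} x + Real.sin θ) +
      d * (-(Real.sin θ * unmarkedAmplitude π {g} x) + Real.cos θ))) * h
  · linear_combination (-(c * (Real.cos θ * unmarkedAmplitude π {g} x) +
      d * (-(Real.sin θ * unmarkedAmplitude π {g} x)))) * h

theorem unmarkedAmplitude_self (π : V → ℝ) (g : V) : unmarkedAmplitude π {g} g = 0 := by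
  simp [unmarkedAmplitude]

variable [Fintype V] [Nontrivial V] {G : SimpleGraph V} {P : Matrix V V ℝ} {π : V → ℝ}

namespace IsErgodicReversible

variable (h : IsErgodicReversible G P π) (g : V)

include h

theorem sum_planePerp_sq (θ : ℝ) : ∑ x, planePerp π g θ x ^ 2 = 1 := by
  have e : ∀ x, planePerp π g θ x ^ 2 = Real.sin θ ^ 2 *
      (unmarkedAmplitude π {g} x * unmarkedAmplitude π {g} x) +
      if x = g then Real.cos θ ^ 2 else 0 := by
    intro x
    unfold planePerp
    split_ifs with hx
    · rw [hx, unmarkedAmplitude_self]; ring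
    · ring
  simp only [e, Finset.sum_add_distrib]
  rw [← Finset.mul_sum, h.sum_unmarkedAmplitude_sq]
  simp [Real.sin_sq_add_cos_sq]

theorem sum_planeVec_mul_planePerp (θ : ℝ) : ∑ x, planeVec π g θ x * planePerp π g θ x = 0 := by
  have e : ∀ x, planeVec π g θ x * planePerp π g θ x = -(Real.sin θ * Real.cos θ) *
      (unmarkedAmplitude π {g} x * unmarkedAmplitude π {g} x) +
      if x = g then Real.sin θ * Real.cos θ else 0 := by
    intro x
    unfold planeVec planePerp
    split_ifs with hx
    · rw [hx, unmarkedAmplitude_self]; ring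
    · ring
  simp only [e, Finset.sum_add_distrib]
  rw [← Finset.mul_sum, h.sum_unmarkedAmplitude_sq]
  simp

/-- For `s = (1 - π_g / sin² θ) / (1 - π_g)` the stationary state of the interpolated chain is at
angle `θ`. -/
theorem sqrt_interpDist_eq_planeVec {θ : ℝ} (hsin : 0 < Real.sin θ) (hcos : 0 < Real.cos θ)
    (x : V) :
    √(interpDist π g ((1 - π g / Real.sin θ ^ 2) / (1 - π g)) x) = planeVec π g θ x := by
  have hg := h.dist_pos g
  have hg1 : 0 < 1 - π g := sub_pos.2 (h.dist_lt_one g)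
  have hsc := Real.sin_sq_add_cos_sq θ
  -- The choice of `s` makes the normalization of the stationary distribution equal to `π_g / sin²
  -- θ`, so that `g` receives mass `sin² θ`.
  have hden : 1 - (1 - π g / Real.sin θ ^ 2) / (1 - π g) * (1 - π g) = π g / Real.sin θ ^ 2 := by
    field_simp; ring
  have hnum : 1 - (1 - π g / Real.sin θ ^ 2) / (1 - π g) =
      π g * Real.cos θ ^ 2 / (Real.sin θ ^ 2 * (1 - π g)) := by
    field_simp
    linear_combination (-π g) * hsc
  unfold interpDist planeVec
  rw [hden]
  split_ifs with hx
  · rw [hx, unmarkedAmplitude_self, mul_zero, zero_add]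
    have : ((1 - (1 - π g / Real.sin θ ^ 2) / (1 - π g)) * π g +
        (1 - π g / Real.sin θ ^ 2) / (1 - π g) * π g) / (π g / Real.sin θ ^ 2) =
        Real.sin θ ^ 2 := by
      rw [← add_mul, sub_add_cancel, one_mul]; field_simp
    rw [this, Real.sqrt_sq hsin.le]
  · rw [hnum, add_zero, add_zero]
    simp only [unmarkedAmplitude, Finset.mem_singleton, hx, if_false, Finset.sum_singleton]
    have : π g * Real.cos θ ^ 2 / (Real.sin θ ^ 2 * (1 - π g)) * π x / (π g / Real.sin θ ^ 2) =
        Real.cos θ ^ 2 * (π x / (1 - π g)) := by field_simp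
    rw [this, Real.sqrt_mul (sq_nonneg _), Real.sqrt_sq hcos.le, Real.sqrt_div (h.dist_nonneg x)]

end IsErgodicReversible

end Plane

/-! ### The loop of the algorithm -/

section MarkedProb

variable {V : Type*} [Fintype V] [DecidableEq V] {r τ : ℕ}

theorem probMarked_nonneg (g : V) (ψ : Reg V r τ → ℂ) : 0 ≤ probMarked g ψ :=
  Finset.sum_nonneg fun _ _ => sq_nonneg _

theorem sqrt_probMarked_eq (g : V) (ψ : Reg V r τ → ℂ) :
    √(probMarked g ψ) = stateNorm fun a => if a.1 = g then ψ a else 0 := by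
  rw [Real.sqrt_eq_iff_mul_self_eq (probMarked_nonneg g ψ) (stateNorm_nonneg _), ← sq,
    stateNorm_sq, probMarked, Finset.sum_filter]
  refine Finset.sum_congr rfl fun a _ => ?_
  split_ifs <;> simp

/-- The root of the probability is the norm of a projected state, so it moves by no more than the
state. Errors are therefore tracked on amplitudes. -/
theorem sqrt_probMarked_le (g : V) (ψ φ : Reg V r τ → ℂ) :
    √(probMarked g ψ) ≤ √(probMarked g φ) + stateNorm (ψ - φ) := by
  rw [sqrt_probMarked_eq, sqrt_probMarked_eq]
  have e : (fun a : Reg V r τ => if a.1 = g then ψ a else 0) =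
      (fun a => if a.1 = g then φ a else 0) + fun a => if a.1 = g then (ψ - φ) a else 0 := by
    ext a
    simp only [Pi.add_apply, Pi.sub_apply]
    split_ifs <;> simp
  rw [e]
  refine (stateNorm_add_le _ _).trans (add_le_add le_rfl (stateNorm_mono fun a => ?_))
  split_ifs <;> simp

theorem abs_sqrt_probMarked_sub_le (g : V) (ψ φ : Reg V r τ → ℂ) :
    |√(probMarked g ψ) - √(probMarked g φ)| ≤ stateNorm (ψ - φ) := by
  have h1 := sqrt_probMarked_le g ψ φ
  have h2 := sqrt_probMarked_le g φ ψ
  have e : stateNorm (φ - ψ) = stateNorm (ψ - φ) :=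
    norm_sub_rev (WithLp.toLp 2 φ : EuclideanSpace ℂ _) (WithLp.toLp 2 ψ)
  rw [e] at h2
  rw [abs_le]
  constructor <;> linarith

theorem probMarked_embed (g o : V) (Φ : V → (Fin r → Bool) → ℂ) :
    probMarked g (embed o τ Φ) = ∑ f, ‖Φ g f‖ ^ 2 := by
  have e : probMarked g (embed o τ Φ) =
      stateNorm (embed o τ fun x f => if x = g then Φ x f else 0) ^ 2 := by
    rw [stateNorm_sq, probMarked, Finset.sum_filter]
    refine Finset.sum_congr rfl fun a _ => ?_
    obtain ⟨x, y, l, a, f⟩ := a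
    simp only [embed]
    by_cases hx : x = g <;> simp [hx]
  rw [e, stateNorm_embed_sq, Finset.sum_eq_single g]
  · simp
  · intro x _ hx; simp [hx]
  · simp

end MarkedProb

/-! ### The ideal evolution with coherent flags. -/

/-- The state `∑ (c f |v_θ⟩ + d f |v_θ^⊥⟩) |o⟩|0^τ⟩|0⟩|f⟩`. -/
noncomputable def planeState {V : Type*} [DecidableEq V] {r : ℕ} (π : V → ℝ) (g o : V) (τ : ℕ)
    (θ : ℝ) (c d : (Fin r → Bool) → ℝ) : Reg V r τ → ℂ :=
  embed o τ fun x f => ((c f * planeVec π g θ x + d f * planePerp π g θ x : ℝ) : ℂ)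

/-- The coefficients of the state after `k` perfect rounds. -/
structure IsIdealCoeff {r : ℕ} (k : ℕ) (δ : ℝ) (c d : (Fin r → Bool) → ℝ) : Prop where
  unused : ∀ f (j : Fin r), k ≤ j → f j = true → c f = 0 ∧ d f = 0
  cross : ∑ f, c f * d f = 0
  norm : ∑ f, (c f ^ 2 + d f ^ 2) = 1
  diff : ∑ f, (c f ^ 2 - d f ^ 2) = Real.cos (2 * δ) ^ k

theorem isIdealCoeff_zero (r : ℕ) (δ : ℝ) :
    IsIdealCoeff (r := r) 0 δ (fun f => if f = fun _ => false then 1 else 0) (fun _ => 0) where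
  unused f j _ hj := by
    have : f ≠ fun _ => false := fun h => by simp [h] at hj
    simp [this]
  cross := by simp
  norm := by simp
  diff := by simp

/-- Qubit `i` was still unset, so after the round the two branches are supported on opposite values
of it and the cross term vanishes. This decoherence is what turns the double-angle formula for the
difference of the weights into plain multiplication by `cos 2δ`. -/
theorem IsIdealCoeff.succ {r : ℕ} {δ : ℝ} {i : Fin r} {c d : (Fin r → Bool) → ℝ}
    (h : IsIdealCoeff (i : ℕ) δ c d) :
    IsIdealCoeff (i + 1 : ℕ) δ
      (fun f => c (flipBit i f) * Real.cos δ + d (flipBit i f) * Real.sin δ)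
      (fun f => d f * Real.cos δ - c f * Real.sin δ) := by
  have hsc := Real.sin_sq_add_cos_sq δ
  have hflip : ∀ F : (Fin r → Bool) → ℝ, ∑ f, F (flipBit i f) = ∑ f, F f := fun F =>
    Equiv.sum_comp (flipBit_involutive i).toPerm F
  have e1 := hflip fun f => (c f * Real.cos δ + d f * Real.sin δ) ^ 2
  refine ⟨fun f j hj hf => ?_, Finset.sum_eq_zero fun f _ => ?_, ?_, ?_⟩
  · have hji : j ≠ i := fun hji => by rw [hji] at hj; omega
    have h1 := h.unused f j (by omega) hf
    have h2 := h.unused (flipBit i f) j (by omega) (by simp [flipBit, hji, hf])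
    simp [h1.1, h1.2, h2.1, h2.2]
  · cases hfi : f i
    · have h1 := h.unused (flipBit i f) i le_rfl (by simp [flipBit, hfi])
      simp [h1.1, h1.2]
    · have h1 := h.unused f i le_rfl hfi
      simp [h1.1, h1.2]
  · rw [Finset.sum_add_distrib, e1, ← Finset.sum_add_distrib, ← h.norm]
    refine Finset.sum_congr rfl fun f _ => ?_
    linear_combination (c f ^ 2 + d f ^ 2) * hsc
  · rw [Finset.sum_sub_distrib, e1, ← Finset.sum_sub_distrib, pow_succ, ← h.diff]
    have e2 : ∀ f, (c f * Real.cos δ + d f * Real.sin δ) ^ 2 -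
        (d f * Real.cos δ - c f * Real.sin δ) ^ 2 =
        (c f ^ 2 - d f ^ 2) * Real.cos (2 * δ) + 2 * Real.sin (2 * δ) * (c f * d f) := by
      intro f
      rw [Real.cos_two_mul', Real.sin_two_mul]
      ring
    simp only [e2, Finset.sum_add_distrib]
    rw [← Finset.mul_sum, h.cross, ← Finset.sum_mul]
    ring

/-- The last frame is at angle `π/2 - δ`, so measuring `g` is a further turn by `δ`. It supplies the
exponent `r + 1`, although there are `r` rounds. -/
theorem probMarked_planeState {V : Type*} [Fintype V] [DecidableEq V] {r : ℕ} (π : V → ℝ)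
    (g o : V) (τ : ℕ) {c d : (Fin r → Bool) → ℝ}
    (h : IsIdealCoeff r (Real.pi / (2 * (r + 1))) c d) :
    probMarked g (planeState π g o τ (r * (Real.pi / (2 * (r + 1)))) c d) = idealProb r := by
  have e0 : (r : ℝ) * (Real.pi / (2 * (r + 1))) = Real.pi / 2 - Real.pi / (2 * (r + 1)) := by
    field_simp; ring
  have e1 : Real.pi / (r + 1) = 2 * (Real.pi / (2 * (r + 1))) := by field_simp
  rw [planeState, probMarked_embed, idealProb, e1, e0]
  set δ := Real.pi / (2 * ((r : ℝ) + 1))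
  have hsc := Real.sin_sq_add_cos_sq δ
  have e2 : ∀ f, ‖((c f * planeVec π g (Real.pi / 2 - δ) g +
      d f * planePerp π g (Real.pi / 2 - δ) g : ℝ) : ℂ)‖ ^ 2 =
      ((c f ^ 2 + d f ^ 2) + Real.cos (2 * δ) * (c f ^ 2 - d f ^ 2) +
        2 * Real.sin (2 * δ) * (c f * d f)) / 2 := by
    intro f
    rw [Complex.norm_real, Real.norm_eq_abs, sq_abs, planeVec, planePerp, unmarkedAmplitude_self,
      if_pos rfl, if_pos rfl, Real.cos_pi_div_two_sub, Real.sin_pi_div_two_sub, Real.cos_two_mul',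
      Real.sin_two_mul]
    linear_combination ((c f ^ 2 + d f ^ 2) / 2) * hsc
  simp only [e2]
  rw [← Finset.sum_div, Finset.sum_add_distrib, Finset.sum_add_distrib, ← Finset.mul_sum,
    ← Finset.mul_sum, h.norm, h.cross, h.diff, pow_succ]
  ring

section Loop

variable {V : Type*} [Fintype V] [DecidableEq V] [Nontrivial V] {P : Matrix V V ℝ} {π : V → ℝ}
  {g o : V} {r τ : ℕ} {t : Fin r → ℕ} {G : SimpleGraph V}

omit [Nontrivial V] in
theorem probMarked_initialState (h : IsErgodicReversible G P π) (g o : V) (r τ : ℕ) :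
    probMarked g (initialState π o r τ) = π g := by
  have e : initialState π o r τ =
      embed o τ fun x f => if f = fun _ => false then ((√(π x) : ℝ) : ℂ) else 0 := by
    ext ⟨x, y, l, a, f⟩
    have hl : (l = fun _ => false) ↔ ∀ j, l j = false := funext_iff
    simp only [initialState, embed, Prod.mk.injEq, hl]
    by_cases h1 : y = o <;> by_cases h2 : (∀ j, l j = false) <;> by_cases h3 : a = false <;>
      by_cases h4 : f = (fun _ => false) <;> simp [h1, h2, h3, h4]
  rw [e, probMarked_embed, Finset.sum_eq_single (fun _ => false)]
  · simp [Real.sq_sqrt (h.dist_nonneg g)]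
  · intro f _ hf; simp [hf]
  · simp

omit [Nontrivial V] in
theorem collapse_initialState (h : IsErgodicReversible G P π) (g o : V) (r τ : ℕ) :
    collapse g (initialState π o r τ) =
      planeState π g o τ 0 (fun f => if f = fun _ => false then 1 else 0) (fun _ => 0) := by
  ext ⟨x, y, l, a, f⟩
  have hl : (l = fun _ => false) ↔ ∀ j, l j = false := funext_iff
  rw [collapse, probMarked_initialState h]
  simp only [initialState, embed, planeState, planeVec, unmarkedAmplitude, Prod.mk.injEq, hl,
    Finset.mem_singleton, Finset.sum_singleton, Real.cos_zero, Real.sin_zero]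
  by_cases h1 : y = o <;> by_cases h2 : (∀ j, l j = false) <;> by_cases h3 : a = false <;>
      by_cases h4 : f = (fun _ => false) <;> by_cases h5 : x = g <;> simp [h1, h2, h3, h4, h5]

namespace IsErgodicReversible

variable (h : IsErgodicReversible G P π)

include h

/-- `θ_i < π/2` makes `sin² θ_i < 1`. Strictness matters: at `s = 1` the Dirichlet form of the
interpolated chain would vanish. -/
theorem interpolationParam_lt_one (i : Fin r) : interpolationParam π g r i < 1 := by
  have hr : ((i : ℕ) : ℝ) + 1 ≤ r := by exact_mod_cast i.2
  have hi : (0 : ℝ) ≤ (i : ℕ) := Nat.cast_nonneg _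
  have hg := h.dist_pos g
  have hg1 : 0 < 1 - π g := sub_pos.2 (h.dist_lt_one g)
  set θ := (((i : ℕ) : ℝ) + 1) * Real.pi / (2 * (r + 1)) with hθ
  have h0 : 0 < θ := by have := Real.pi_pos; positivity
  have h1 : θ < Real.pi / 2 := by
    rw [hθ, div_lt_div_iff₀ (by positivity) (by norm_num)]
    nlinarith [Real.pi_pos]
  have hs : 0 < Real.sin θ := Real.sin_pos_of_pos_of_lt_pi h0 (by linarith [Real.pi_pos])
  have hc : 0 < Real.cos θ := Real.cos_pos_of_mem_Ioo ⟨by linarith [Real.pi_pos], h1⟩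
  have hlt : Real.sin θ ^ 2 < 1 := by nlinarith [Real.sin_sq_add_cos_sq θ, pow_pos hc 2]
  rw [interpolationParam, div_lt_one hg1]
  have : π g < π g / Real.sin θ ^ 2 := by
    rw [lt_div_iff₀ (by positivity)]
    nlinarith
  linarith

theorem sqrt_interpDist_interpolationParam (i : Fin r) (x : V) :
    √(interpDist π g (interpolationParam π g r i) x) =
      planeVec π g (((i : ℕ) + 1) * (Real.pi / (2 * (r + 1)))) x := by
  have hr : ((i : ℕ) : ℝ) + 1 ≤ r := by exact_mod_cast i.2
  have hi : (0 : ℝ) ≤ (i : ℕ) := Nat.cast_nonneg _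
  have h0 : 0 < (((i : ℕ) : ℝ) + 1) * (Real.pi / (2 * (r + 1))) := by
    have := Real.pi_pos; positivity
  have h1 : (((i : ℕ) : ℝ) + 1) * (Real.pi / (2 * (r + 1))) < Real.pi / 2 := by
    rw [← mul_div_assoc, div_lt_div_iff₀ (by positivity) (by norm_num)]
    nlinarith [Real.pi_pos]
  rw [← h.sqrt_interpDist_eq_planeVec g
    (Real.sin_pos_of_pos_of_lt_pi h0 (by linarith [Real.pi_pos]))
    (Real.cos_pos_of_mem_Ioo ⟨by linarith [Real.pi_pos], h1⟩), interpolationParam, mul_div_assoc]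

/-- One round of the algorithm approximates a perfect projective measurement. -/
theorem stateNorm_round_planeState_le (R : Realization P g o (interpolationParam π g r) t τ)
    (i : Fin r) (hs : 0 ≤ interpolationParam π g r i) {η : ℝ} (hη0 : 0 ≤ η)
    (ht : walkTail (t i) (2 ^ τ) < 1)
    (hη : ∀ x : ℝ, 0 ≤ x →
      x ≤ 1 - eigenvalueGap (interpolated P g (interpolationParam π g r i)) →
      x ^ t i + walkTail (t i) (2 ^ τ) ≤ η * (1 - walkTail (t i) (2 ^ τ)))
    {c d : (Fin r → Bool) → ℝ} (hcd : IsIdealCoeff (i : ℕ) (Real.pi / (2 * (r + 1))) c d) :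
    ∃ c' d', IsIdealCoeff (i + 1 : ℕ) (Real.pi / (2 * (r + 1))) c' d' ∧
      stateNorm (runCircuit G R (qfsCircuit r τ i)
          (planeState π g o τ ((i : ℕ) * (Real.pi / (2 * (r + 1)))) c d) -
        planeState π g o τ (((i : ℕ) + 1 : ℕ) * (Real.pi / (2 * (r + 1)))) c' d') ≤ 2 * η := by
  have hs1 := h.interpolationParam_lt_one (g := g) i
  set δ := Real.pi / (2 * ((r : ℝ) + 1)) with hδ
  set θ := (((i : ℕ) : ℝ) + 1) * δ with hθ
  have hσ : ∀ x, √(interpDist π g (interpolationParam π g r i) x) = planeVec π g θ x :=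
    h.sqrt_interpDist_interpolationParam i
  have hrot := planeVec_rotate π g ((i : ℕ) * δ) δ
  have hθ' : ((i : ℕ) : ℝ) * δ + δ = θ := by rw [hθ]; ring
  have hθ'' : (((i : ℕ) + 1 : ℕ) : ℝ) * δ = θ := by push_cast; rfl
  refine ⟨_, _, hcd.succ, ?_⟩
  rw [hθ'']
  obtain ⟨u, hu1, hu2⟩ := h.exists_fastForward_eq hs hs1 (R.isWalk i) ht hη
    (v := planePerp π g θ) (by simp only [hσ]; exact h.sum_planeVec_mul_planePerp g θ)
  rw [h.sum_planePerp_sq, mul_one] at hu1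
  have hfix : ∀ a : ℝ, walkOperator G o (R.walk i) *ᵥ
      tensorBase o (fun x => ((a * planeVec π g θ x : ℝ) : ℂ)) =
      tensorBase o (fun x => ((a * planeVec π g θ x : ℝ) : ℂ)) := by
    intro a
    have e : tensorBase o (fun x => ((a * planeVec π g θ x : ℝ) : ℂ)) = (a : ℂ) •
        tensorBase o (fun x => ((√(interpDist π g (interpolationParam π g r i) x) : ℝ) : ℂ)) := by
      rw [← tensorBase_smul]
      congr 1
      ext x
      simp only [Pi.smul_apply, hσ, smul_eq_mul, Complex.ofReal_mul]
    rw [e, Matrix.mulVec_smul, walkOperator_mulVec_stationary (R.isWalk i)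
      (h.sqrt_interpDist_pos g hs hs1) (h.sqrt_interpDist_reversible g hs hs1)
      (h.interpolated_eq_zero g)]
  have hblock := stateNorm_round_sub_le G R i
    (Φ := fun x f => (((c f * Real.cos δ + d f * Real.sin δ) * planeVec π g θ x : ℝ) : ℂ))
    (Ψ := fun x f => (((d f * Real.cos δ - c f * Real.sin δ) * planePerp π g θ x : ℝ) : ℂ))
    (X := fun x f => (((d f * Real.cos δ - c f * Real.sin δ) * u x : ℝ) : ℂ))
    (runCircuit_qff_embed_of_fixed G R i fun f => hfix _) (fun x f => ?_)
  · have e1 : planeState π g o τ ((i : ℕ) * δ) c d = embed o τ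
        ((fun x f => (((c f * Real.cos δ + d f * Real.sin δ) * planeVec π g θ x : ℝ) : ℂ)) +
        fun x f => (((d f * Real.cos δ - c f * Real.sin δ) * planePerp π g θ x : ℝ) : ℂ)) := by
      unfold planeState
      congr 1
      ext x f
      rw [hrot, hθ', Complex.ofReal_add]
      rfl
    have e2 : planeState π g o τ θ
        (fun f => c (flipBit i f) * Real.cos δ + d (flipBit i f) * Real.sin δ)
        (fun f => d f * Real.cos δ - c f * Real.sin δ) = embed o τ fun x f =>
        (((c (flipBit i f) * Real.cos δ + d (flipBit i f) * Real.sin δ) *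
          planeVec π g θ x : ℝ) : ℂ) +
        (((d f * Real.cos δ - c f * Real.sin δ) * planePerp π g θ x : ℝ) : ℂ) := by
      unfold planeState
      congr 1
      ext x f
      rw [Complex.ofReal_add]
    rw [e1, e2]
    refine hblock.trans (mul_le_mul_of_nonneg_left ?_ zero_le_two)
    refine (sq_le_sq₀ (stateNorm_nonneg _) hη0).1 ?_
    rw [stateNorm_embed_sq]
    have e3 : ∀ x f, ‖(((d f * Real.cos δ - c f * Real.sin δ) * u x : ℝ) : ℂ)‖ ^ 2 =
        u x ^ 2 * (d f * Real.cos δ - c f * Real.sin δ) ^ 2 := by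
      intro x f
      rw [Complex.norm_real, Real.norm_eq_abs, sq_abs]; ring
    simp only [e3]
    rw [← Finset.sum_mul_sum]
    have e4 : ∑ f, (d f * Real.cos δ - c f * Real.sin δ) ^ 2 ≤ 1 := by
      rw [← hcd.succ.norm, Finset.sum_add_distrib]
      exact le_add_of_nonneg_left (Finset.sum_nonneg fun f _ => sq_nonneg _)
    have e5 : 0 ≤ ∑ f, (d f * Real.cos δ - c f * Real.sin δ) ^ 2 :=
      Finset.sum_nonneg fun f _ => sq_nonneg _
    calc _ ≤ η ^ 2 * 1 := mul_le_mul hu1 e4 e5 (sq_nonneg _)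
      _ = _ := mul_one _
  · rw [runCircuit_qff_embed_apply G R i ht.le]
    have e : tensorBase o (fun x =>
        (((d f * Real.cos δ - c f * Real.sin δ) * planePerp π g θ x : ℝ) : ℂ)) =
        ((d f * Real.cos δ - c f * Real.sin δ : ℝ) : ℂ) •
          tensorBase o (fun x => (planePerp π g θ x : ℂ)) := by
      rw [← tensorBase_smul]
      congr 1
      ext x
      simp
    simp only [e, Matrix.mulVec_smul, Pi.smul_apply, smul_eq_mul]
    rw [Complex.ofReal_mul, ← hu2, Finset.mul_sum]
    exact Finset.sum_congr rfl fun n _ => by ring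

/-- The success amplitude of the loop differs by at most `2 r η` from the ideal one. -/
theorem abs_sqrt_loopSuccessProb_sub_le (R : Realization P g o (interpolationParam π g r) t τ)
    (hs : ∀ i, 0 ≤ interpolationParam π g r i) {η : ℝ} (hη0 : 0 ≤ η)
    (ht : ∀ i, walkTail (t i) (2 ^ τ) < 1)
    (hη : ∀ i, ∀ x : ℝ, 0 ≤ x →
      x ≤ 1 - eigenvalueGap (interpolated P g (interpolationParam π g r i)) →
      x ^ t i + walkTail (t i) (2 ^ τ) ≤ η * (1 - walkTail (t i) (2 ^ τ))) :
    |√(loopSuccessProb G π R) - √(idealProb r)| ≤ r * (2 * η) := by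
  -- Hybrid argument: later rounds preserve the norm of the error made so far, so each round adds at
  -- most `2η`.
  have key : ∀ k ≤ r, ∃ c d, IsIdealCoeff k (Real.pi / (2 * (r + 1))) c d ∧
      stateNorm (runCircuit G R (((List.finRange r).take k).flatMap (qfsCircuit r τ))
        (collapse g (initialState π o r τ)) -
        planeState π g o τ (k * (Real.pi / (2 * (r + 1)))) c d) ≤ k * (2 * η) := by
    intro k
    induction k with
    | zero =>
      intro _
      refine ⟨_, _, isIdealCoeff_zero r _, ?_⟩
      rw [collapse_initialState h]
      simp [runCircuit_nil, stateNorm]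
    | succ k ih =>
      intro hk
      obtain ⟨c, d, hcd, hn⟩ := ih (by omega)
      obtain ⟨c', d', hcd', hn'⟩ := h.stateNorm_round_planeState_le R ⟨k, hk⟩ (hs _) hη0 (ht _)
        (hη _) hcd
      refine ⟨c', d', hcd', ?_⟩
      have e1 : ((List.finRange r).take (k + 1)).flatMap (qfsCircuit r τ) =
          ((List.finRange r).take k).flatMap (qfsCircuit r τ) ++ qfsCircuit r τ ⟨k, hk⟩ := by
        rw [List.take_succ_eq_append_getElem (by simpa using hk), List.flatMap_append]
        simp
      rw [e1, runCircuit_append]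
      rw [← stateNorm_runCircuit G R (qfsCircuit r τ ⟨k, hk⟩), runCircuit_sub] at hn
      have e2 := stateNorm_add_le _ _ |>.trans (add_le_add hn hn')
      rw [sub_add_sub_cancel] at e2
      refine e2.trans (le_of_eq ?_)
      push_cast; ring
  obtain ⟨c, d, hcd, hn⟩ := key r le_rfl
  rw [List.take_of_length_le (by simp)] at hn
  rw [← probMarked_planeState π g o τ hcd]
  exact (abs_sqrt_probMarked_sub_le g _ _).trans hn

end IsErgodicReversible

end Loop

/-! ### The parameters of the algorithm -/

theorem le_two_pow_registerSize {Γ : ℝ} (hΓ : 0 < Γ) : Γ ≤ 2 ^ registerSize Γ := by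
  calc Γ = (2 : ℝ) ^ Real.logb 2 Γ := (Real.rpow_logb (by norm_num) (by norm_num) hΓ).symm
    _ ≤ (2 : ℝ) ^ (registerSize Γ : ℝ) :=
      Real.rpow_le_rpow_of_exponent_le (by norm_num) (Nat.le_ceil _)
    _ = _ := Real.rpow_natCast _ _

theorem registerSize_le {Γ : ℝ} (hΓ : 1 ≤ Γ) : (registerSize Γ : ℝ) ≤ Real.logb 2 Γ + 1 :=
  (Nat.ceil_lt_add_one (Real.logb_nonneg (by norm_num) hΓ)).le

theorem two_pow_registerSize_le {Γ : ℝ} (hΓ : 1 ≤ Γ) : (2 : ℝ) ^ registerSize Γ ≤ 2 * Γ := by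
  calc (2 : ℝ) ^ registerSize Γ = (2 : ℝ) ^ (registerSize Γ : ℝ) := (Real.rpow_natCast _ _).symm
    _ ≤ (2 : ℝ) ^ (Real.logb 2 Γ + 1) :=
      Real.rpow_le_rpow_of_exponent_le (by norm_num) (registerSize_le hΓ)
    _ = 2 * Γ := by
      rw [Real.rpow_add_one (by norm_num), Real.rpow_logb (by norm_num) (by norm_num) (by linarith),
        mul_comm]

/-- The constant in the lower bound on `Γ`. -/
noncomputable def registerConst (r : ℕ) : ℝ :=
  2 * (1 + Real.log (16 * r)) * (9 + 8 * Real.log (2 * r))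

theorem log_mul_natCast_nonneg {a : ℝ} (ha : 1 ≤ a) (r : ℕ) : 0 ≤ Real.log (a * r) := by
  rcases Nat.eq_zero_or_pos r with rfl | hr
  · simp
  · have : (1 : ℝ) ≤ r := by exact_mod_cast hr
    exact Real.log_nonneg (by nlinarith)

theorem one_le_registerConst (r : ℕ) : 1 ≤ registerConst r := by
  have h1 := log_mul_natCast_nonneg (a := 16) (by norm_num) r
  have h2 := log_mul_natCast_nonneg (a := 2) (by norm_num) r
  unfold registerConst
  nlinarith [mul_nonneg h1 h2]

section Parameters

variable {V : Type*} [Fintype V] [DecidableEq V] [Nontrivial V] {G : SimpleGraph V}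
  {P : Matrix V V ℝ} {π : V → ℝ} {g o : V} {r : ℕ} {ε Γ : ℝ}

namespace IsErgodicReversible

variable (h : IsErgodicReversible G P π)

include h

theorem log_mul_sqrt_ge {B : ℝ} (hB0 : 0 ≤ B) (hε0 : 0 < ε) (hε : ε ≤ Real.exp (-B)) :
    B ≤ Real.log ε⁻¹ ∧ B ≤ Real.log ε⁻¹ * √(maxHittingTime P π) := by
  have h1 : B ≤ Real.log ε⁻¹ := by
    rw [Real.log_inv, le_neg, ← Real.log_exp (-B)]
    exact Real.log_le_log hε0 hε
  have h2 : 1 ≤ √(maxHittingTime P π) := Real.one_le_sqrt.2 h.one_le_maxHittingTime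
  exact ⟨h1, h1.trans (le_mul_of_one_le_right (hB0.trans h1) h2)⟩

variable (hr : 1 ≤ r) (hε0 : 0 < ε) (hε : ε ≤ Real.exp (-6))
  (hs : ∀ i : Fin r, 0 ≤ interpolationParam π g r i)

include hr hε0 hε hs

theorem fastForwardSteps_bounds (i : Fin r) :
    (0 : ℝ) < fastForwardSteps P π g r ε i ∧
    2 * Real.log (2 * r / ε) ≤
      eigenvalueGap (interpolated P g (interpolationParam π g r i)) *
        fastForwardSteps P π g r ε i ∧
    (fastForwardSteps P π g r ε i : ℝ) ≤
      maxHittingTime P π * Real.log ε⁻¹ * (9 + 8 * Real.log (2 * r)) := by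
  have hr' : (1 : ℝ) ≤ r := by exact_mod_cast hr
  have hHT := h.one_le_maxHittingTime
  have hgap := h.eigenvalueGap_interpolated_ge g (hs i) (h.interpolationParam_lt_one i)
  have hgap0 := h.eigenvalueGap_interpolated_pos g (hs i) (h.interpolationParam_lt_one i)
  set Δ := eigenvalueGap (interpolated P g (interpolationParam π g r i)) with hΔ
  have hL := (h.log_mul_sqrt_ge (by norm_num) hε0 hε).1
  have hlog2 := log_mul_natCast_nonneg (a := 2) (by norm_num) r
  have hlog : Real.log (2 * r / ε) = Real.log (2 * r) + Real.log ε⁻¹ := by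
    rw [div_eq_mul_inv, Real.log_mul (by positivity) (by positivity)]
  have hlog0 : 0 < Real.log (2 * r / ε) := by rw [hlog]; linarith
  have hx0 : 0 < 2 / Δ * Real.log (2 * r / ε) := by positivity
  have hceil : 2 / Δ * Real.log (2 * r / ε) ≤ fastForwardSteps P π g r ε i := Nat.le_ceil _
  refine ⟨hx0.trans_le hceil, ?_, ?_⟩
  · calc 2 * Real.log (2 * r / ε) = Δ * (2 / Δ * Real.log (2 * r / ε)) := by field_simp
      _ ≤ _ := mul_le_mul_of_nonneg_left hceil hgap0.le
  · have h1 : (fastForwardSteps P π g r ε i : ℝ) ≤ 2 / Δ * Real.log (2 * r / ε) + 1 :=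
      (Nat.ceil_lt_add_one hx0.le).le
    have h2 : 2 / Δ ≤ 8 * maxHittingTime P π := by
      rw [div_le_iff₀ hgap0]
      rw [div_le_iff₀ (by positivity)] at hgap
      linarith
    have h3 : Real.log (2 * r / ε) ≤ Real.log ε⁻¹ * (1 + Real.log (2 * r)) := by
      rw [hlog]; nlinarith
    have h4 : 2 / Δ * Real.log (2 * r / ε) ≤
        8 * maxHittingTime P π * (Real.log ε⁻¹ * (1 + Real.log (2 * r))) :=
      mul_le_mul h2 h3 hlog0.le (by positivity)
    -- Absorbs the `1` lost in rounding up, which turns the coefficient `8` into `9`.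
    have h5 : 1 ≤ maxHittingTime P π * Real.log ε⁻¹ := by nlinarith
    calc _ ≤ _ := h1
      _ ≤ 8 * maxHittingTime P π * (Real.log ε⁻¹ * (1 + Real.log (2 * r))) +
          maxHittingTime P π * Real.log ε⁻¹ := add_le_add h4 h5
      _ = _ := by ring

/-- In Hoeffding's bound `2 exp(-N²/(2t))`, `N²` is of order `HT log²(1/ε)` or more while `t` is at
most of order `HT log(1/ε)`. The exponent thus gains a factor `log(1/ε)`, and `registerConst` is
sized to bring it to `log(16 r) + log(1/ε)`. -/
theorem walkTail_fastForwardSteps_le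
    (hΓ : registerConst r * (Real.log ε⁻¹ * √(maxHittingTime P π)) ≤ Γ) (i : Fin r) :
    walkTail (fastForwardSteps P π g r ε i) (2 ^ registerSize Γ) ≤ ε / (8 * r) := by
  have hr' : (1 : ℝ) ≤ r := by exact_mod_cast hr
  have hHT := h.one_le_maxHittingTime
  obtain ⟨hL, hX⟩ := h.log_mul_sqrt_ge (by norm_num) hε0 hε
  obtain ⟨ht0, -, ht⟩ := h.fastForwardSteps_bounds hr hε0 hε hs i
  have hκ := one_le_registerConst r
  have hl2 := log_mul_natCast_nonneg (a := 2) (by norm_num) r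
  have hl16 := log_mul_natCast_nonneg (a := 16) (by norm_num) r
  have hX0 : 0 ≤ Real.log ε⁻¹ * √(maxHittingTime P π) := by linarith
  have hΓ0 : 0 < Γ := by nlinarith
  have hN := le_two_pow_registerSize hΓ0
  refine (walkTail_le _ _).trans ?_
  have hexp : (1 + Real.log (16 * r)) * Real.log ε⁻¹ ≤
      (((2 ^ registerSize Γ : ℕ) : ℝ)) ^ 2 / (2 * fastForwardSteps P π g r ε i) := by
    rw [le_div_iff₀ (by positivity)]
    have h1 : registerConst r * (Real.log ε⁻¹ ^ 2 * maxHittingTime P π) ≤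
        (((2 ^ registerSize Γ : ℕ) : ℝ)) ^ 2 := by
      -- Squaring the constant is more than is needed; since it is at least `1`, its first power
      -- suffices below.
      calc _ ≤ registerConst r ^ 2 * (Real.log ε⁻¹ ^ 2 * maxHittingTime P π) := by
            refine mul_le_mul_of_nonneg_right ?_ (by positivity)
            nlinarith
        _ = (registerConst r * (Real.log ε⁻¹ * √(maxHittingTime P π))) ^ 2 := by
            rw [mul_pow, mul_pow, Real.sq_sqrt (by linarith)]
        _ ≤ _ := by
            push_cast
            exact pow_le_pow_left₀ (by positivity) (hΓ.trans hN) 2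
    refine le_trans ?_ h1
    calc _ ≤ (1 + Real.log (16 * r)) * Real.log ε⁻¹ *
          (2 * (maxHittingTime P π * Real.log ε⁻¹ * (9 + 8 * Real.log (2 * r)))) := by
            refine mul_le_mul_of_nonneg_left (by linarith) ?_
            exact mul_nonneg (by linarith) (by linarith)
      _ = _ := by unfold registerConst; ring
  have h2 : Real.exp (-(Real.log (16 * r) + Real.log ε⁻¹)) = ε / (16 * r) := by
    rw [← Real.log_mul (by positivity) (by positivity), ← Real.log_inv,
      Real.exp_log (by positivity), mul_inv, inv_inv]
    field_simp
  calc _ ≤ 2 * Real.exp (-(Real.log (16 * r) + Real.log ε⁻¹)) := by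
        gcongr
        refine le_trans ?_ hexp
        nlinarith
    _ = _ := by rw [h2]; field_simp; norm_num

/-- The success amplitude of the loop is within `ε` of the ideal one. -/
theorem abs_sqrt_loopSuccessProb_sub_sqrt_idealProb_le
    (hΓ : registerConst r * (Real.log ε⁻¹ * √(maxHittingTime P π)) ≤ Γ)
    (R : Realization P g o (interpolationParam π g r) (fastForwardSteps P π g r ε)
      (registerSize Γ)) :
    |√(loopSuccessProb G π R) - √(idealProb r)| ≤ ε := by
  have hr' : (1 : ℝ) ≤ r := by exact_mod_cast hr
  have hε1 : ε ≤ 1 / 2 := by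
    refine hε.trans ?_
    rw [Real.exp_neg, inv_le_comm₀ (Real.exp_pos _) (by norm_num)]
    have := Real.add_one_le_exp (6 : ℝ)
    linarith
  have htail := h.walkTail_fastForwardSteps_le (Γ := Γ) hr hε0 hε hs hΓ
  have htail' : ∀ i, walkTail (fastForwardSteps P π g r ε i) (2 ^ registerSize Γ) ≤ 1 / 2 := by
    intro i
    refine (htail i).trans ?_
    rw [div_le_iff₀ (by positivity)]
    linarith
  have hq : ε / (2 * r) ≤ 1 / 4 := by
    rw [div_le_iff₀ (by positivity)]
    linarith
  have hq0 : 0 < ε / (2 * r) := by positivity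
  -- With `η = ε/(2r)` the power is at most `η²`, thanks to the factor `2` in `t`, and the tail is
  -- at most `η/4`. As `η ≤ 1/4` and the tail is at most `1/2`, their sum is at most `η/2 ≤ η(1 -
  -- tail)`. Over all rounds, `r · 2η = ε`.
  refine (h.abs_sqrt_loopSuccessProb_sub_le R hs (η := ε / (2 * r)) (by positivity)
    (fun i => (htail' i).trans_lt (by norm_num)) fun i x hx0 hx => ?_).trans (le_of_eq ?_)
  · obtain ⟨-, ht, -⟩ := h.fastForwardSteps_bounds hr hε0 hε hs i
    have h1 : x ^ fastForwardSteps P π g r ε i ≤ (ε / (2 * r)) ^ 2 := by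
      set Δ := eigenvalueGap (interpolated P g (interpolationParam π g r i))
      have hx' : x ≤ Real.exp (-Δ) := hx.trans (by linarith [Real.add_one_le_exp (-Δ)])
      calc _ ≤ Real.exp (-Δ) ^ fastForwardSteps P π g r ε i := pow_le_pow_left₀ hx0 hx' _
        _ = Real.exp (-(Δ * fastForwardSteps P π g r ε i)) := by
            rw [← Real.exp_nat_mul]; congr 1; ring
        _ ≤ Real.exp (-(2 * Real.log (2 * r / ε))) := by gcongr
        _ = (ε / (2 * r)) ^ 2 := by
            rw [show -(2 * Real.log (2 * r / ε)) = ((2 : ℕ) : ℝ) * -Real.log (2 * r / ε) by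
              push_cast; ring, Real.exp_nat_mul, ← Real.log_inv, Real.exp_log (by positivity),
              inv_div]
    have h2 := htail i
    have e : ε / (8 * r) = ε / (2 * r) / 4 := by field_simp; norm_num
    rw [e] at h2
    have h3 := htail' i
    nlinarith
  · field_simp

end IsErgodicReversible

end Parameters

/-! ### Costs -/

section Cost

variable {r τ : ℕ} (U C : ℝ)

theorem sum_map_cost_flatMap {α : Type*} (l : List α) (c : α → List (Gate r τ)) :
    ((l.flatMap c).map (Gate.cost U C)).sum =
      (l.map fun a => ((c a).map (Gate.cost U C)).sum).sum := by
  induction l with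
  | nil => rfl
  | cons a l ih => rw [List.flatMap_cons, List.map_append, List.sum_append, ih]; rfl

theorem cost_flatMap_replicate {γ : Fin τ → Gate r τ} (hγ : ∀ j, (γ j).cost U C = U + C) :
    (((List.finRange τ).flatMap fun j : Fin τ => List.replicate (2 ^ (j : ℕ)) (γ j)).map
      (Gate.cost U C)).sum = (2 ^ τ - 1) * (U + C) := by
  have h1 : ∑ j : Fin τ, (2 : ℝ) ^ (j : ℕ) = 2 ^ τ - 1 := by
    rw [Fin.sum_univ_eq_sum_range (fun n => (2 : ℝ) ^ n), geom_sum_eq (by norm_num)]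
    norm_num
  rw [sum_map_cost_flatMap, ← Fin.sum_univ_def, ← h1, Finset.sum_mul]
  refine Finset.sum_congr rfl fun j _ => ?_
  simp [hγ, mul_add]

theorem cost_qfsCircuit (i : Fin r) :
    ((qfsCircuit r τ i).map (Gate.cost U C)).sum = 2 * (2 ^ τ - 1) * (U + C) := by
  have h1 := cost_flatMap_replicate (r := r) (τ := τ) U C (γ := fun j => .ctrlWalk i j)
    fun _ => rfl
  have h2 := cost_flatMap_replicate (r := r) (τ := τ) U C (γ := fun j => .ctrlWalkInv i j)
    fun _ => rfl
  have h3 : ((ctrlInvCircuit r τ i).map (Gate.cost U C)).sum = (2 ^ τ - 1) * (U + C) := by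
    rw [← h2, sum_map_cost_flatMap, ctrlInvCircuit, sum_map_cost_flatMap, List.map_reverse,
      List.sum_reverse]
  change ((ctrlCircuit r τ i).map (Gate.cost U C)).sum = _ at h1
  simp only [qfsCircuit, qffCircuit, qffInvCircuit, List.map_append, List.sum_append, h1, h3]
  simp [Gate.cost]
  ring

theorem searchCost_eq (S : ℝ) :
    searchCost r τ S U C = S + (C + r * (2 * (2 ^ τ - 1) * (U + C))) := by
  rw [searchCost, searchCircuit, sum_map_cost_flatMap]
  simp [cost_qfsCircuit]

end Cost

/-! ### Proof of the main theorem. -/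

theorem exp_neg_six_le : Real.exp (-6) ≤ 1 / 200 := by
  rw [Real.exp_neg, inv_le_comm₀ (Real.exp_pos _) (by norm_num)]
  have h1 : (2.7 : ℝ) ≤ Real.exp 1 := by linarith [Real.exp_one_gt_d9]
  calc _ ≤ (2.7 : ℝ) ^ 6 := by norm_num
    _ ≤ Real.exp 1 ^ 6 := by gcongr
    _ = _ := by rw [← Real.exp_nat_mul]; norm_num

theorem theorem2 :
    ∃ ε₀ : ℝ, 0 < ε₀ ∧ ε₀ < 1 ∧ ∃ κ : ℕ → ℝ, (∀ r, 0 < κ r) ∧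
    -- success probability, complexity and number of ancilla qubits
    (∀ r : ℕ, 1 ≤ r → ∀ K : ℝ, κ r ≤ K → ∃ c₁ c₂ : ℝ, 0 < c₁ ∧ 0 < c₂ ∧
      ∀ (V : Type*) [Fintype V] [DecidableEq V] [Nontrivial V]
        (G : SimpleGraph V) (P : Matrix V V ℝ) (π : V → ℝ) (g o : V),
        IsErgodicReversible G P π →
        (∀ i : Fin r, interpolationParam π g r i ∈ Set.Icc (0 : ℝ) 1) →
        ∀ ε : ℝ, 0 < ε → ε ≤ ε₀ →
        ∀ Γ : ℝ, κ r * (Real.log ε⁻¹ * √(maxHittingTime P π)) ≤ Γ →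
          Γ ≤ K * (Real.log ε⁻¹ * √(maxHittingTime P π)) →
          (∀ R : Realization P g o (interpolationParam π g r) (fastForwardSteps P π g r ε)
              (registerSize Γ),
            Real.cos (Real.pi / (2 * (r + 1))) ^ (r + 1) - ε ≤ √(loopSuccessProb G π R) ∧
            (10 ≤ r → 4 / 5 < loopSuccessProb G π R ∧ 4 / 5 < successProb G π R)) ∧
          (∀ S U C : ℝ, 0 ≤ S → 0 ≤ U → 0 ≤ C →
            S + c₁ * (Real.log ε⁻¹ * √(maxHittingTime P π)) * (U + C) ≤
              searchCost r (registerSize Γ) S U C ∧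
            searchCost r (registerSize Γ) S U C ≤
              S + c₂ * (Real.log ε⁻¹ * √(maxHittingTime P π)) * (U + C)) ∧
          c₁ * (Real.log (Real.log ε⁻¹) + Real.log (√(maxHittingTime P π))) ≤
            ancillaQubits r (registerSize Γ) ∧
          ancillaQubits r (registerSize Γ) ≤
            c₂ * (Real.log (Real.log ε⁻¹) + Real.log (√(maxHittingTime P π)))) ∧
    -- the success probability increases with the number of rounds
    (∀ r : ℕ, 1 ≤ r → ∃ ε₁ : ℝ, 0 < ε₁ ∧ ∀ r' : ℕ, r < r' →
      ∀ (V : Type*) [Fintype V] [DecidableEq V] [Nontrivial V]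
        (G : SimpleGraph V) (P : Matrix V V ℝ) (π : V → ℝ) (g o : V),
        IsErgodicReversible G P π →
        (∀ i : Fin r, interpolationParam π g r i ∈ Set.Icc (0 : ℝ) 1) →
        (∀ i : Fin r', interpolationParam π g r' i ∈ Set.Icc (0 : ℝ) 1) →
        ∀ ε : ℝ, 0 < ε → ε ≤ ε₁ →
        ∀ Γ Γ' : ℝ, κ r * (Real.log ε⁻¹ * √(maxHittingTime P π)) ≤ Γ →
          κ r' * (Real.log ε⁻¹ * √(maxHittingTime P π)) ≤ Γ' →
        ∀ (R : Realization P g o (interpolationParam π g r) (fastForwardSteps P π g r ε)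
            (registerSize Γ))
          (R' : Realization P g o (interpolationParam π g r') (fastForwardSteps P π g r' ε)
            (registerSize Γ')),
          loopSuccessProb G π R < loopSuccessProb G π R' ∧
          successProb G π R < successProb G π R') ∧
    -- the guaranteed success amplitude increases with the number of rounds, and tends to 1
    StrictMono (fun r : ℕ => Real.cos (Real.pi / (2 * (r + 1))) ^ (r + 1)) ∧
    Filter.Tendsto (fun r : ℕ => Real.cos (Real.pi / (2 * (r + 1))) ^ (r + 1)) Filter.atTop
      (nhds 1) := by
  -- `ε ≤ e⁻⁶` serves twice: the amplitude loses at most `1/200`, and `log(1/ε) ≥ 6` keeps the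
  -- double logarithm at least `1`, so that additive constants can be absorbed.
  refine ⟨Real.exp (-6), Real.exp_pos _, exp_neg_six_le.trans_lt (by norm_num), registerConst,
    fun r => zero_lt_one.trans_le (one_le_registerConst r), fun r hr K hK => ?_, fun r hr => ?_,
    strictMono_cos_pow, tendsto_cos_pow⟩
  · have hr' : (1 : ℝ) ≤ r := by exact_mod_cast hr
    have hκ := one_le_registerConst r
    have hK1 : 1 ≤ K := hκ.trans hK
    have hlogK := Real.log_nonneg hK1
    -- The first bracket of the upper constant serves the cost, the second the ancilla count.
    refine ⟨1, (1 + 4 * r * K) + (4 + 2 * Real.log K + r), one_pos, by positivity, ?_⟩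
    intro V _ _ _ G P π g o h hs ε hε0 hε Γ hΓ hΓK
    obtain ⟨hL, hX⟩ := h.log_mul_sqrt_ge (by norm_num) hε0 hε
    have hs0 : ∀ i : Fin r, 0 ≤ interpolationParam π g r i := fun i => (hs i).1
    have hHT1 : 1 ≤ √(maxHittingTime P π) := Real.one_le_sqrt.2 h.one_le_maxHittingTime
    have hlogX : Real.log (Real.log ε⁻¹) + Real.log (√(maxHittingTime P π)) =
        Real.log (Real.log ε⁻¹ * √(maxHittingTime P π)) :=
      (Real.log_mul (by linarith) (by linarith)).symm
    rw [hlogX]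
    refine ⟨fun R => ?_, ?_⟩
    · have hclose := abs_le.1
        (h.abs_sqrt_loopSuccessProb_sub_sqrt_idealProb_le hr hε0 hε hs0 hΓ R)
      refine ⟨by linarith [cos_pow_le_sqrt_idealProb hr], fun h10 => ?_⟩
      have h1 : (9 / 10 : ℝ) ≤ √(idealProb r) := by
        refine Real.le_sqrt_of_sq_le ?_
        linarith [idealProb_ten, idealProb_le (by norm_num) h10]
      have h2 : (895 / 1000 : ℝ) ≤ √(loopSuccessProb G π R) := by
        linarith [exp_neg_six_le]
      have h3 : 4 / 5 < loopSuccessProb G π R := by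
        have h4 : √(loopSuccessProb G π R) ^ 2 = loopSuccessProb G π R :=
          Real.sq_sqrt (probMarked_nonneg _ _)
        nlinarith
      refine ⟨h3, ?_⟩
      rw [successProb, probMarked_initialState h]
      -- The overall probability is the average of `1` and `p_succ` with weights `π_g` and `1 -
      -- π_g`.
      nlinarith [h.dist_pos g, h.dist_lt_one g]
    · set X := Real.log ε⁻¹ * √(maxHittingTime P π) with hXdef
      have hX1 : X ≤ Γ := (le_mul_of_one_le_left (by linarith) hκ).trans hΓ
      have hΓ1 : 1 ≤ Γ := by linarith
      have hN1 := le_two_pow_registerSize (by linarith : 0 < Γ)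
      have hN2 := two_pow_registerSize_le hΓ1
      have hlog1 : 1 ≤ Real.log X := by
        rw [Real.le_log_iff_exp_le (by linarith)]
        linarith [Real.exp_one_lt_d9]
      refine ⟨fun S U C hS hU hC => ?_, ?_, ?_⟩
      · rw [searchCost_eq]
        have hUC : 0 ≤ U + C := add_nonneg hU hC
        have hNr : 2 * ((2 : ℝ) ^ registerSize Γ - 1) ≤
            r * (2 * ((2 : ℝ) ^ registerSize Γ - 1)) :=
          le_mul_of_one_le_left (by linarith) hr'
        -- The subtracted `1` is harmless, since `2(N - 1) ≥ N` for `N ≥ 2`, and here `N ≥ X ≥ 6`.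
        have hrX : X ≤ r * (2 * ((2 : ℝ) ^ registerSize Γ - 1)) := by linarith
        constructor
        · have := mul_le_mul_of_nonneg_right hrX hUC
          linarith
        · have h1 : r * (2 * ((2 : ℝ) ^ registerSize Γ - 1)) ≤ r * (4 * (K * X)) := by
            refine mul_le_mul_of_nonneg_left ?_ (by linarith)
            linarith
          have h2 : 1 + r * (2 * ((2 : ℝ) ^ registerSize Γ - 1)) ≤
              (1 + 4 * r * K + (4 + 2 * Real.log K + r)) * X := by
            have : 0 ≤ (4 + 2 * Real.log K + r) * X := by positivity
            linarith
          have h3 := mul_le_mul_of_nonneg_right h2 hUC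
          linarith
      · have h1 : Real.log X ≤ registerSize Γ := by
          have h2 : Real.log Γ ≤ registerSize Γ * Real.log 2 := by
            rw [← Real.log_pow]
            exact Real.log_le_log (by linarith) hN1
          have h3 := Real.log_le_log (by linarith) hX1
          have h4 : (registerSize Γ : ℝ) * Real.log 2 ≤ registerSize Γ :=
            mul_le_of_le_one_right (Nat.cast_nonneg _) (by linarith [Real.log_two_lt_d9])
          linarith
        unfold ancillaQubits
        push_cast
        linarith
      · have h1 := registerSize_le hΓ1
        have h2 : Real.logb 2 Γ ≤ 2 * Real.log Γ := by
          rw [Real.logb, div_le_iff₀ (Real.log_pos (by norm_num))]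
          have := Real.log_nonneg hΓ1
          nlinarith [Real.log_two_gt_d9]
        have h3 : Real.log Γ ≤ Real.log K + Real.log X := by
          rw [← Real.log_mul (by linarith) (by linarith)]
          exact Real.log_le_log (by linarith) hΓK
        have h4 : (registerSize Γ : ℝ) + 1 + r ≤ (4 + 2 * Real.log K + r) * Real.log X := by
          nlinarith
        have h5 : 0 ≤ (1 + 4 * r * K) * Real.log X := by positivity
        unfold ancillaQubits
        push_cast
        linarith
  · have hlt : √(idealProb r) < √(idealProb (r + 1)) :=
      Real.sqrt_lt_sqrt (idealProb_nonneg hr) (idealProb_lt_succ hr)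
    -- Both amplitudes err by at most `ε`, so a third of the gap keeps them apart. By monotonicity
    -- the gap to `r + 1` suffices for every `r' > r`, which makes `ε₁` independent of `r'`.
    refine ⟨min (Real.exp (-6)) ((√(idealProb (r + 1)) - √(idealProb r)) / 3),
      lt_min (Real.exp_pos _) (by linarith), ?_⟩
    intro r' hrr' V _ _ _ G P π g o h hs hs' ε hε0 hε Γ Γ' hΓ hΓ' R R'
    have h1 := abs_le.1 (h.abs_sqrt_loopSuccessProb_sub_sqrt_idealProb_le hr hε0
      (hε.trans (min_le_left _ _)) (fun i => (hs i).1) hΓ R)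
    have h2 := abs_le.1 (h.abs_sqrt_loopSuccessProb_sub_sqrt_idealProb_le (hr.trans hrr'.le) hε0
      (hε.trans (min_le_left _ _)) (fun i => (hs' i).1) hΓ' R')
    have h3 : √(idealProb (r + 1)) ≤ √(idealProb r') :=
      Real.sqrt_le_sqrt (idealProb_le (by omega) hrr')
    have h4 := hε.trans (min_le_right _ _)
    have h5 : √(loopSuccessProb G π R) < √(loopSuccessProb G π R') := by linarith
    replace h5 := (Real.sqrt_lt_sqrt_iff (probMarked_nonneg _ _)).1 h5
    change loopSuccessProb G π R < loopSuccessProb G π R' at h5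
    refine ⟨h5, ?_⟩
    rw [successProb, successProb, probMarked_initialState h, probMarked_initialState h]
    have := mul_lt_mul_of_pos_left h5 (sub_pos.2 (h.dist_lt_one g))
    linarith
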